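/- **Notation.** For a monic polynomial $p$ of degree $d$ with real coefficients write $p(x)=\sum_{k=0}^d(-1)^k\binom dk \tilde e_k(p)\,x^{d-k}$, let $m_n(p)=\frac1d\sum_{i=1}^d\lambda_i^n$, where $\lambda_1,\dots,\lambda_d$ are its complex roots with multiplicity, and let $p\boxtimes_d q$ be the polynomial with $\tilde e_k(p\boxtimes_d q)=\tilde e_k(p)\tilde e_k(q)$ for $0\le k\le d$. The finite free cumulants of $p$ are, for $1\le n\le d$, $$\kappa_n(p)=\frac{(-d)^{n-1}}{(n-1)!}\sum_{\pi\in P(n)}(-1)^{|\pi|-1}(|\pi|-1)!\prod_{V\in\pi}\tilde e_{|V|}(p),$$ where $P(n)$ is the set of all partitions of $[n]=\{1,\dots,n\}$. For a sequence $u=(u_n)_{n\ge1}$ put $u_\pi=\prod_{V\in\pi}u_{|V|}$ for a partition $\pi$, let $u_{\pi\setminus V}$ be the same product over the blocks other than $V$, and put $u_\sigma=\prod_{c}u_{|c|}$ over all cycles $c$ (fixed points included) of a permutation $\sigma$. Let $NC(n)$ be the set of non-crossing partitions of $[n]$, and let $Kr(\pi)=\pi^{-1}\gamma_n$, $\gamma_n=(1,\dots,n)$,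 be the Kreweras complement, where partitions are read as permutations whose cycles are the blocks in increasing order, and conversely. For $t,s\ge1$ let $\gamma_{t,s}=(1,\dots,t)(t+1,\dots,t+s)$, let $S_{NC}(t,s)$ be the set of $\sigma\in S_{t+s}$ such that $\langle\sigma,\gamma_{t,s}\rangle$ is transitive and $\sigma$ and $Kr_{t,s}(\sigma):=\sigma^{-1}\gamma_{t,s}$ together have $t+s$ cycles. For a probability measure $\mu$ on $\mathbb R$ with finite moments $m_n(\mu)$ of all orders, the free cumulants $r_n(\mu)$ are defined by $m_n(\mu)=\sum_{\pi\in NC(n)}r_\pi(\mu)$, $n\ge1$. The free multiplicative convolution $\mu\boxtimes\nu$ is given by its free cumulants $r_n(\mu\boxtimes\nu)=\sum_{\pi\in NC(n)}r_\pi(\mu)\,r_{Kr(\pi)}(\nu)$, and $m_n(\mu\boxtimes\nu)=\sum_{\pi\in NC(n)}r_\pi(\mu\boxtimes\nu)$; these are the moments of any probability measure with finite moments of all orders and with these free cumulants. A sequence $\mathfrak p=(p_d)_{d\ge1}$ of monic real-rooted polynomials, $\deg p_d=d$, has infinitesimal distribution $(\mu,\mu')$, where $\mu$ is a probability measure on $\mathbb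 R$ with finite moments of all orders and $\mu':\mathbb R[x]\to\mathbb R$ is linear, if for all $n\ge0$ one has $m_n(p_d)\to m_n(\mu)$ and $d\,(m_n(p_d)-m_n(\mu))\to\mu'(x^n)=:m_n'(\mathfrak p)$ as $d\to\infty$. **Theorem.** Let $\mathfrak p=(p_d)_{d\ge1}$ and $\mathfrak q=(q_d)_{d\ge1}$ be sequences of monic real-rooted polynomials, $\deg p_d=\deg q_d=d$, with infinitesimal distributions $(\mu,\mu')$ and $(\nu,\nu')$, respectively. Then there are numbers $\hat r_n(\mathfrak q)$, $n\ge1$, not depending on $d$, with $\kappa_n(q_d)=r_n(\nu)+\frac1d\hat r_n(\mathfrak q)+o(1/d)$ for every $n\ge1$, and for every $n\ge1$ $$m_n(p_d\boxtimes_d q_d)=m_n(\mu\boxtimes\nu)+\frac1d\,m_n'(\mathfrak p\boxtimes\mathfrak q)+o(1/d)\qquad(d\to\infty),$$ where $$m'_n(\mathfrak p\boxtimes\mathfrak q)=\sum_{\pi\in NC(n)}\Big(\sum_{V\in\pi}m'_{|V|}(\mathfrak p)\,m_{\pi\setminus V}(\mu)\,r_{Kr(\pi)}(\nu)+\sum_{W\in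 Kr(\pi)}m_\pi(\mu)\,\hat r_{|W|}(\mathfrak q)\,r_{Kr(\pi)\setminus W}(\nu)\Big)-\frac n2\sum_{\substack{t+s=n,\ t,s\ge1\\ \sigma\in S_{NC}(t,s)}}\frac{m_\sigma(\mu)\,r_{Kr_{t,s}(\sigma)}(\nu)}{ts}.$$ -/

import Mathlib

open Finset Polynomial Filter MeasureTheory Topology Asymptotics

namespace FiniteFree

/-! ### Set partitions and permutations -/

/-- `SetPartition n` is the set `P(n)` of all partitions of an `n`-element set, modelled on `Fin n`
with its usual order. -/
abbrev SetPartition (n : ℕ) : Type := Finpartition (univ : Finset (Fin n))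

/-- `u_π = ∏_{V ∈ π} u_{|V|}`. -/
def blockProd {n : ℕ} (u : ℕ → ℝ) (π : SetPartition n) : ℝ :=
  ∏ V ∈ π.parts, u #V

/-- `∑_{V ∈ π} a_{|V|} u_{π ∖ V}`, where `u_{π ∖ V}` is the product over the blocks of `π` other
than `V`. -/
def blockDerivSum {n : ℕ} (a u : ℕ → ℝ) (π : SetPartition n) : ℝ :=
  ∑ V ∈ π.parts, a #V * ∏ W ∈ π.parts.erase V, u #W

/-- `π` is non-crossing: if `a < b < c < d` with `a, c ∈ V` and `b, d ∈ W` for blocks `V`, `W`,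
then `V = W`. -/
def IsNonCrossing {n : ℕ} (π : SetPartition n) : Prop :=
  ∀ V ∈ π.parts, ∀ W ∈ π.parts, ∀ a ∈ V, ∀ b ∈ W, ∀ c ∈ V, ∀ d ∈ W,
    a < b → b < c → c < d → V = W

instance {n : ℕ} (π : SetPartition n) : Decidable (IsNonCrossing π) := by
  unfold IsNonCrossing; infer_instance

/-- The set `NC(n)` of non-crossing partitions. -/
def NC (n : ℕ) : Finset (SetPartition n) := univ.filter IsNonCrossing

/-- The partition whose blocks are the cycles (fixed points included) of a permutation. -/
def cyclePartition {n : ℕ} (σ : Equiv.Perm (Fin n)) : SetPartition n :=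
  letI : DecidableRel (Equiv.Perm.SameCycle.setoid σ).r :=
    inferInstanceAs (DecidableRel (Equiv.Perm.SameCycle σ))
  Finpartition.ofSetoid (Equiv.Perm.SameCycle.setoid σ)

/-- The cyclic permutation that runs through the elements of `V` in increasing order and fixes
everything else. -/
def blockCycle {n : ℕ} (V : Finset (Fin n)) : Equiv.Perm (Fin n) :=
  (V.sort (· ≤ ·)).formPerm

theorem blockCycle_apply_of_notMem {n : ℕ} {V : Finset (Fin n)} {i : Fin n} (h : i ∉ V) :
    blockCycle V i = i :=
  List.formPerm_apply_of_notMem (by simpa using h)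

theorem blockCycle_pairwise_commute {n : ℕ} (π : SetPartition n) :
    (π.parts : Set (Finset (Fin n))).Pairwise (Function.onFun Commute blockCycle) := by
  intro V hV W hW hVW
  refine Equiv.Perm.Disjoint.commute fun i => ?_
  by_cases hi : i ∈ V
  · exact Or.inr (blockCycle_apply_of_notMem
      (Finset.disjoint_left.mp (π.disjoint hV hW hVW) hi))
  · exact Or.inl (blockCycle_apply_of_notMem hi)

/-- A partition seen as a permutation: its cycles are the blocks written in increasing order. -/
def partitionPerm {n : ℕ} (π : SetPartition n) : Equiv.Perm (Fin n) :=
  π.parts.noncommProd blockCycle (blockCycle_pairwise_commute π)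

/-- The Kreweras complement `Kr(π) = π⁻¹ γ_n`, seen as a partition, with `γ_n = (1, 2, …, n)`. -/
def kreweras {n : ℕ} (π : SetPartition n) : SetPartition n :=
  cyclePartition ((partitionPerm π)⁻¹ * finRotate n)

/-- `γ_{t,s} = (1, …, t)(t+1, …, t+s)`. -/
def annularRotate (t s : ℕ) : Equiv.Perm (Fin (t + s)) :=
  finSumFinEquiv.permCongr (Equiv.sumCongr (finRotate t) (finRotate s))

/-- The annular Kreweras complement `Kr_{t,s}(σ) = σ⁻¹ γ_{t,s}`. -/
def annularKreweras {t s : ℕ} (σ : Equiv.Perm (Fin (t + s))) : Equiv.Perm (Fin (t + s)) :=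
  σ⁻¹ * annularRotate t s

open Classical in
/-- The set `S_NC(t,s)` of annular non-crossing permutations: `σ` and `γ_{t,s}` generate a
transitive group, and `σ` and `σ⁻¹ γ_{t,s}` together have `t + s` cycles. -/
noncomputable def annularNC (t s : ℕ) : Finset (Equiv.Perm (Fin (t + s))) :=
  univ.filter fun σ =>
    MulAction.IsPretransitive (Subgroup.closure {σ, annularRotate t s}) (Fin (t + s)) ∧
    #(cyclePartition σ).parts + #(cyclePartition (annularKreweras σ)).parts = t + s

/-! ### Free cumulants and free multiplicative convolution -/

/-- The `n`-th moment `m_n(μ)`. -/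
noncomputable def moment (μ : Measure ℝ) (n : ℕ) : ℝ := ∫ x, x ^ n ∂μ

/-- `m_n = ∑_{π ∈ NC(n)} r_π`. -/
def momentOfCumulant (r : ℕ → ℝ) (n : ℕ) : ℝ := ∑ π ∈ NC n, blockProd r π

/-- The free cumulants of a sequence `m` of moments, defined by solving the moment-cumulant formula
`m_n = ∑_{π ∈ NC(n)} r_π` recursively for the term `r_n` with `π = 1_n`
(see `moment_cumulant_formula`). The test `#V < n` always succeeds there. -/
def cumulantOfMoment (m : ℕ → ℝ) (n : ℕ) : ℝ :=
  m n - ∑ π ∈ (NC n).erase ⊤, ∏ V ∈ π.parts, if #V < n then cumulantOfMoment m #V else 0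
  termination_by n

theorem top_parts {n : ℕ} (hn : 1 ≤ n) : (⊤ : SetPartition n).parts = {univ} := by
  have : NeZero n := ⟨by omega⟩
  have h : (univ : Finset (Fin n)) ≠ ⊥ := (Finset.univ_nonempty).ne_empty
  refine (Finpartition.parts_top_subset _).antisymm ?_
  have hne : (⊤ : SetPartition n).parts ≠ ∅ := fun h0 => by
    have := (⊤ : SetPartition n).sup_parts
    rw [h0] at this
    exact h this.symm
  exact (Finset.subset_singleton_iff.mp (Finpartition.parts_top_subset _)).resolve_left hne |>.ge

theorem card_block_lt {n : ℕ} {π : SetPartition n} (hπ : π ≠ ⊤) {V : Finset (Fin n)}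
    (hV : V ∈ π.parts) : #V < n := by
  have hne : V ≠ univ := by
    rintro rfl
    apply hπ
    refine top_le_iff.mp fun W _ => ⟨univ, hV, Finset.subset_univ W⟩
  simpa using Finset.card_lt_card (Finset.ssubset_univ_iff.mpr hne)

theorem top_mem_NC {n : ℕ} (hn : 1 ≤ n) : (⊤ : SetPartition n) ∈ NC n := by
  simp only [NC, Finset.mem_filter, Finset.mem_univ, true_and, IsNonCrossing, top_parts hn,
    Finset.mem_singleton]
  intro V hV W hW
  simp [hV, hW]

/-- The moment-cumulant formula. -/
theorem moment_cumulant_formula (m : ℕ → ℝ) {n : ℕ} (hn : 1 ≤ n) :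
    m n = ∑ π ∈ NC n, blockProd (cumulantOfMoment m) π := by
  rw [← Finset.add_sum_erase _ _ (top_mem_NC hn)]
  have h1 : blockProd (cumulantOfMoment m) (⊤ : SetPartition n) = cumulantOfMoment m n := by
    simp [blockProd, top_parts hn]
  have h2 : ∑ π ∈ (NC n).erase ⊤, blockProd (cumulantOfMoment m) π =
      ∑ π ∈ (NC n).erase ⊤, ∏ V ∈ π.parts, if #V < n then cumulantOfMoment m #V else 0 := by
    refine Finset.sum_congr rfl fun π hπ => Finset.prod_congr rfl fun V hV => ?_
    rw [if_pos (card_block_lt (Finset.ne_of_mem_erase hπ) hV)]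
  have h3 : cumulantOfMoment m n = m n - ∑ π ∈ (NC n).erase ⊤, ∏ V ∈ π.parts,
      if #V < n then cumulantOfMoment m #V else 0 := by
    rw [cumulantOfMoment]
  rw [h1, h2, h3]
  ring

/-- The free cumulants `r_n(μ)`. -/
noncomputable def freeCumulant (μ : Measure ℝ) : ℕ → ℝ := cumulantOfMoment (moment μ)

/-- The free cumulants of `μ ⊠ ν`: `r_n(μ ⊠ ν) = ∑_{π ∈ NC(n)} r_π(μ) r_{Kr(π)}(ν)`. -/
noncomputable def freeMulCumulant (μ ν : Measure ℝ) (n : ℕ) : ℝ :=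
  ∑ π ∈ NC n, blockProd (freeCumulant μ) π * blockProd (freeCumulant ν) (kreweras π)

/-- The moments `m_n(μ ⊠ ν)`, computed from the free cumulants of `μ ⊠ ν`. -/
noncomputable def freeMulMoment (μ ν : Measure ℝ) : ℕ → ℝ :=
  momentOfCumulant (freeMulCumulant μ ν)

/-- `ρ` has finite moments of all orders. -/
def HasAllMoments (ρ : Measure ℝ) : Prop := ∀ n : ℕ, Integrable (fun x : ℝ => x ^ n) ρ

/-- The probability measure `ρ` is the free multiplicative convolution of `μ` and `ν`. -/
structure IsFreeMulConv (μ ν ρ : Measure ℝ) : Prop where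
  isProbabilityMeasure : IsProbabilityMeasure ρ
  hasAllMoments : HasAllMoments ρ
  freeCumulant_eq : ∀ n : ℕ, 1 ≤ n → freeCumulant ρ n = freeMulCumulant μ ν n

/-! ### Polynomials -/

/-- The set of monic real-rooted polynomials of degree `d`. -/
def MonicRealRooted (d : ℕ) : Set ℝ[X] := {p | p.Monic ∧ p.natDegree = d ∧ p.Splits}

/-- The normalized coefficients `e_k(p)` of a polynomial
`p = ∑_{k=0}^d (-1)^k (d choose k) e_k(p) x^{d-k}` (for `k ≤ d`). -/
noncomputable def normCoeff (d : ℕ) (p : ℝ[X]) (k : ℕ) : ℝ :=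
  (-1) ^ k * p.coeff (d - k) / (d.choose k : ℝ)

/-- The finite free multiplicative convolution `p ⊠_d q`. -/
noncomputable def finiteFreeMul (d : ℕ) (p q : ℝ[X]) : ℝ[X] :=
  ∑ k ∈ range (d + 1),
    C ((-1) ^ k * (d.choose k : ℝ) * (normCoeff d p k * normCoeff d q k)) * X ^ (d - k)

/-- The `n`-th moment `m_n(p) = (1/d) ∑ λ^n` of the root distribution of a polynomial of degree `d`,
the sum being over the complex roots with multiplicity. The sum is real
(`sum_aroots_pow_im`), and if `p` is real-rooted it is the sum over the real roots
(`rootMoment_of_splits`). -/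
noncomputable def rootMoment (d : ℕ) (p : ℝ[X]) (n : ℕ) : ℝ :=
  ((p.aroots ℂ).map (fun z => z ^ n)).sum.re / d

theorem sum_aroots_pow_im (p : ℝ[X]) (n : ℕ) : ((p.aroots ℂ).map (fun z => z ^ n)).sum.im = 0 := by
  have h1 : (p.aroots ℂ).map (starRingEnd ℂ) = p.aroots ℂ := by
    have h := (IsAlgClosed.splits (p.map (algebraMap ℝ ℂ))).roots_map (starRingEnd ℂ)
    have h2 : (starRingEnd ℂ).comp (algebraMap ℝ ℂ) = algebraMap ℝ ℂ := by
      ext x; simp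
    rw [Polynomial.map_map, h2] at h
    exact h.symm
  rw [← Complex.conj_eq_iff_im, map_multiset_sum, Multiset.map_map]
  conv_rhs => rw [← h1, Multiset.map_map]
  simp

theorem rootMoment_of_splits (d : ℕ) {p : ℝ[X]} (hp : p.Splits) (n : ℕ) :
    rootMoment d p n = (p.roots.map (fun x => x ^ n)).sum / d := by
  have h : p.aroots ℂ = p.roots.map (algebraMap ℝ ℂ) :=
    hp.roots_map (algebraMap ℝ ℂ)
  have h2 : ((p.aroots ℂ).map (fun z => z ^ n)).sum =
      (((p.roots.map (fun x => x ^ n)).sum : ℝ) : ℂ) := by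
    rw [h, Multiset.map_map]
    change _ = Complex.ofRealHom _
    rw [map_multiset_sum, Multiset.map_map]
    simp
  rw [rootMoment, h2, Complex.ofReal_re]

/-- The finite free cumulants
`κ_n(p) = (-d)^{n-1}/(n-1)! ∑_{π ∈ P(n)} (-1)^{|π|-1} (|π|-1)! ∏_{V ∈ π} e_{|V|}(p)`,
for `1 ≤ n ≤ d`. -/
noncomputable def finiteFreeCumulant (d : ℕ) (p : ℝ[X]) (n : ℕ) : ℝ :=
  (-(d : ℝ)) ^ (n - 1) / ((n - 1).factorial : ℝ) *
    ∑ π : SetPartition n, (-1) ^ (#π.parts - 1) * ((#π.parts - 1).factorial : ℝ) *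
      blockProd (normCoeff d p) π

/-- The sequence `(p_d)_{d ≥ 1}` has infinitesimal distribution `(μ, μ')`: its root distributions
converge in moments to the probability measure `μ`, and for every `n` the limit
`m_n'(𝔭) = lim_d d (m_n(p_d) - m_n(μ))` exists and equals `μ'(x^n)`. -/
structure HasInfinitesimalDistribution (p : ℕ → ℝ[X]) (μ : Measure ℝ) (μ' : ℝ[X] →ₗ[ℝ] ℝ) :
    Prop where
  isProbabilityMeasure : IsProbabilityMeasure μ
  hasAllMoments : HasAllMoments μ
  tendsto_moment : ∀ n : ℕ,
    Tendsto (fun d : ℕ => rootMoment d (p d) n) atTop (𝓝 (moment μ n))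
  tendsto_infinitesimal : ∀ n : ℕ,
    Tendsto (fun d : ℕ => (d : ℝ) * (rootMoment d (p d) n - moment μ n)) atTop (𝓝 (μ' (X ^ n)))

/-- `r̂` is the sequence of cumulant fluctuations of `(q_d)_{d ≥ 1}` (with limiting root
distribution `ν`): `κ_n(q_d) = r_n(ν) + r̂_n / d + o(1/d)` for all `n ≥ 1`. -/
def IsCumulantFluctuation (q : ℕ → ℝ[X]) (ν : Measure ℝ) (rhat : ℕ → ℝ) : Prop :=
  ∀ n : ℕ, 1 ≤ n →
    (fun d : ℕ => finiteFreeCumulant d (q d) n - (freeCumulant ν n + rhat n / d))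
      =o[atTop] (fun d : ℕ => 1 / (d : ℝ))

/-- `∑_{π ∈ NC(n)} (∑_{V ∈ π} m'_{|V|} m_{π∖V} r_{Kr(π)} + ∑_{W ∈ Kr(π)} m_π r̂_{|W|} r_{Kr(π)∖W})
  - (n/2) ∑_{t+s=n, σ ∈ S_NC(t,s)} m_σ r_{Kr_{t,s}(σ)} / (ts)`, where `t, s ≥ 1`. -/
noncomputable def mulInfinitesimalMoment (m m' r rhat : ℕ → ℝ) (n : ℕ) : ℝ :=
  ∑ π ∈ NC n,
      (blockDerivSum m' m π * blockProd r (kreweras π) +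
        blockProd m π * blockDerivSum rhat r (kreweras π)) -
    (n : ℝ) / 2 *
      ∑ ts ∈ (antidiagonal n).filter (fun ts => 1 ≤ ts.1 ∧ 1 ≤ ts.2),
        ∑ σ ∈ annularNC ts.1 ts.2,
          blockProd m (cyclePartition σ) * blockProd r (cyclePartition (annularKreweras σ)) /
            ((ts.1 : ℝ) * (ts.2 : ℝ))

end FiniteFree

/-! For each `d` there is an exact formula for the moments of `p ⊠_d q`, and it is a genus expansion
in `1/d`. Newton's identities write `n! (d choose n) e_n(p)` as the sum over all permutations of `n`
points of the product of `(-1)^{k-1} d m_k(p)` over the cycle lengths `k` (`permSum_powerWeight`).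
The definition of the finite free cumulants writes `e_n(q)` in the same way with weights
`(-1/d)^{k-1} κ_k(q)` (`permSum_cumulantWeight`). The product of the two sums runs over pairs `(α,
β)`. Passing to classical cumulants keeps exactly the pairs that generate a transitive group
(`isCum_transSum`). Since the product is also `n! (d choose n) e_n(p ⊠_d q)`, comparison with
Newton's identities for `p ⊠_d q` gives `m_n(p ⊠_d q) = 1/(n-1)! ∑ (-1/d)^{n+1-#α-#β} m_α(p) κ_β(q)`
over transitive pairs (`rootMoment_finiteFreeMul`).

Group the pairs by `g = αβ`. The genus inequality `#α + #β + #g ≤ n + 2` (`euler_inequality`) says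
that order 0 forces `g` to be a long cycle. At order 1 it leaves at most two cycles, and a sign
argument leaves exactly two. All long cycles are conjugate, there are `(n-1)!` of them, and the
minimal factorizations of `(1, …, n)` are the non-crossing partitions with their Kreweras
complements (`mem_factors_finRotate_iff`, `mem_NC_iff`). Permutations with two cycles of lengths `t,
s` are conjugate to `γ_{t,s}`; counting them yields the weight `n/(2ts)` (`sum_factorSum_annular`).
Everything else carries a factor `1/d²` (`genusSum_eq`).

It remains to expand the ingredients. The polynomial `(x-1)^d` is the unit of `⊠_d` and has all
moments 1, so the formula also expresses `m_n(q)` through the cumulants of `q`. That expression is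
affine in `κ_n(q)`, with a coefficient tending to 1, so first-order expansions of moments pass
inductively to cumulants, and the limits are the free cumulants. The leading term is identified with
`m_n(μ ⊠ ν)` by computing the limit of `m_n(p_d ⊠_d q_d)` a second time, through the cumulants of
`p_d ⊠_d q_d` (`freeMulMoment_eq_planarSum`). The first-order term consists of the Leibniz rule
applied to the planar sum and of minus the annular sum at the limit values. -/

set_option linter.unusedSectionVars false

namespace FiniteFree

/-! ### Orbit equivalence relations -/

section Orbits

variable {X : Type*}

/-- The equivalence relation whose classes are the cycles of `σ`. -/
abbrev orb (σ : Equiv.Perm X) : Setoid X := Equiv.Perm.SameCycle.setoid σ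

/-- The number of classes of an equivalence relation. -/
noncomputable def numClasses (r : Setoid X) : ℕ := Nat.card (Quotient r)

theorem orb_rel {σ : Equiv.Perm X} {x y : X} : orb σ x y ↔ σ.SameCycle x y := Iff.rfl

theorem orb_apply (σ : Equiv.Perm X) (x : X) : orb σ x (σ x) :=
  Equiv.Perm.sameCycle_apply_right.mpr Equiv.Perm.SameCycle.rfl

/-- One-step test: invariance along a whole cycle follows from invariance under a single application
of `σ`. -/
theorem orb_le_iff {σ : Equiv.Perm X} {s : Setoid X} : orb σ ≤ s ↔ ∀ x, s x (σ x) := by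
  refine ⟨fun h x => h (orb_apply σ x), fun h x y hxy => ?_⟩
  obtain ⟨k, rfl⟩ := hxy
  induction k using Int.induction_on with
  | zero => exact s.refl x
  | succ k ih =>
    rw [add_comm, zpow_add, zpow_one, Equiv.Perm.mul_apply]
    exact s.trans ih (h _)
  | pred k ih =>
    have h1 := h ((σ ^ (-(k : ℤ) - 1)) x)
    rw [← Equiv.Perm.mul_apply, ← zpow_one_add] at h1
    have h2 : (1 + (-(k : ℤ) - 1)) = -k := by ring
    rw [h2] at h1
    exact s.trans ih (s.symm h1)

theorem orb_one : orb (1 : Equiv.Perm X) = ⊥ :=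
  le_bot_iff.mp (orb_le_iff.mpr fun _ => rfl)

theorem orb_inv (σ : Equiv.Perm X) : orb σ⁻¹ = orb σ := by
  ext x y
  exact Equiv.Perm.sameCycle_inv

theorem orb_mul_le {α β : Equiv.Perm X} {s : Setoid X} (hα : orb α ≤ s) (hβ : orb β ≤ s) :
    orb (α * β) ≤ s :=
  orb_le_iff.mpr fun x => s.trans (orb_le_iff.mp hβ x) (orb_le_iff.mp hα (β x))

/-- The join is the orbit relation of the generated group, and `α = (αβ)β⁻¹`, so the pairs `(α, β)`
and `(αβ, β)` have the same join. -/
theorem orb_mul_sup_right (α β : Equiv.Perm X) : orb (α * β) ⊔ orb β = orb α ⊔ orb β := by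
  refine le_antisymm (sup_le (orb_mul_le le_sup_left le_sup_right) le_sup_right)
    (sup_le ?_ le_sup_right)
  have h : orb (α * β * β⁻¹) ≤ orb (α * β) ⊔ orb β :=
    orb_mul_le le_sup_left ((orb_inv β).le.trans le_sup_right)
  rwa [mul_inv_cancel_right] at h

theorem orb_mul_sup_left (α β : Equiv.Perm X) : orb α ⊔ orb (α * β) = orb α ⊔ orb β := by
  refine le_antisymm (sup_le le_sup_left (orb_mul_le le_sup_left le_sup_right))
    (sup_le le_sup_left ?_)
  have h : orb (α⁻¹ * (α * β)) ≤ orb α ⊔ orb (α * β) :=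
    orb_mul_le ((orb_inv α).le.trans le_sup_left) le_sup_right
  rwa [inv_mul_cancel_left] at h

theorem orb_swap_le_iff [DecidableEq X] {i j : X} {s : Setoid X} :
    orb (Equiv.swap i j) ≤ s ↔ s i j := by
  rw [orb_le_iff]
  refine ⟨fun h => by simpa using h i, fun h x => ?_⟩
  rcases eq_or_ne x i with rfl | hi
  · simpa using h
  · rcases eq_or_ne x j with rfl | hj
    · simpa using s.symm h
    · rw [Equiv.swap_apply_of_ne_of_ne hi hj]

variable [Finite X]

theorem numClasses_anti {r s : Setoid X} (h : r ≤ s) : numClasses s ≤ numClasses r :=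
  Nat.card_le_card_of_surjective (Quotient.map' id fun _ _ hab => h hab)
    (fun q => Quotient.inductionOn' q fun x => ⟨Quotient.mk'' x, rfl⟩)

theorem eq_of_numClasses_le {r s : Setoid X} (h : r ≤ s) (hc : numClasses r ≤ numClasses s) :
    r = s := by
  let f : Quotient r → Quotient s := Quotient.map' id fun _ _ hab => h hab
  have hf : Function.Surjective f := fun q => Quotient.inductionOn' q fun x => ⟨Quotient.mk'' x, rfl⟩
  have hbij : Function.Bijective f := by
    cases nonempty_fintype X
    classical
    have := Fintype.ofFinite (Quotient r)
    have := Fintype.ofFinite (Quotient s)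
    rw [Fintype.bijective_iff_surjective_and_card]
    refine ⟨hf, ?_⟩
    have := (numClasses_anti h).antisymm hc
    simpa [numClasses, Nat.card_eq_fintype_card] using this.symm
  refine le_antisymm h fun x y hxy => ?_
  have : f (Quotient.mk'' x) = f (Quotient.mk'' y) := Quotient.sound' hxy
  exact Quotient.exact' (hbij.1 this)

theorem numClasses_bot : numClasses (⊥ : Setoid X) = Nat.card X :=
  (Nat.card_congr (Equiv.ofBijective (Quotient.mk (⊥ : Setoid X))
    ⟨fun _ _ h => Quotient.exact h, Quotient.mk_surjective⟩)).symm

theorem numClasses_top [Nonempty X] : numClasses (⊤ : Setoid X) = 1 := by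
  rw [numClasses, Nat.card_eq_one_iff_unique]
  refine ⟨⟨fun a b => ?_⟩, ⟨Quotient.mk _ (Classical.arbitrary X)⟩⟩
  induction a using Quotient.inductionOn
  induction b using Quotient.inductionOn
  exact Quotient.sound trivial

theorem numClasses_pos [Nonempty X] (r : Setoid X) : 0 < numClasses r :=
  numClasses_top.symm.le.trans (numClasses_anti le_top)

theorem numClasses_eq_one_iff [Nonempty X] {r : Setoid X} : numClasses r = 1 ↔ r = ⊤ :=
  ⟨fun h => eq_of_numClasses_le le_top (by rw [h, numClasses_top]),
    fun h => h ▸ numClasses_top⟩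

theorem numClasses_le_sup_swap [DecidableEq X] (r : Setoid X) (i j : X) :
    numClasses r ≤ numClasses (r ⊔ orb (Equiv.swap i j)) + 1 := by
  classical
  cases nonempty_fintype X
  have := Fintype.ofFinite (Quotient r)
  -- Redirecting the class of `j` to that of `i` is constant on the classes of the join, and its
  -- range contains every class except possibly that of `j`.
  let f : X → Quotient r := fun x =>
    if (Quotient.mk r x) = Quotient.mk r j then Quotient.mk r i else Quotient.mk r x
  have h1 : r ⊔ orb (Equiv.swap i j) ≤ Setoid.ker f := by
    refine sup_le (fun x y hxy => ?_) (orb_swap_le_iff.mpr ?_)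
    · have : Quotient.mk r x = Quotient.mk r y := Quotient.sound hxy
      simp only [Setoid.ker_def, f, this]
    · simp only [Setoid.ker_def, f]
      split_ifs <;> rfl
  have h2 := numClasses_anti h1
  have h3 : numClasses (Setoid.ker f) = Nat.card (Set.range f) :=
    Nat.card_congr (Setoid.quotientKerEquivRange f)
  have h4 : (univ.erase (Quotient.mk r j) : Finset (Quotient r)) ⊆ (Set.range f).toFinset := by
    intro q hq
    induction q using Quotient.inductionOn with | _ x
    simp only [mem_erase, mem_univ, and_true] at hq
    simp only [Set.mem_toFinset, Set.mem_range]
    exact ⟨x, by simp only [f, if_neg hq]⟩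
  have h5 := card_le_card h4
  rw [card_erase_of_mem (mem_univ _), Set.toFinset_card, card_univ, ← Nat.card_eq_fintype_card,
    ← Nat.card_eq_fintype_card, ← h3] at h5
  have : Nat.card (Quotient r) = numClasses r := rfl
  omega

theorem numClasses_sup_swap_of_not_rel [DecidableEq X] {r : Setoid X} {i j : X} (h : ¬ r i j) :
    numClasses (r ⊔ orb (Equiv.swap i j)) + 1 = numClasses r := by
  refine le_antisymm ?_ (numClasses_le_sup_swap r i j)
  by_contra! hlt
  have := eq_of_numClasses_le (le_sup_left : r ≤ r ⊔ orb (Equiv.swap i j)) (by omega)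
  exact h (by rw [this]; exact orb_swap_le_iff.mp le_sup_right)

theorem sup_swap_of_rel [DecidableEq X] {r : Setoid X} {i j : X} (h : r i j) :
    r ⊔ orb (Equiv.swap i j) = r :=
  sup_eq_left.mpr (orb_swap_le_iff.mpr h)

/-- A set that is stable under a permutation of a finite type is a union of cycles. -/
theorem mem_iff_of_sameCycle {σ : Equiv.Perm X} {A : Set X} (hA : ∀ x ∈ A, σ x ∈ A) {x y : X}
    (h : σ.SameCycle x y) : x ∈ A ↔ y ∈ A := by
  have key : ∀ x y, σ.SameCycle x y → x ∈ A → y ∈ A := by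
    intro x y hxy hx
    obtain ⟨k, rfl⟩ := hxy.exists_nat_pow_eq
    induction k with
    | zero => exact hx
    | succ k ih =>
      rw [pow_succ', Equiv.Perm.mul_apply]
      exact hA _ (ih (Equiv.Perm.sameCycle_pow_right.mpr Equiv.Perm.SameCycle.rfl))
  exact ⟨key x y h, key y x h.symm⟩

/-- The new permutation maps `j` to `σ i` and then follows the `σ`-cycle of `i`. If it never met
`i`, the points reached in this way would be closed under `σ` and so contain `i` after all. -/
theorem sameCycle_mul_swap_of_not [DecidableEq X] {σ : Equiv.Perm X} {i j : X}
    (h : ¬ σ.SameCycle i j) : (σ * Equiv.swap i j).SameCycle i j := by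
  by_contra hn
  have hij : i ≠ j := fun e => h (e ▸ Equiv.Perm.SameCycle.rfl)
  let A : Set X := {x | σ.SameCycle i x ∧ (σ * Equiv.swap i j).SameCycle j x}
  have hA : ∀ x ∈ A, σ x ∈ A := by
    rintro x ⟨h1, h2⟩
    have hxi : x ≠ i := by rintro rfl; exact hn h2.symm
    have hxj : x ≠ j := by rintro rfl; exact h h1
    refine ⟨Equiv.Perm.sameCycle_apply_right.mpr h1, ?_⟩
    have := Equiv.Perm.sameCycle_apply_right.mpr h2
    rwa [Equiv.Perm.mul_apply, Equiv.swap_apply_of_ne_of_ne hxi hxj] at this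
  have h0 : σ i ∈ A := by
    refine ⟨Equiv.Perm.sameCycle_apply_right.mpr Equiv.Perm.SameCycle.rfl, ?_⟩
    have := orb_apply (σ * Equiv.swap i j) j
    rwa [Equiv.Perm.mul_apply, Equiv.swap_apply_right] at this
  have h1 : i ∈ A :=
    (mem_iff_of_sameCycle hA (Equiv.Perm.sameCycle_apply_right.mpr Equiv.Perm.SameCycle.rfl)).mpr h0
  exact hn h1.2.symm

/-- The arc `σ i, …, σ^a i = j`, with `a` minimal, closes up because the new permutation sends `j`
to `σ i`; the point `i` is left outside. -/
theorem not_sameCycle_mul_swap [DecidableEq X] {σ : Equiv.Perm X} {i j : X} (hij : i ≠ j)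
    (h : σ.SameCycle i j) : ¬ (σ * Equiv.swap i j).SameCycle i j := by
  have hex : ∃ a : ℕ, (σ ^ a) i = j := h.exists_nat_pow_eq
  classical
  let a := Nat.find hex
  have ha : (σ ^ a) i = j := Nat.find_spec hex
  have hmin : ∀ b < a, (σ ^ b) i ≠ j := fun b hb => Nat.find_min hex hb
  let B : Set X := {x | ∃ k, 1 ≤ k ∧ k ≤ a ∧ (σ ^ k) i = x}
  have ha0 : 1 ≤ a := by
    rcases Nat.eq_zero_or_pos a with h0 | h0
    · rw [h0] at ha; exact absurd ha hij
    · exact h0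
  have hi : i ∉ B := by
    rintro ⟨k, hk, hka, hki⟩
    refine hmin (a - k) (by omega) ?_
    rw [← ha]
    conv_rhs => rw [show a = (a - k) + k by omega, pow_add, Equiv.Perm.mul_apply, hki]
  have hj : j ∈ B := ⟨a, ha0, le_rfl, ha⟩
  have hB : ∀ x ∈ B, (σ * Equiv.swap i j) x ∈ B := by
    rintro x ⟨k, hk, hka, rfl⟩
    rw [Equiv.Perm.mul_apply]
    rcases hka.eq_or_lt with rfl | hlt
    · rw [ha, Equiv.swap_apply_right]
      exact ⟨1, le_rfl, ha0, by simp⟩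
    · rw [Equiv.swap_apply_of_ne_of_ne (fun e => hi ⟨k, hk, hka, e⟩) (hmin k hlt)]
      exact ⟨k + 1, by omega, hlt, by rw [pow_succ', Equiv.Perm.mul_apply]⟩
  exact fun hn => hi ((mem_iff_of_sameCycle hB hn).mpr hj)

theorem numClasses_mul_swap_of_not [DecidableEq X] {σ : Equiv.Perm X} {i j : X}
    (h : ¬ σ.SameCycle i j) :
    numClasses (orb (σ * Equiv.swap i j)) + 1 = numClasses (orb σ) := by
  rw [← numClasses_sup_swap_of_not_rel (r := orb σ) h, ← orb_mul_sup_right,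
    sup_swap_of_rel (orb_rel.mpr (sameCycle_mul_swap_of_not h))]

theorem numClasses_mul_swap_of_sameCycle [DecidableEq X] {σ : Equiv.Perm X} {i j : X}
    (hij : i ≠ j) (h : σ.SameCycle i j) :
    numClasses (orb (σ * Equiv.swap i j)) = numClasses (orb σ) + 1 := by
  have := numClasses_mul_swap_of_not (not_sameCycle_mul_swap hij h)
  rw [mul_assoc, Equiv.swap_mul_self, mul_one] at this
  exact this.symm

theorem numClasses_mul_swap_le [DecidableEq X] (σ : Equiv.Perm X) (i j : X) :
    numClasses (orb (σ * Equiv.swap i j)) ≤ numClasses (orb σ) + 1 := by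
  rcases eq_or_ne i j with rfl | hij
  · simp [← Equiv.Perm.one_def]
  by_cases h : σ.SameCycle i j
  · exact (numClasses_mul_swap_of_sameCycle hij h).le
  · have := numClasses_mul_swap_of_not h; omega

/-- Conjugation by an equivalence transports the cycles. -/
theorem orb_permCongr_rel {Y : Type*} (e : X ≃ Y) (σ : Equiv.Perm X) {x y : X} :
    orb (e.permCongr σ) (e x) (e y) ↔ orb σ x y := by
  refine ⟨fun h => ?_, ?_⟩
  · have h2 : orb (e.permCongr σ) ≤ Setoid.comap e.symm (orb σ) := orb_le_iff.mpr fun z => by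
      have := orb_apply σ (e.symm z)
      simpa [Setoid.comap_rel] using this
    have := h2 h
    simpa [Setoid.comap_rel] using this
  · intro h
    have : orb σ ≤ Setoid.comap e (orb (e.permCongr σ)) := orb_le_iff.mpr fun z => by
      have := orb_apply (e.permCongr σ) (e z)
      simpa [Setoid.comap_rel] using this
    exact this h

end Orbits

/-! ### Genus inequality and parity of cycle counts -/

section Euler

variable {X : Type*} [Finite X]

/-- The genus inequality for a pair of permutations. -/
theorem euler_inequality (α β : Equiv.Perm X) :
    numClasses (orb α) + numClasses (orb β) + numClasses (orb (α * β)) ≤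
      Nat.card X + 2 * numClasses (orb α ⊔ orb β) := by
  classical
  cases nonempty_fintype X
  -- Split a transposition off `β`, so that `β'` has one cycle more. Putting it back either leaves
  -- the join unchanged, and then `αβ` has at most one cycle more than `αβ'`, or it merges two
  -- classes of the join, and then it merges two cycles of `αβ'` as well.
  induction hk : Nat.card X - numClasses (orb β) using Nat.strong_induction_on generalizing β with
  | _ k ih =>
  by_cases hβ : β = 1
  · rw [hβ, orb_one, mul_one, sup_bot_eq, numClasses_bot]
    omega
  obtain ⟨i, hi⟩ : ∃ i, β i ≠ i := by
    by_contra! h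
    exact hβ (Equiv.ext h)
  set j := β i
  set β' := β * Equiv.swap i j with hβ'
  have hij : β.SameCycle i j := orb_apply β i
  have hn : ¬ β'.SameCycle i j := not_sameCycle_mul_swap (Ne.symm hi) hij
  have hc : numClasses (orb β') = numClasses (orb β) + 1 :=
    numClasses_mul_swap_of_sameCycle (Ne.symm hi) hij
  have hle : numClasses (orb β') ≤ Nat.card X := by
    rw [← numClasses_bot]; exact numClasses_anti bot_le
  have hind := ih _ (by omega) β' rfl
  have hββ : β = β' * Equiv.swap i j := by rw [hβ', mul_assoc, Equiv.swap_mul_self, mul_one]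
  have hsup : orb α ⊔ orb β = orb α ⊔ orb β' ⊔ orb (Equiv.swap i j) := by
    rw [sup_assoc, hβ', orb_mul_sup_right, sup_swap_of_rel hij]
  have hm : α * β = (α * β') * Equiv.swap i j := by rw [mul_assoc, ← hββ]
  by_cases hr : (orb α ⊔ orb β') i j
  · have h1 := numClasses_mul_swap_le (α * β') i j
    rw [sup_swap_of_rel hr] at hsup
    rw [hm, hsup]
    omega
  · have h1 := numClasses_sup_swap_of_not_rel hr
    have h2 : ¬ (α * β').SameCycle i j := fun h =>
      hr (orb_mul_le (s := orb α ⊔ orb β') le_sup_left le_sup_right h)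
    have h3 := numClasses_mul_swap_of_not h2
    rw [hm, hsup]
    omega

/-- Each transposition changes the number of cycles by exactly one. Combined with multiplicativity
of the sign, this excludes long cycles at first order in `1/d`. -/
theorem neg_one_pow_numClasses [Fintype X] [DecidableEq X] (σ : Equiv.Perm X) :
    (-1 : ℤˣ) ^ numClasses (orb σ) = (-1) ^ Nat.card X * Equiv.Perm.sign σ := by
  induction σ using Equiv.Perm.swap_induction_on' with
  | one => rw [orb_one, numClasses_bot]; simp
  | mul_swap σ i j hij ih =>
    rw [Equiv.Perm.sign_mul, Equiv.Perm.sign_swap hij, ← mul_assoc, ← ih]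
    by_cases h : σ.SameCycle i j
    · rw [numClasses_mul_swap_of_sameCycle hij h, pow_succ]
    · rw [← numClasses_mul_swap_of_not h, pow_succ]; simp

end Euler
end FiniteFree

namespace FiniteFree

/-! ### Multiplicative functions of an equivalence relation -/

section ClassProd

variable {X Y : Type*} [Fintype X] [Fintype Y]

open Classical in
/-- The class of `x`. -/
noncomputable def cls (r : Setoid X) (x : X) : Finset X := univ.filter (r x ·)

open Classical in
/-- The set of classes of `r`. -/
noncomputable def classes (r : Setoid X) : Finset (Finset X) := univ.image (cls r)

/-- `∏_V u_{|V|}` over the classes `V` of `r`. -/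
noncomputable def classProd (u : ℕ → ℝ) (r : Setoid X) : ℝ := ∏ V ∈ classes r, u #V

theorem mem_cls {r : Setoid X} {x y : X} : y ∈ cls r x ↔ r x y := by simp [cls]

theorem cls_eq_iff {r : Setoid X} {x y : X} : cls r x = cls r y ↔ r x y := by
  refine ⟨fun h => mem_cls.mp (h ▸ mem_cls.mpr (r.refl y)), fun h => ?_⟩
  ext z
  rw [mem_cls, mem_cls]
  exact ⟨r.trans (r.symm h), r.trans h⟩

theorem mem_classes {r : Setoid X} {V : Finset X} : V ∈ classes r ↔ ∃ x, cls r x = V := by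
  simp [classes]

theorem card_classes (r : Setoid X) : #(classes r) = numClasses r := by
  classical
  have h : classes r = univ.image (Quotient.lift (s := r) (cls r) fun _ _ h => cls_eq_iff.mpr h) := by
    ext V
    simp only [classes, mem_image, mem_univ, true_and]
    refine ⟨fun ⟨x, hx⟩ => ⟨Quotient.mk r x, hx⟩, fun ⟨q, hq⟩ => ?_⟩
    induction q using Quotient.inductionOn with | _ x
    exact ⟨x, hq⟩
  rw [h, card_image_of_injective, card_univ, numClasses, Nat.card_eq_fintype_card]
  intro a b hab
  induction a using Quotient.inductionOn
  induction b using Quotient.inductionOn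
  exact Quotient.sound (cls_eq_iff.mp hab)

/-- The hypothesis `h` makes the range of `f` a union of classes of `r` on which `r` pulls back to
`s`. It covers both bijections and the two halves of a split permutation. -/
theorem classProd_eq_prod_image [DecidableEq (Finset X)] {r : Setoid X} {s : Setoid Y} {f : Y → X}
    (hf : Function.Injective f)
    (h : ∀ a x, r (f a) x ↔ ∃ b, f b = x ∧ s a b) (u : ℕ → ℝ) :
    ∏ V ∈ univ.image (fun a => cls r (f a)), u #V = classProd u s := by
  classical
  have h1 : ∀ a, cls r (f a) = (cls s a).map ⟨f, hf⟩ := by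
    intro a
    ext x
    simp only [mem_cls, h, Finset.mem_map, Function.Embedding.coeFn_mk]
    exact ⟨fun ⟨b, h1, h2⟩ => ⟨b, h2, h1⟩, fun ⟨b, h1, h2⟩ => ⟨b, h2, h1⟩⟩
  have h2 : univ.image (fun a => cls r (f a)) = (classes s).map (mapEmbedding ⟨f, hf⟩).toEmbedding := by
    ext V
    simp only [classes, h1, mem_image, mem_univ, true_and, Finset.mem_map, exists_exists_eq_and]
    rfl
  rw [h2, prod_map]
  simp [classProd, mapEmbedding_apply]

theorem classProd_equiv {r : Setoid X} {s : Setoid Y} (e : Y ≃ X)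
    (h : ∀ a b, r (e a) (e b) ↔ s a b) (u : ℕ → ℝ) : classProd u r = classProd u s := by
  classical
  rw [← classProd_eq_prod_image e.injective (r := r) (s := s)]
  · have : classes r = univ.image (fun a => cls r (e a)) := by
      ext V
      simp only [classes, mem_image, mem_univ, true_and]
      exact ⟨fun ⟨x, hx⟩ => ⟨e.symm x, by simpa using hx⟩, fun ⟨x, hx⟩ => ⟨e x, hx⟩⟩
    rw [classProd, this]
  · intro a x
    refine ⟨fun hx => ⟨e.symm x, by simp, (h _ _).mp (by simpa using hx)⟩, ?_⟩
    rintro ⟨b, rfl, hb⟩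
    exact (h _ _).mpr hb

theorem classProd_permCongr (e : X ≃ Y) (σ : Equiv.Perm X) (u : ℕ → ℝ) :
    classProd u (orb (e.permCongr σ)) = classProd u (orb σ) :=
  classProd_equiv e (fun _ _ => orb_permCongr_rel e σ) u

theorem numClasses_permCongr (e : X ≃ Y) (σ : Equiv.Perm X) :
    numClasses (orb (e.permCongr σ)) = numClasses (orb σ) :=
  (Nat.card_congr (Quotient.congr e fun _ _ => (orb_permCongr_rel e σ).symm)).symm

theorem classProd_top [Nonempty X] (u : ℕ → ℝ) :
    classProd u (⊤ : Setoid X) = u (Fintype.card X) := by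
  classical
  have : classes (⊤ : Setoid X) = {univ} := by
    ext V
    have h : ∀ x : X, cls (⊤ : Setoid X) x = univ := fun x => by
      ext y; simp [mem_cls, Setoid.top_def]
    simp only [classes, mem_image, mem_univ, true_and, h, mem_singleton, exists_const]
    exact eq_comm
  rw [classProd, this, prod_singleton, card_univ]

theorem classProd_of_isEmpty [IsEmpty X] (u : ℕ → ℝ) (r : Setoid X) : classProd u r = 1 := by
  simp [classProd, classes]

theorem classProd_congr {u v : ℕ → ℝ} (h : ∀ n, 1 ≤ n → u n = v n) (r : Setoid X) :
    classProd u r = classProd v r := by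
  classical
  refine prod_congr rfl fun V hV => ?_
  obtain ⟨x, -, rfl⟩ := mem_image.mp hV
  exact h _ (card_pos.mpr ⟨x, mem_cls.mpr (r.refl x)⟩)

theorem classProd_mul (u v : ℕ → ℝ) (r : Setoid X) :
    classProd (fun n => u n * v n) r = classProd u r * classProd v r := prod_mul_distrib

theorem classProd_const (c : ℝ) (r : Setoid X) : classProd (fun _ => c) r = c ^ numClasses r := by
  rw [classProd, prod_const, card_classes]

theorem classes_pairwiseDisjoint (r : Setoid X) :
    (classes r : Set (Finset X)).PairwiseDisjoint id := by
  classical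
  intro V hV W hW hVW
  obtain ⟨x, -, rfl⟩ := mem_image.mp hV
  obtain ⟨y, -, rfl⟩ := mem_image.mp hW
  refine Finset.disjoint_left.mpr fun z hz hz' => hVW (cls_eq_iff.mpr ?_)
  exact r.trans (mem_cls.mp hz) (r.symm (mem_cls.mp hz'))

theorem sum_card_classes (r : Setoid X) : ∑ V ∈ classes r, #V = Fintype.card X := by
  classical
  have h := card_biUnion (s := classes r) (t := id) fun V hV W hW h =>
    classes_pairwiseDisjoint r hV hW h
  simp only [id] at h
  rw [← h, ← card_univ]
  congr 1
  ext x
  simp only [mem_biUnion, mem_univ, iff_true]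
  exact ⟨cls r x, mem_image_of_mem _ (mem_univ x), mem_cls.mpr (r.refl x)⟩

theorem classProd_pow (c : ℝ) (r : Setoid X) :
    classProd (fun n => c ^ n) r = c ^ Fintype.card X := by
  rw [classProd, prod_pow_eq_pow_sum, sum_card_classes]

theorem numClasses_le_card (r : Setoid X) : numClasses r ≤ Fintype.card X := by
  rw [← Nat.card_eq_fintype_card, ← numClasses_bot]; exact numClasses_anti bot_le

/-- `∏_V c^{|V| - 1} u_{|V|} = c^{|X| - #classes} ∏_V u_{|V|}`. -/
theorem classProd_pow_pred_mul (c : ℝ) (u : ℕ → ℝ) (r : Setoid X) :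
    classProd (fun n => c ^ (n - 1) * u n) r =
      c ^ (Fintype.card X - numClasses r) * classProd u r := by
  classical
  rw [classProd_mul]
  congr 1
  rw [classProd, prod_pow_eq_pow_sum]
  congr 1
  have hpos : ∀ V ∈ classes r, 1 ≤ #V := by
    intro V hV
    obtain ⟨x, -, rfl⟩ := mem_image.mp hV
    exact card_pos.mpr ⟨x, mem_cls.mpr (r.refl x)⟩
  rw [sum_tsub_distrib _ hpos, sum_card_classes, sum_const, smul_eq_mul, mul_one, card_classes]

end ClassProd

/-! ### Splitting off an orbit -/

section Split

variable {X : Type*} {p : X → Prop} [DecidablePred p]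

theorem subtypeCongr_zpow (a : Equiv.Perm {x // p x}) (b : Equiv.Perm {x // ¬ p x}) (k : ℤ) :
    (a.subtypeCongr b) ^ k = (a ^ k).subtypeCongr (b ^ k) :=
  (map_zpow (Equiv.Perm.subtypeCongrHom p) (a, b) k).symm

theorem orb_subtypeCongr_left (a : Equiv.Perm {x // p x}) (b : Equiv.Perm {x // ¬ p x})
    (x : {x // p x}) (y : X) :
    orb (a.subtypeCongr b) x y ↔ ∃ z : {x // p x}, (z : X) = y ∧ orb a x z := by
  constructor
  · rintro ⟨k, rfl⟩
    refine ⟨(a ^ k) x, ?_, k, rfl⟩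
    rw [subtypeCongr_zpow, Equiv.Perm.subtypeCongr.left_apply_subtype]
  · rintro ⟨z, rfl, k, rfl⟩
    refine ⟨k, ?_⟩
    rw [subtypeCongr_zpow, Equiv.Perm.subtypeCongr.left_apply_subtype]

theorem orb_subtypeCongr_right (a : Equiv.Perm {x // p x}) (b : Equiv.Perm {x // ¬ p x})
    (x : {x // ¬ p x}) (y : X) :
    orb (a.subtypeCongr b) x y ↔ ∃ z : {x // ¬ p x}, (z : X) = y ∧ orb b x z := by
  constructor
  · rintro ⟨k, rfl⟩
    refine ⟨(b ^ k) x, ?_, k, rfl⟩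
    rw [subtypeCongr_zpow, Equiv.Perm.subtypeCongr.right_apply_subtype]
  · rintro ⟨z, rfl, k, rfl⟩
    refine ⟨k, ?_⟩
    rw [subtypeCongr_zpow, Equiv.Perm.subtypeCongr.right_apply_subtype]

variable [Fintype X] [Fintype {x // p x}] [Fintype {x // ¬ p x}]

theorem disjoint_image_cls (a : Equiv.Perm {x // p x}) (b : Equiv.Perm {x // ¬ p x})
    [DecidableEq (Finset X)] :
    Disjoint (univ.image fun x : {x // p x} => cls (orb (a.subtypeCongr b)) x)
      (univ.image fun x : {x // ¬ p x} => cls (orb (a.subtypeCongr b)) x) := by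
  refine Finset.disjoint_left.mpr fun V hV hV' => ?_
  obtain ⟨x, -, rfl⟩ := mem_image.mp hV
  obtain ⟨y, -, hy⟩ := mem_image.mp hV'
  obtain ⟨z, hz, -⟩ := (orb_subtypeCongr_left a b x y).mp (cls_eq_iff.mp hy.symm)
  exact y.2 (hz ▸ z.2)

theorem classes_subtypeCongr (a : Equiv.Perm {x // p x}) (b : Equiv.Perm {x // ¬ p x})
    [DecidableEq (Finset X)] :
    classes (orb (a.subtypeCongr b)) =
      (univ.image fun x : {x // p x} => cls (orb (a.subtypeCongr b)) x) ∪
      (univ.image fun x : {x // ¬ p x} => cls (orb (a.subtypeCongr b)) x) := by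
  ext V
  simp only [classes, mem_image, mem_univ, true_and, mem_union]
  constructor
  · rintro ⟨x, rfl⟩
    by_cases hx : p x
    · exact Or.inl ⟨⟨x, hx⟩, rfl⟩
    · exact Or.inr ⟨⟨x, hx⟩, rfl⟩
  · rintro (⟨x, rfl⟩ | ⟨x, rfl⟩) <;> exact ⟨x, rfl⟩

theorem classProd_subtypeCongr (a : Equiv.Perm {x // p x}) (b : Equiv.Perm {x // ¬ p x})
    (u : ℕ → ℝ) :
    classProd u (orb (a.subtypeCongr b)) = classProd u (orb a) * classProd u (orb b) := by
  classical
  rw [classProd, classes_subtypeCongr, prod_union (disjoint_image_cls a b),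
    classProd_eq_prod_image Subtype.val_injective (orb_subtypeCongr_left a b),
    classProd_eq_prod_image Subtype.val_injective (orb_subtypeCongr_right a b)]

theorem numClasses_subtypeCongr (a : Equiv.Perm {x // p x}) (b : Equiv.Perm {x // ¬ p x}) :
    numClasses (orb (a.subtypeCongr b)) = numClasses (orb a) + numClasses (orb b) := by
  -- With the constant weight 2 the class product is `2 ^ numClasses`, so multiplicativity becomes
  -- additivity of the counts.
  have h := classProd_subtypeCongr a b (fun _ => 2)
  rw [classProd_const, classProd_const, classProd_const, ← pow_add] at h
  exact_mod_cast pow_right_injective₀ (by norm_num) (by norm_num) h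

end Split

/-! ### Decomposition of sums over pairs by a joint orbit -/

section SplitSum

variable {X : Type*} [Fintype X] [DecidableEq X]

open Classical in
/-- The pairs of permutations that generate a transitive group. -/
noncomputable def transPairs (X : Type*) [Fintype X] [DecidableEq X] :
    Finset (Equiv.Perm X × Equiv.Perm X) := univ.filter fun a => orb a.1 ⊔ orb a.2 = ⊤

theorem mem_transPairs {a : Equiv.Perm X × Equiv.Perm X} :
    a ∈ transPairs X ↔ orb a.1 ⊔ orb a.2 = ⊤ := by simp [transPairs]

theorem mem_iff_of_cls_eq {r : Setoid X} {x₀ : X} {S : Finset X} (h : cls r x₀ = S) {x y : X}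
    (hxy : r x y) : x ∈ S ↔ y ∈ S := by
  subst h
  rw [mem_cls, mem_cls]
  exact ⟨fun h => r.trans h hxy, fun h => r.trans h (r.symm hxy)⟩

/-- Both permutations preserve membership in `S`, which confines the joint orbit of `x₀`;
transitivity on `S` makes it all of `S`. -/
theorem cls_subtypeCongr_of_trans {S : Finset X} {x₀ : X} (hx₀ : x₀ ∈ S)
    {a₁ a₂ : Equiv.Perm {x // x ∈ S}} (h : orb a₁ ⊔ orb a₂ = ⊤)
    (b₁ b₂ : Equiv.Perm {x // ¬ x ∈ S}) :
    cls (orb (a₁.subtypeCongr b₁) ⊔ orb (a₂.subtypeCongr b₂)) x₀ = S := by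
  ext x
  rw [mem_cls]
  constructor
  · intro hx
    have h1 : ∀ (a : Equiv.Perm {x // x ∈ S}) (b : Equiv.Perm {x // ¬ x ∈ S}),
        orb (a.subtypeCongr b) ≤ Setoid.ker (fun x => x ∈ S) := by
      intro a b
      refine orb_le_iff.mpr fun y => ?_
      rw [Setoid.ker_def]
      by_cases hy : y ∈ S
      · rw [Equiv.Perm.subtypeCongr.left_apply _ _ hy]
        simp [hy]
      · rw [Equiv.Perm.subtypeCongr.right_apply _ _ hy]
        simpa [hy] using (b ⟨y, hy⟩).2
    have h2 : Setoid.ker (fun x => x ∈ S) x₀ x := sup_le (h1 a₁ b₁) (h1 a₂ b₂) hx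
    rw [Setoid.ker_def] at h2
    simpa [hx₀] using h2
  · intro hx
    have h1 : (⊤ : Setoid {x // x ∈ S}) ≤
        Setoid.comap Subtype.val (orb (a₁.subtypeCongr b₁) ⊔ orb (a₂.subtypeCongr b₂)) := by
      rw [← h]
      refine sup_le (fun y z hyz => ?_) (fun y z hyz => ?_)
      · exact (le_sup_left : orb (a₁.subtypeCongr b₁) ≤ _)
          ((orb_subtypeCongr_left a₁ b₁ y z).mpr ⟨z, rfl, hyz⟩)
      · exact (le_sup_right : orb (a₂.subtypeCongr b₂) ≤ _)
          ((orb_subtypeCongr_left a₂ b₂ y z).mpr ⟨z, rfl, hyz⟩)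
    exact h1 (x := ⟨x₀, hx₀⟩) (y := ⟨x, hx⟩) trivial

/-- The map `g` records the joint class inside `S` and is `none` outside. It is constant on joint
orbits upstairs, and `S` is one such orbit, so there is only one class. -/
theorem trans_of_cls_subtypeCongr {S : Finset X} {x₀ : X}
    {a₁ a₂ : Equiv.Perm {x // x ∈ S}} {b₁ b₂ : Equiv.Perm {x // ¬ x ∈ S}}
    (h : cls (orb (a₁.subtypeCongr b₁) ⊔ orb (a₂.subtypeCongr b₂)) x₀ = S) :
    orb a₁ ⊔ orb a₂ = ⊤ := by
  classical
  let s := orb a₁ ⊔ orb a₂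
  let g : X → Option (Quotient s) := fun x => if h : x ∈ S then some (Quotient.mk s ⟨x, h⟩) else none
  have h1 : ∀ (a : Equiv.Perm {x // x ∈ S}) (b : Equiv.Perm {x // ¬ x ∈ S}), orb a ≤ s →
      orb (a.subtypeCongr b) ≤ Setoid.ker g := by
    intro a b hab
    refine orb_le_iff.mpr fun y => ?_
    rw [Setoid.ker_def]
    by_cases hy : y ∈ S
    · rw [Equiv.Perm.subtypeCongr.left_apply _ _ hy]
      simp only [g, dif_pos hy, dif_pos (a ⟨y, hy⟩).2]
      exact congrArg some (Quotient.sound (hab (orb_apply a ⟨y, hy⟩)))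
    · rw [Equiv.Perm.subtypeCongr.right_apply _ _ hy]
      simp only [g, dif_neg hy, dif_neg (b ⟨y, hy⟩).2]
  have h2 := sup_le (h1 a₁ b₁ le_sup_left) (h1 a₂ b₂ le_sup_right)
  refine top_le_iff.mp fun x y _ => ?_
  have hx : (orb (a₁.subtypeCongr b₁) ⊔ orb (a₂.subtypeCongr b₂)) x₀ x := mem_cls.mp (by rw [h]; exact x.2)
  have hy : (orb (a₁.subtypeCongr b₁) ⊔ orb (a₂.subtypeCongr b₂)) x₀ y := mem_cls.mp (by rw [h]; exact y.2)
  have h3 := h2 (Setoid.trans' _ (Setoid.symm' _ hx) hy)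
  rw [Setoid.ker_def] at h3
  simp only [g, dif_pos x.2, dif_pos y.2] at h3
  exact Quotient.exact (Option.some_injective _ h3)

theorem exists_subtypeCongr {S : Finset X} {α : Equiv.Perm X} (h : ∀ x, x ∈ S ↔ α x ∈ S) :
    ∃ (a : Equiv.Perm {x // x ∈ S}) (b : Equiv.Perm {x // ¬ x ∈ S}), a.subtypeCongr b = α := by
  refine ⟨α.subtypePerm fun x => (h x).symm, α.subtypePerm fun x => (not_congr (h x)).symm, ?_⟩
  ext x
  by_cases hx : x ∈ S
  · rw [Equiv.Perm.subtypeCongr.left_apply _ _ hx]; rfl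
  · rw [Equiv.Perm.subtypeCongr.right_apply _ _ hx]; rfl

/-- A sum over pairs of permutations, split according to the orbit of `x₀`. -/
theorem sum_pairs_eq_sum_orbit (x₀ : X) (f : Equiv.Perm X × Equiv.Perm X → ℝ) :
    ∑ a, f a = ∑ S ∈ univ.filter (fun S : Finset X => x₀ ∈ S),
      ∑ a ∈ transPairs {x // x ∈ S},
        ∑ b : Equiv.Perm {x // ¬ x ∈ S} × Equiv.Perm {x // ¬ x ∈ S},
          f (a.1.subtypeCongr b.1, a.2.subtypeCongr b.2) := by
  classical
  rw [← sum_fiberwise_of_maps_to (s := univ) (t := univ.filter (fun S : Finset X => x₀ ∈ S))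
    (g := fun a : Equiv.Perm X × Equiv.Perm X => cls (orb a.1 ⊔ orb a.2) x₀)
    (fun a _ => by simp only [mem_filter, mem_univ, true_and, mem_cls]; exact Setoid.refl' _ _)]
  refine sum_congr rfl fun S hS => ?_
  simp only [mem_filter, mem_univ, true_and] at hS
  rw [← sum_product']
  symm
  refine sum_bij (fun c _ => (c.1.1.subtypeCongr c.2.1, c.1.2.subtypeCongr c.2.2)) ?_ ?_ ?_ ?_
  · rintro ⟨a, b⟩ hab
    simp only [mem_product, mem_transPairs, mem_univ, and_true] at hab
    simp only [mem_filter, mem_univ, true_and]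
    exact cls_subtypeCongr_of_trans hS hab _ _
  · rintro ⟨⟨a₁, a₂⟩, b₁, b₂⟩ - ⟨⟨a₁', a₂'⟩, b₁', b₂'⟩ - h
    simp only [Prod.mk.injEq] at h
    have h1 := Equiv.Perm.subtypeCongrHom_injective (fun x => x ∈ S)
      (a₁ := (a₁, b₁)) (a₂ := (a₁', b₁')) h.1
    have h2 := Equiv.Perm.subtypeCongrHom_injective (fun x => x ∈ S)
      (a₁ := (a₂, b₂)) (a₂ := (a₂', b₂')) h.2
    simp only [Prod.mk.injEq] at h1 h2 ⊢
    exact ⟨⟨h1.1, h2.1⟩, h1.2, h2.2⟩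
  · rintro ⟨α, β⟩ hab
    simp only [mem_filter, mem_univ, true_and] at hab
    obtain ⟨a₁, b₁, h1⟩ := exists_subtypeCongr (S := S) (α := α) fun x =>
      mem_iff_of_cls_eq hab ((le_sup_left : orb α ≤ orb α ⊔ orb β) (orb_apply α x))
    obtain ⟨a₂, b₂, h2⟩ := exists_subtypeCongr (S := S) (α := β) fun x =>
      mem_iff_of_cls_eq hab ((le_sup_right : orb β ≤ orb α ⊔ orb β) (orb_apply β x))
    subst h1 h2
    refine ⟨((a₁, a₂), b₁, b₂), ?_, rfl⟩
    simp only [mem_product, mem_transPairs, mem_univ, and_true]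
    exact trans_of_cls_subtypeCongr hab
  · intro _ _; rfl

end SplitSum
end FiniteFree

namespace FiniteFree

/-! ### The moment-cumulant recursion -/

/-- `c` is the sequence of (classical) cumulants of the sequence `e`. -/
def IsCum (e c : ℕ → ℝ) : Prop :=
  ∀ n, e (n + 1) = ∑ k ∈ range (n + 1), (n.choose k : ℝ) * c (k + 1) * e (n - k)

theorem IsCum.unique_cumulant {e c c' : ℕ → ℝ} (h0 : e 0 = 1) (h : IsCum e c) (h' : IsCum e c')
    (n : ℕ) : c (n + 1) = c' (n + 1) := by
  induction n using Nat.strong_induction_on with | _ n ih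
  have h1 := (h n).symm.trans (h' n)
  rw [sum_range_succ, sum_range_succ, sum_congr rfl (g := fun k => (n.choose k : ℝ) * c' (k + 1) *
    e (n - k)) fun k hk => by rw [ih k (mem_range.mp hk)]] at h1
  simpa [h0] using h1

theorem IsCum.unique_moment {e e' c : ℕ → ℝ} (h0 : e 0 = e' 0) (h : IsCum e c) (h' : IsCum e' c)
    (n : ℕ) : e n = e' n := by
  induction n using Nat.strong_induction_on with | _ n ih
  cases n with
  | zero => exact h0
  | succ n =>
    rw [h n, h' n]
    exact sum_congr rfl fun k _ => by rw [ih (n - k) (by omega)]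

theorem IsCum.congr {e c c' : ℕ → ℝ} (h : IsCum e c) (hc : ∀ n, c (n + 1) = c' (n + 1)) :
    IsCum e c' := fun n => by rw [h n]; simp only [hc]

/-- The cumulants of `e`, shifted by one. -/
noncomputable def cumSeq (e : ℕ → ℝ) (n : ℕ) : ℝ :=
  e (n + 1) - ∑ k : Fin n, (n.choose k : ℝ) * cumSeq e k * e (n - k)
  decreasing_by exact k.2

theorem isCum_cumSeq {e : ℕ → ℝ} (h0 : e 0 = 1) : IsCum e (fun n => cumSeq e (n - 1)) := by
  intro n
  rw [sum_range_succ, ← Fin.sum_univ_eq_sum_range (fun k => (n.choose k : ℝ) *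
    cumSeq e (k + 1 - 1) * e (n - k)) n]
  simp only [Nat.add_sub_cancel, Nat.choose_self, Nat.cast_one, one_mul, Nat.sub_self, h0, mul_one]
  conv_rhs => rw [cumSeq]
  ring

theorem sum_powerset_filter_mem {X : Type*} [DecidableEq X] {x₀ : X} {t : Finset X} (h : x₀ ∉ t)
    (g : ℕ → ℝ) :
    ∑ S ∈ (insert x₀ t).powerset.filter (fun S => x₀ ∈ S), g #S =
      ∑ k ∈ range (#t + 1), ((#t).choose k : ℝ) * g (k + 1) := by
  rw [sum_filter, sum_powerset_insert h, sum_eq_zero, zero_add]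
  · have h1 : ∀ S ∈ t.powerset, (if x₀ ∈ insert x₀ S then g #(insert x₀ S) else 0) =
        (fun k => g (k + 1)) #S := by
      intro S hS
      rw [if_pos (mem_insert_self _ _), card_insert_of_notMem fun hx => h (mem_powerset.mp hS hx)]
    rw [sum_congr rfl h1, sum_powerset_apply_card fun k => g (k + 1)]
    simp
  · intro S hS
    rw [if_neg fun hx => h (mem_powerset.mp hS hx)]

/-! ### Generating sums over permutations -/

section PermSum

variable (X : Type*) [Fintype X] [DecidableEq X]

/-- `∑_σ φ_σ` over all permutations of `X`. -/
noncomputable def permSum (φ : ℕ → ℝ) : ℝ := ∑ σ : Equiv.Perm X, classProd φ (orb σ)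

/-- `∑ φ_α ψ_β` over all pairs `(α, β)` that generate a transitive group on `X`. -/
noncomputable def transSum (φ ψ : ℕ → ℝ) : ℝ :=
  ∑ a ∈ transPairs X, classProd φ (orb a.1) * classProd ψ (orb a.2)

variable {X} {Y : Type*} [Fintype Y] [DecidableEq Y]

theorem permSum_congr (e : X ≃ Y) (φ : ℕ → ℝ) : permSum X φ = permSum Y φ :=
  Fintype.sum_equiv e.permCongr _ _ fun σ => (classProd_permCongr e σ φ).symm

theorem orb_sup_permCongr_eq_top (e : X ≃ Y) {α β : Equiv.Perm X} (h : orb α ⊔ orb β = ⊤) :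
    orb (e.permCongr α) ⊔ orb (e.permCongr β) = ⊤ := by
  have h1 : orb α ⊔ orb β ≤ Setoid.comap e (orb (e.permCongr α) ⊔ orb (e.permCongr β)) := by
    refine sup_le (fun x y hxy => ?_) (fun x y hxy => ?_)
    · exact (le_sup_left : orb (e.permCongr α) ≤ _) ((orb_permCongr_rel e α).mpr hxy)
    · exact (le_sup_right : orb (e.permCongr β) ≤ _) ((orb_permCongr_rel e β).mpr hxy)
  rw [h] at h1
  refine top_le_iff.mp fun x y _ => ?_
  have := h1 (x := e.symm x) (y := e.symm y) trivial
  simpa [Setoid.comap_rel] using this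

theorem orb_sup_permCongr_eq_top_iff (e : X ≃ Y) {α β : Equiv.Perm X} :
    orb (e.permCongr α) ⊔ orb (e.permCongr β) = ⊤ ↔ orb α ⊔ orb β = ⊤ := by
  refine ⟨fun h => ?_, orb_sup_permCongr_eq_top e⟩
  have := orb_sup_permCongr_eq_top e.symm h
  simpa only [← Equiv.permCongr_symm, Equiv.symm_apply_apply] using this

theorem transSum_congr (e : X ≃ Y) (φ ψ : ℕ → ℝ) : transSum X φ ψ = transSum Y φ ψ := by
  refine sum_equiv (e.permCongr.prodCongr e.permCongr) (fun a => ?_) fun a _ => ?_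
  · simp only [mem_transPairs, Equiv.prodCongr_apply, Prod.map_fst, Prod.map_snd,
      orb_sup_permCongr_eq_top_iff]
  · simp only [Equiv.prodCongr_apply, Prod.map_fst, Prod.map_snd, classProd_permCongr]

theorem permSum_eq (φ : ℕ → ℝ) : permSum X φ = permSum (Fin (Fintype.card X)) φ :=
  permSum_congr (Fintype.equivFin X) φ

theorem transSum_eq (φ ψ : ℕ → ℝ) : transSum X φ ψ = transSum (Fin (Fintype.card X)) φ ψ :=
  transSum_congr (Fintype.equivFin X) φ ψ

end PermSum

theorem permSum_zero (φ : ℕ → ℝ) : permSum (Fin 0) φ = 1 := by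
  simp [permSum, classProd_of_isEmpty]

theorem filter_mem_eq_powerset (n : ℕ) : (univ.filter fun S : Finset (Fin (n + 1)) => 0 ∈ S) =
    (insert 0 ((univ : Finset (Fin (n + 1))).erase 0)).powerset.filter fun S => 0 ∈ S := by
  rw [insert_erase (mem_univ _), powerset_univ]

theorem sum_filter_zero_mem (n : ℕ) (g : ℕ → ℝ) :
    ∑ S ∈ univ.filter (fun S : Finset (Fin (n + 1)) => 0 ∈ S), g #S =
      ∑ k ∈ range (n + 1), (n.choose k : ℝ) * g (k + 1) := by
  rw [filter_mem_eq_powerset, sum_powerset_filter_mem (notMem_erase _ _)]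
  simp

theorem card_notMem {n : ℕ} (S : Finset (Fin n)) : Fintype.card {x // ¬ x ∈ S} = n - #S := by
  rw [Fintype.card_subtype_compl, Fintype.card_fin, Fintype.card_coe]

/-- The exponential formula for pairs of permutations. -/
theorem isCum_transSum (φ ψ : ℕ → ℝ) :
    IsCum (fun n => permSum (Fin n) φ * permSum (Fin n) ψ) (fun n => transSum (Fin n) φ ψ) := by
  intro n
  have h1 : permSum (Fin (n + 1)) φ * permSum (Fin (n + 1)) ψ =
      ∑ a : Equiv.Perm (Fin (n + 1)) × Equiv.Perm (Fin (n + 1)),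
        classProd φ (orb a.1) * classProd ψ (orb a.2) := by
    rw [permSum, permSum, Fintype.sum_mul_sum, ← Fintype.sum_prod_type']
  simp only
  -- On the joint orbit `S` of `0` the pair is transitive, on the complement it is arbitrary. The
  -- weights factor accordingly, and the result depends on `S` only through its size.
  rw [h1, sum_pairs_eq_sum_orbit 0]
  have h2 := sum_filter_zero_mem n fun k => transSum (Fin k) φ ψ *
    (permSum (Fin (n + 1 - k)) φ * permSum (Fin (n + 1 - k)) ψ)
  have h3 : ∀ k, n + 1 - (k + 1) = n - k := fun k => by omega
  refine Eq.trans (sum_congr rfl fun S _ => ?_) (h2.trans (sum_congr rfl fun k _ => ?_))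
  swap
  · rw [h3 k, mul_assoc]
  have e1 := transSum_eq (X := {x // x ∈ S}) φ ψ
  have e2 := permSum_eq (X := {x // ¬ x ∈ S}) φ
  have e3 := permSum_eq (X := {x // ¬ x ∈ S}) ψ
  rw [card_notMem] at e2 e3
  rw [Fintype.card_coe] at e1
  rw [← e1, ← e2, ← e3, transSum, permSum, permSum, sum_mul]
  refine sum_congr rfl fun a _ => ?_
  rw [Fintype.sum_mul_sum, ← Fintype.sum_prod_type', mul_sum]
  refine sum_congr rfl fun b _ => ?_
  rw [classProd_subtypeCongr, classProd_subtypeCongr]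
  ring

/-! ### Exponential formula for single permutations -/

section Single

variable {X : Type*} [Fintype X] [DecidableEq X]

open Classical in
/-- The permutations with a single cycle. -/
noncomputable def longCycles (X : Type*) [Fintype X] [DecidableEq X] : Finset (Equiv.Perm X) :=
  univ.filter fun σ => orb σ = ⊤

theorem mem_longCycles {σ : Equiv.Perm X} : σ ∈ longCycles X ↔ orb σ = ⊤ := by simp [longCycles]

/-- A sum over permutations, split according to the cycle of `x₀`. -/
theorem sum_perm_eq_sum_orbit (x₀ : X) (f : Equiv.Perm X → ℝ) :
    ∑ σ, f σ = ∑ S ∈ univ.filter (fun S : Finset X => x₀ ∈ S),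
      ∑ a ∈ longCycles {x // x ∈ S}, ∑ b : Equiv.Perm {x // ¬ x ∈ S}, f (a.subtypeCongr b) := by
  -- A permutation is treated as a pair with trivial second component; such a pair is transitive
  -- exactly when the first component is a single cycle.
  have h := sum_pairs_eq_sum_orbit x₀ fun a => if a.2 = 1 then f a.1 else 0
  rw [Fintype.sum_prod_type] at h
  simp only [sum_ite_eq', mem_univ, if_true] at h
  rw [h]
  refine sum_congr rfl fun S _ => ?_
  have h1 : ∀ (a : Equiv.Perm {x // x ∈ S}) (b : Equiv.Perm {x // ¬ x ∈ S}),
      a.subtypeCongr b = 1 ↔ a = 1 ∧ b = 1 := by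
    intro a b
    rw [← Prod.mk.injEq, ← (Equiv.Perm.subtypeCongrHom_injective (· ∈ S)).eq_iff]
    have : Equiv.Perm.subtypeCongrHom (· ∈ S) ((1 : Equiv.Perm {x // x ∈ S}),
      (1 : Equiv.Perm {x // ¬ x ∈ S})) = 1 := map_one _
    rw [this]
    rfl
  simp only [h1]
  have h2 : ∀ a : Equiv.Perm {x // x ∈ S} × Equiv.Perm {x // x ∈ S},
      (∑ b : Equiv.Perm {x // ¬ x ∈ S} × Equiv.Perm {x // ¬ x ∈ S},
        if a.2 = 1 ∧ b.2 = 1 then f (a.1.subtypeCongr b.1) else 0) =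
      if a.2 = 1 then ∑ b : Equiv.Perm {x // ¬ x ∈ S}, f (a.1.subtypeCongr b) else 0 := by
    intro a
    rw [Fintype.sum_prod_type]
    split_ifs with ha <;> simp [ha]
  simp only [h2]
  classical
  rw [transPairs, sum_filter, Fintype.sum_prod_type, longCycles, sum_filter]
  refine sum_congr rfl fun a _ => ?_
  rw [sum_eq_single 1 (fun b _ hb => by simp [hb]) (by simp)]
  simp [orb_one]

end Single

theorem card_longCycles_congr {X Y : Type*} [Fintype X] [DecidableEq X] [Fintype Y]
    [DecidableEq Y] (e : X ≃ Y) : #(longCycles X) = #(longCycles Y) := by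
  refine card_equiv e.permCongr fun σ => ?_
  rw [mem_longCycles, mem_longCycles]
  have := orb_sup_permCongr_eq_top_iff e (α := σ) (β := σ)
  rw [sup_idem, sup_idem] at this
  exact this.symm

/-- The cycle of `0` contributes `φ` of its length for each cyclic order on it. The number of cyclic
orders is left symbolic, since this very identity with `φ = 1` determines it. -/
theorem isCum_permSum_aux (φ : ℕ → ℝ) :
    IsCum (fun n => permSum (Fin n) φ) (fun n => #(longCycles (Fin n)) * φ n) := by
  intro n
  simp only
  rw [permSum, sum_perm_eq_sum_orbit 0]
  have h2 := sum_filter_zero_mem n fun k => #(longCycles (Fin k)) * φ k *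
    permSum (Fin (n + 1 - k)) φ
  have h3 : ∀ k, n + 1 - (k + 1) = n - k := fun k => by omega
  refine Eq.trans (sum_congr rfl fun S hS => ?_) (h2.trans (sum_congr rfl fun k _ => ?_))
  swap
  · rw [h3 k, ← mul_assoc]
  simp only [mem_filter, mem_univ, true_and] at hS
  have : Nonempty {x // x ∈ S} := ⟨⟨0, hS⟩⟩
  have e1 := card_longCycles_congr (Fintype.equivFin {x // x ∈ S})
  have e2 := permSum_eq (X := {x // ¬ x ∈ S}) φ
  rw [card_notMem] at e2
  rw [Fintype.card_coe] at e1
  rw [← e1, ← e2, permSum]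
  have h4 : ∀ a ∈ longCycles {x // x ∈ S}, (∑ b : Equiv.Perm {x // ¬ x ∈ S},
      classProd φ (orb (a.subtypeCongr b))) = φ #S * ∑ b : Equiv.Perm {x // ¬ x ∈ S},
      classProd φ (orb b) := by
    intro a ha
    rw [mul_sum]
    refine sum_congr rfl fun b _ => ?_
    rw [classProd_subtypeCongr, mem_longCycles.mp ha, classProd_top, Fintype.card_coe]
  rw [sum_congr rfl h4, sum_const, nsmul_eq_mul, mul_assoc]

/-- With `φ = 1` the permutation sums are factorials. In `(n+1)! = ∑ (n choose k) k! (n-k)!` all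
`n+1` terms equal `n!`, so the cumulants of the factorials are `(n-1)!`, and cumulants are unique.
-/
theorem card_longCycles (n : ℕ) : #(longCycles (Fin (n + 1))) = n.factorial := by
  have h1 := isCum_permSum_aux fun _ => 1
  have h2 : ∀ n, permSum (Fin n) (fun _ => 1) = n.factorial := by
    intro n
    simp [permSum, classProd_const, Fintype.card_perm]
  simp only [h2, mul_one] at h1
  have h3 : IsCum (fun n => (n.factorial : ℝ)) (fun n => ((n - 1).factorial : ℝ)) := by
    intro n
    have : ∀ k ∈ range (n + 1), (n.choose k : ℝ) * ((k + 1 - 1).factorial : ℝ) *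
        ((n - k).factorial : ℝ) = n.factorial := by
      intro k hk
      rw [Nat.add_sub_cancel]
      exact_mod_cast Nat.choose_mul_factorial_mul_factorial (by simpa [Nat.lt_succ_iff] using hk)
    rw [sum_congr rfl this]
    simp [Nat.factorial_succ]
  have := h1.unique_cumulant (by simp) h3 n
  exact_mod_cast this

/-- The exponential formula for permutations. -/
theorem isCum_permSum (φ : ℕ → ℝ) :
    IsCum (fun n => permSum (Fin n) φ) (fun n => ((n - 1).factorial : ℝ) * φ n) :=
  (isCum_permSum_aux φ).congr fun n => by rw [card_longCycles, Nat.add_sub_cancel]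

end FiniteFree

namespace FiniteFree

/-! ### Cumulants as sums over set partitions -/

section SetPartitionSum

variable {X : Type*} [DecidableEq X]

/-- The weight `(-1)^{k-1} (k-1)!` of a partition with `k` blocks. -/
noncomputable def blockWeight (k : ℕ) : ℝ := (-1) ^ (k - 1) * ((k - 1).factorial : ℝ)

open Classical in
/-- The set of partitions of `s`, as sets of blocks. -/
noncomputable def partsSet (s : Finset X) : Finset (Finset (Finset X)) :=
  s.powerset.powerset.filter fun P => ∅ ∉ P ∧ ∀ x ∈ s, ∃! V, V ∈ P ∧ x ∈ V

theorem mem_partsSet {s : Finset X} {P : Finset (Finset X)} :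
    P ∈ partsSet s ↔ (∀ V ∈ P, V ⊆ s) ∧ ∅ ∉ P ∧ ∀ x ∈ s, ∃! V, V ∈ P ∧ x ∈ V := by
  simp only [partsSet, mem_filter, mem_powerset]
  refine and_congr_left fun _ => ⟨fun h V hV => mem_powerset.mp (h hV), fun h V hV =>
    mem_powerset.mpr (h V hV)⟩

theorem sum_finpartition_eq (s : Finset X) (F : Finset (Finset X) → ℝ) :
    ∑ π : Finpartition s, F π.parts = ∑ P ∈ partsSet s, F P := by
  refine sum_bij (fun π _ => π.parts) (fun π _ => ?_) (fun π _ π' _ h => Finpartition.ext h)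
    (fun P hP => ?_) fun _ _ => rfl
  · exact mem_partsSet.mpr ⟨fun V hV => π.le hV, π.bot_notMem, fun x hx => π.existsUnique_mem hx⟩
  · obtain ⟨h1, h2, h3⟩ := mem_partsSet.mp hP
    exact ⟨Finpartition.ofExistsUnique P h1 h3 h2, mem_univ _, rfl⟩

/-- The cumulant of `e` computed over the partitions of `s`. -/
noncomputable def setCum (e : ℕ → ℝ) (s : Finset X) : ℝ :=
  ∑ P ∈ partsSet s, blockWeight #P * ∏ V ∈ P, e #V

theorem eq_of_mem_partsSet {s : Finset X} {P : Finset (Finset X)} (hP : P ∈ partsSet s)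
    {V W : Finset X} (hV : V ∈ P) (hW : W ∈ P) {x : X} (hxV : x ∈ V) (hxW : x ∈ W) : V = W := by
  obtain ⟨h1, -, h3⟩ := mem_partsSet.mp hP
  exact (h3 x (h1 V hV hxV)).unique ⟨hV, hxV⟩ ⟨hW, hxW⟩

theorem insert_mem_partsSet {s B : Finset X} {P : Finset (Finset X)} (hB : B ⊆ s)
    (hne : B.Nonempty) (hP : P ∈ partsSet (s \ B)) : insert B P ∈ partsSet s := by
  obtain ⟨h1, h2, h3⟩ := mem_partsSet.mp hP
  refine mem_partsSet.mpr ⟨?_, ?_, ?_⟩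
  · intro V hV
    rcases mem_insert.mp hV with rfl | hV
    · exact hB
    · exact (h1 V hV).trans sdiff_subset
  · rw [mem_insert, not_or]
    exact ⟨hne.ne_empty.symm, h2⟩
  · intro x hx
    by_cases hxB : x ∈ B
    · refine ⟨B, ⟨mem_insert_self _ _, hxB⟩, ?_⟩
      rintro V ⟨hV, hxV⟩
      rcases mem_insert.mp hV with rfl | hV
      · rfl
      · exact absurd hxB (mem_sdiff.mp (h1 V hV hxV)).2
    · obtain ⟨V, ⟨hV, hxV⟩, huniq⟩ := h3 x (mem_sdiff.mpr ⟨hx, hxB⟩)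
      refine ⟨V, ⟨mem_insert_of_mem hV, hxV⟩, ?_⟩
      rintro W ⟨hW, hxW⟩
      rcases mem_insert.mp hW with rfl | hW
      · exact absurd hxW hxB
      · exact huniq W ⟨hW, hxW⟩

theorem erase_mem_partsSet {s B : Finset X} {P : Finset (Finset X)} (hP : P ∈ partsSet s)
    (hB : B ∈ P) : P.erase B ∈ partsSet (s \ B) := by
  obtain ⟨h1, h2, h3⟩ := mem_partsSet.mp hP
  refine mem_partsSet.mpr ⟨?_, ?_, ?_⟩
  · intro V hV x hx
    obtain ⟨hne, hV⟩ := mem_erase.mp hV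
    exact mem_sdiff.mpr ⟨h1 V hV hx, fun hxB => hne (eq_of_mem_partsSet hP hV hB hx hxB)⟩
  · exact fun h => h2 (mem_of_mem_erase h)
  · intro x hx
    obtain ⟨hxs, hxB⟩ := mem_sdiff.mp hx
    obtain ⟨V, ⟨hV, hxV⟩, huniq⟩ := h3 x hxs
    exact ⟨V, ⟨mem_erase.mpr ⟨fun h => hxB (h ▸ hxV), hV⟩, hxV⟩,
      fun W hW => huniq W ⟨mem_of_mem_erase hW.1, hW.2⟩⟩

theorem notMem_partsSet_sdiff {s B : Finset X} {P : Finset (Finset X)} (hne : B.Nonempty)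
    (hP : P ∈ partsSet (s \ B)) : B ∉ P := by
  intro h
  obtain ⟨x, hx⟩ := hne
  exact (mem_sdiff.mp ((mem_partsSet.mp hP).1 B h hx)).2 hx

theorem card_filter_notMem_partsSet {s : Finset X} {x₀ : X} (hx₀ : x₀ ∈ s)
    {P : Finset (Finset X)} (hP : P ∈ partsSet s) :
    #(P.filter fun B => x₀ ∉ B) + 1 = #P := by
  obtain ⟨V, ⟨hV, hxV⟩, huniq⟩ := (mem_partsSet.mp hP).2.2 x₀ hx₀
  have : P.filter (fun B => x₀ ∉ B) = P.erase V := by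
    ext W
    rw [mem_filter, mem_erase]
    exact ⟨fun h => ⟨fun e => h.2 (e ▸ hxV), h.1⟩, fun h => ⟨h.2, fun hx => h.1 (huniq W ⟨h.2, hx⟩)⟩⟩
  rw [this, card_erase_add_one hV]

theorem partsSet_card_one {s : Finset X} (hs : s.Nonempty) :
    (partsSet s).filter (fun P => #P = 1) = {{s}} := by
  ext P
  rw [mem_filter, mem_singleton, card_eq_one]
  constructor
  · rintro ⟨hP, V, rfl⟩
    obtain ⟨h1, -, h3⟩ := mem_partsSet.mp hP
    congr 1
    refine (h1 V (mem_singleton_self V)).antisymm fun x hx => ?_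
    obtain ⟨W, ⟨hW, hxW⟩, -⟩ := h3 x hx
    rwa [mem_singleton.mp hW] at hxW
  · rintro rfl
    refine ⟨mem_partsSet.mpr ⟨fun V hV => (mem_singleton.mp hV).le, ?_, fun x hx => ?_⟩, s, rfl⟩
    · rw [mem_singleton]; exact hs.ne_empty.symm
    · exact ⟨s, ⟨mem_singleton_self s, hx⟩, fun V hV => mem_singleton.mp hV.1⟩

/-- The Möbius cancellation: `k` is the number of blocks not containing the base point, each of
which can be marked. -/
theorem blockWeight_rec (k : ℕ) :
    blockWeight (k + 1) + k * blockWeight k = if k = 0 then 1 else 0 := by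
  rcases k with _ | k
  · simp [blockWeight]
  · simp only [blockWeight, Nat.factorial_succ, pow_succ, Nat.add_sub_cancel, Nat.succ_ne_zero,
      if_false]
    push_cast
    ring

/-- Adjoin `B = s \ S` as a block to a partition of `S`: for nonempty `B` this gives the partitions
of `s` with a marked block avoiding `x₀`, and `B = ∅` gives the unmarked ones. For each partition of
`s` these contributions cancel by `blockWeight_rec` unless it has only one block. -/
theorem sum_setCum {s : Finset X} {x₀ : X} (hx₀ : x₀ ∈ s) {e : ℕ → ℝ} (h0 : e 0 = 1) :
    ∑ S ∈ s.powerset.filter (fun S => x₀ ∈ S), setCum e S * e (#s - #S) = e #s := by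
  have h1 : ∑ S ∈ s.powerset.filter (fun S => x₀ ∈ S), setCum e S * e (#s - #S) =
      ∑ B ∈ (s.erase x₀).powerset, setCum e (s \ B) * e #B := by
    refine sum_bij' (fun S _ => s \ S) (fun B _ => s \ B) ?_ ?_ ?_ ?_ ?_
    · intro S hS
      obtain ⟨h, hx⟩ := mem_filter.mp hS
      exact mem_powerset.mpr (subset_erase.mpr ⟨sdiff_subset, fun h' => (mem_sdiff.mp h').2 hx⟩)
    · intro B hB
      have := subset_erase.mp (mem_powerset.mp hB)
      exact mem_filter.mpr ⟨mem_powerset.mpr sdiff_subset, mem_sdiff.mpr ⟨hx₀, this.2⟩⟩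
    · intro S hS
      exact Finset.sdiff_sdiff_eq_self (mem_powerset.mp (mem_filter.mp hS).1)
    · intro B hB
      exact Finset.sdiff_sdiff_eq_self (subset_erase.mp (mem_powerset.mp hB)).1
    · intro S hS
      have := mem_powerset.mp (mem_filter.mp hS).1
      rw [Finset.sdiff_sdiff_eq_self this, card_sdiff_of_subset this]
  have h2 : ∑ B ∈ (s.erase x₀).powerset.erase ∅, setCum e (s \ B) * e #B =
      ∑ P ∈ partsSet s, ∑ B ∈ P.filter (fun B => x₀ ∉ B),
        blockWeight (#P - 1) * ∏ V ∈ P, e #V := by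
    simp only [setCum, sum_mul]
    rw [sum_sigma', sum_sigma']
    refine sum_bij' (fun c _ => ⟨insert c.1 c.2, c.1⟩) (fun c _ => ⟨c.2, c.1.erase c.2⟩) ?_ ?_ ?_ ?_ ?_
    · rintro ⟨B, P⟩ h
      simp only [mem_sigma, mem_erase, mem_powerset, mem_filter] at h ⊢
      have hB := subset_erase.mp h.1.2
      exact ⟨insert_mem_partsSet hB.1 (nonempty_iff_ne_empty.mpr h.1.1) h.2, mem_insert_self _ _, hB.2⟩
    · rintro ⟨P, B⟩ h
      simp only [mem_sigma, mem_erase, mem_powerset, mem_filter] at h ⊢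
      obtain ⟨h1, h2, h3⟩ := mem_partsSet.mp h.1
      exact ⟨⟨fun e => h2 (e ▸ h.2.1), subset_erase.mpr ⟨h1 B h.2.1, h.2.2⟩⟩,
        erase_mem_partsSet h.1 h.2.1⟩
    · rintro ⟨B, P⟩ h
      simp only [mem_sigma, mem_erase, mem_powerset] at h
      simp only [erase_insert (notMem_partsSet_sdiff (nonempty_iff_ne_empty.mpr h.1.1) h.2)]
    · rintro ⟨P, B⟩ h
      simp only [mem_sigma, mem_filter] at h
      simp only [insert_erase h.2.1]
    · rintro ⟨B, P⟩ h
      simp only [mem_sigma, mem_erase, mem_powerset] at h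
      have hn := notMem_partsSet_sdiff (nonempty_iff_ne_empty.mpr h.1.1) h.2
      simp only [card_insert_of_notMem hn, prod_insert hn, Nat.add_sub_cancel]
      ring
  rw [h1, ← add_sum_erase _ _ (empty_mem_powerset _), h2, sdiff_empty, card_empty, h0, mul_one,
    setCum, ← sum_add_distrib]
  have h3 : ∀ P ∈ partsSet s, blockWeight #P * ∏ V ∈ P, e #V +
      ∑ B ∈ P.filter (fun B => x₀ ∉ B), blockWeight (#P - 1) * ∏ V ∈ P, e #V =
      if #P = 1 then ∏ V ∈ P, e #V else 0 := by
    intro P hP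
    have hc := card_filter_notMem_partsSet hx₀ hP
    rw [sum_const, nsmul_eq_mul, ← hc, Nat.add_sub_cancel, ← mul_assoc, ← add_mul, blockWeight_rec]
    simp
  rw [sum_congr rfl h3, ← sum_filter, partsSet_card_one ⟨x₀, hx₀⟩, sum_singleton, prod_singleton]

theorem setCum_eq {e c : ℕ → ℝ} (h0 : e 0 = 1) (h : IsCum e c) {s : Finset X} (hs : s.Nonempty) :
    setCum e s = c #s := by
  induction hk : #s using Nat.strong_induction_on generalizing s with | _ k ih
  obtain ⟨x₀, hx₀⟩ := hs
  have h1 := sum_setCum hx₀ h0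
  have h2 : e #s = ∑ S ∈ s.powerset.filter (fun S => x₀ ∈ S), c #S * e (#s - #S) := by
    have hn := card_erase_add_one hx₀
    have := sum_powerset_filter_mem (notMem_erase x₀ s) fun k => c k * e (#s - k)
    rw [insert_erase hx₀] at this
    rw [this, ← hn, h]
    refine sum_congr rfl fun k _ => ?_
    rw [Nat.add_sub_add_right, mul_assoc]
  have hmem : s ∈ s.powerset.filter (fun S => x₀ ∈ S) := mem_filter.mpr ⟨mem_powerset_self s, hx₀⟩
  rw [h2, ← add_sum_erase _ _ hmem, ← add_sum_erase _ _ hmem] at h1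
  have h3 : ∀ S ∈ (s.powerset.filter fun S => x₀ ∈ S).erase s,
      setCum e S * e (#s - #S) = c #S * e (#s - #S) := by
    intro S hS
    obtain ⟨hne, hS⟩ := mem_erase.mp hS
    obtain ⟨hS, hx⟩ := mem_filter.mp hS
    rw [ih #S (hk ▸ card_lt_card ((mem_powerset.mp hS).ssubset_of_ne hne)) ⟨x₀, hx⟩ rfl]
  rw [sum_congr rfl h3] at h1
  simpa [h0, hk] using h1

end SetPartitionSum

theorem isCum_setPartition {e : ℕ → ℝ} (h0 : e 0 = 1) :
    IsCum e fun n => ∑ π : SetPartition n, (-1) ^ (#π.parts - 1) *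
      ((#π.parts - 1).factorial : ℝ) * blockProd e π := by
  refine (isCum_cumSeq h0).congr fun n => ?_
  have h1 := setCum_eq h0 (isCum_cumSeq h0) (univ_nonempty (α := Fin (n + 1)))
  rw [card_univ, Fintype.card_fin] at h1
  rw [← h1, setCum, ← sum_finpartition_eq]
  rfl

end FiniteFree

namespace FiniteFree

/-! ### Newton's identities -/

theorem newton_multiset (s : Multiset ℂ) (n : ℕ) :
    ((n + 1 : ℕ) : ℂ) * s.esymm (n + 1) =
      ∑ k ∈ range (n + 1), (-1) ^ k * (s.map (fun z => z ^ (k + 1))).sum * s.esymm (n - k) := by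
  have h := congrArg (MvPolynomial.aeval (fun x : s => (x : ℂ))) (MvPolynomial.mul_esymm_eq_sum s ℂ (n + 1))
  have hp : ∀ k, MvPolynomial.aeval (fun x : s => (x : ℂ)) (MvPolynomial.psum s ℂ k) =
      (s.map (fun z => z ^ k)).sum := by
    intro k
    conv_rhs => rw [← s.map_univ_coe, Multiset.map_map]
    simp only [MvPolynomial.psum, map_sum, map_pow, MvPolynomial.aeval_X]
    rfl
  simp only [map_mul, map_sum, map_pow, map_neg, map_one, map_natCast,
    MvPolynomial.aeval_esymm_eq_multiset_esymm, hp, s.map_univ_coe] at h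
  rw [h, sum_filter, Nat.sum_antidiagonal_eq_sum_range_succ_mk, sum_range_succ,
    if_neg (lt_irrefl _), add_zero, ← sum_range_reflect, mul_sum]
  refine sum_congr rfl fun k hk => ?_
  have hk := mem_range.mp hk
  have e1 : n + 1 - 1 - k = n - k := by omega
  have e2 : n + 1 - (n - k) = k + 1 := by omega
  simp only [e1, e2]
  -- After the reversal of the summation index the two signs combine to an even power times
  -- `(-1)^k`.
  rw [if_pos (by omega), ← mul_assoc, ← mul_assoc, ← pow_add,
    show n + 1 + 1 + (n - k) = 2 * (n + 1 - k) + k by omega, pow_add, pow_mul]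
  simp
  ring

section Poly

variable {d : ℕ} {p q : ℝ[X]}

theorem normCoeff_eq_esymm (hp : p.Monic) (hd : p.natDegree = d) (n : ℕ) :
    (((d.choose n : ℝ) * normCoeff d p n : ℝ) : ℂ) = (p.aroots ℂ).esymm n := by
  have hs := IsAlgClosed.splits (p.map (algebraMap ℝ ℂ))
  have hdeg : (p.map (algebraMap ℝ ℂ)).natDegree = d := by rw [hp.natDegree_map, hd]
  have hcard : Multiset.card (p.aroots ℂ) = d := by
    rw [← hdeg]; exact splits_iff_card_roots.mp hs
  rcases le_or_gt n d with hn | hn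
  · have h := coeff_eq_esymm_roots_of_splits hs (k := d - n) (by rw [hdeg]; omega)
    rw [hdeg, (hp.map _).leadingCoeff, one_mul, Nat.sub_sub_self hn, coeff_map] at h
    have hc : (d.choose n : ℝ) ≠ 0 := by exact_mod_cast (Nat.choose_pos hn).ne'
    have h2 : (d.choose n : ℝ) * normCoeff d p n = (-1) ^ n * p.coeff (d - n) := by
      rw [normCoeff]; field_simp
    have h3 : ((p.coeff (d - n) : ℝ) : ℂ) =
      (-1) ^ n * (p.map (algebraMap ℝ ℂ)).roots.esymm n := h
    rw [h2, Complex.ofReal_mul, h3, Complex.ofReal_pow, ← mul_assoc, ← mul_pow]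
    simp [aroots]
  -- Above the degree both sides vanish, so Newton's recursion is available for every index.
  · rw [Nat.choose_eq_zero_of_lt hn, Multiset.esymm, Multiset.powersetCard_eq_empty _ (by omega)]
    simp

theorem normCoeff_zero (hp : p.Monic) (hd : p.natDegree = d) : normCoeff d p 0 = 1 := by
  simp [normCoeff, ← hd, hp.coeff_natDegree]

/-- The value 0 comes from division by `d.choose n = 0`. It lets the identities below hold for all
`n`, without the restriction `n ≤ d`. -/
theorem normCoeff_of_lt {n : ℕ} (h : d < n) : normCoeff d p n = 0 := by
  simp [normCoeff, Nat.choose_eq_zero_of_lt h]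

/-- `φ_k = (-1)^{k-1} d u_k`. -/
noncomputable def powerWeight (d : ℕ) (u : ℕ → ℝ) (k : ℕ) : ℝ := (-1) ^ (k - 1) * ((d : ℝ) * u k)

/-- `ψ_k = (-1/d)^{k-1} u_k`. -/
noncomputable def cumulantWeight (d : ℕ) (u : ℕ → ℝ) (k : ℕ) : ℝ := (-(1 / (d : ℝ))) ^ (k - 1) * u k

theorem ofReal_rootMoment (hd : 1 ≤ d) (n : ℕ) :
    (((d : ℝ) * rootMoment d p n : ℝ) : ℂ) = ((p.aroots ℂ).map (fun z => z ^ n)).sum := by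
  have hd' : (d : ℝ) ≠ 0 := by exact_mod_cast (by omega : d ≠ 0)
  rw [rootMoment, mul_div_cancel₀ _ hd']
  exact Complex.ext rfl (by rw [sum_aroots_pow_im]; simp)

/-- These are Newton's identities multiplied by `n!`: the factorials `k!` and `(n-k)!` produce the
binomial coefficient of the cumulant recursion. -/
theorem isCum_rootMoment (hd1 : 1 ≤ d) (hp : p.Monic) (hd : p.natDegree = d) :
    IsCum (fun n => (n.factorial : ℝ) * ((d.choose n : ℝ) * normCoeff d p n))
      (fun n => ((n - 1).factorial : ℝ) * powerWeight d (rootMoment d p) n) := by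
  intro n
  apply Complex.ofReal_injective
  have h := newton_multiset (p.aroots ℂ) n
  simp only
  rw [Complex.ofReal_mul, normCoeff_eq_esymm hp hd, Nat.factorial_succ, Complex.ofReal_natCast,
    Nat.cast_mul, mul_comm (((n + 1 : ℕ) : ℂ)), mul_assoc, h, mul_sum, Complex.ofReal_sum]
  refine sum_congr rfl fun k hk => ?_
  have hk := Nat.lt_succ_iff.mp (mem_range.mp hk)
  rw [Complex.ofReal_mul, Complex.ofReal_mul _ ((d.choose (n - k) : ℝ) * _),
    normCoeff_eq_esymm hp hd, powerWeight, Nat.add_sub_cancel, Complex.ofReal_mul,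
    Complex.ofReal_mul (k.factorial : ℝ), Complex.ofReal_mul ((-1) ^ k), ofReal_rootMoment hd1,
    ← Nat.choose_mul_factorial_mul_factorial hk]
  push_cast
  ring

theorem permSum_powerWeight (hd1 : 1 ≤ d) (hp : p.Monic) (hd : p.natDegree = d) (n : ℕ) :
    permSum (Fin n) (powerWeight d (rootMoment d p)) =
      (n.factorial : ℝ) * ((d.choose n : ℝ) * normCoeff d p n) :=
  (isCum_permSum _).unique_moment (by simp [permSum_zero, normCoeff_zero hp hd])
    (isCum_rootMoment hd1 hp hd) n

/-- The sum over set partitions in the definition of `κ_n` is the classical cumulant of the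
normalized coefficients; the prefactor only rescales it. -/
theorem isCum_cumulantWeight (hd1 : 1 ≤ d) (hp : p.Monic) (hd : p.natDegree = d) :
    IsCum (normCoeff d p)
      (fun n => ((n - 1).factorial : ℝ) * cumulantWeight d (finiteFreeCumulant d p) n) := by
  refine (isCum_setPartition (normCoeff_zero hp hd)).congr fun n => ?_
  have hd' : (d : ℝ) ≠ 0 := by exact_mod_cast (by omega : d ≠ 0)
  have hf : (n.factorial : ℝ) ≠ 0 := by exact_mod_cast n.factorial_ne_zero
  rw [cumulantWeight, finiteFreeCumulant, Nat.add_sub_cancel]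
  have h1 : (-(1 / (d : ℝ))) ^ n * (-(d : ℝ)) ^ n = 1 := by
    rw [← mul_pow]; field_simp; simp
  generalize (∑ π : SetPartition (n + 1), (-1) ^ (#π.parts - 1) * ((#π.parts - 1).factorial : ℝ) *
      blockProd (normCoeff d p) π) = S
  calc S = ((-(1 / (d : ℝ))) ^ n * (-(d : ℝ)) ^ n) * S := by rw [h1, one_mul]
    _ = _ := by field_simp

theorem permSum_cumulantWeight (hd1 : 1 ≤ d) (hp : p.Monic) (hd : p.natDegree = d) (n : ℕ) :
    permSum (Fin n) (cumulantWeight d (finiteFreeCumulant d p)) = normCoeff d p n :=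
  (isCum_permSum _).unique_moment (by simp [permSum_zero, normCoeff_zero hp hd])
    (isCum_cumulantWeight hd1 hp hd) n

/-! ### Coefficients of the finite free multiplicative convolution -/

theorem coeff_finiteFreeMul {k : ℕ} (hk : k ≤ d) :
    (finiteFreeMul d p q).coeff (d - k) =
      (-1) ^ k * (d.choose k : ℝ) * (normCoeff d p k * normCoeff d q k) := by
  rw [finiteFreeMul, finsetSum_coeff, sum_eq_single k]
  · rw [coeff_C_mul, coeff_X_pow, if_pos rfl, mul_one]
  · intro j hj hjk
    have := mem_range.mp hj
    rw [coeff_C_mul, coeff_X_pow, if_neg (by omega), mul_zero]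
  · intro h
    exact absurd (mem_range.mpr (by omega)) h

theorem normCoeff_finiteFreeMul (n : ℕ) :
    normCoeff d (finiteFreeMul d p q) n = normCoeff d p n * normCoeff d q n := by
  rcases le_or_gt n d with hn | hn
  · have hc : (d.choose n : ℝ) ≠ 0 := by exact_mod_cast (Nat.choose_pos hn).ne'
    rw [normCoeff, coeff_finiteFreeMul hn, mul_assoc ((-1) ^ n), ← mul_assoc ((-1) ^ n), ← mul_pow]
    field_simp
    simp
  · simp [normCoeff_of_lt hn]

theorem natDegree_finiteFreeMul_le : (finiteFreeMul d p q).natDegree ≤ d := by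
  refine natDegree_sum_le_of_forall_le _ _ fun k _ => ?_
  exact (natDegree_C_mul_X_pow_le _ _).trans (Nat.sub_le _ _)

theorem coeff_finiteFreeMul_top (hp : p.Monic) (hpd : p.natDegree = d) (hq : q.Monic)
    (hqd : q.natDegree = d) : (finiteFreeMul d p q).coeff d = 1 := by
  have := coeff_finiteFreeMul (d := d) (p := p) (q := q) (k := 0) (Nat.zero_le _)
  simpa [normCoeff_zero hp hpd, normCoeff_zero hq hqd] using this

theorem monic_finiteFreeMul (hp : p.Monic) (hpd : p.natDegree = d) (hq : q.Monic)
    (hqd : q.natDegree = d) : (finiteFreeMul d p q).Monic :=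
  monic_of_natDegree_le_of_coeff_eq_one d natDegree_finiteFreeMul_le
    (coeff_finiteFreeMul_top hp hpd hq hqd)

theorem natDegree_finiteFreeMul (hp : p.Monic) (hpd : p.natDegree = d) (hq : q.Monic)
    (hqd : q.natDegree = d) : (finiteFreeMul d p q).natDegree = d :=
  natDegree_finiteFreeMul_le.antisymm (le_natDegree_of_ne_zero (by
    rw [coeff_finiteFreeMul_top hp hpd hq hqd]; exact one_ne_zero))

/-- The sequence `n! (d choose n) e_n(p) e_n(q)` is a product of two permutation sums and is also
Newton's sequence for `p ⊠_d q`. Its cumulants are computed in both ways. -/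
theorem transSum_power_cumulant (hd1 : 1 ≤ d) (hp : p.Monic) (hpd : p.natDegree = d) (hq : q.Monic)
    (hqd : q.natDegree = d) (n : ℕ) :
    transSum (Fin (n + 1)) (powerWeight d (rootMoment d p))
      (cumulantWeight d (finiteFreeCumulant d q)) =
    (n.factorial : ℝ) * powerWeight d (rootMoment d (finiteFreeMul d p q)) (n + 1) := by
  have h1 := isCum_transSum (powerWeight d (rootMoment d p))
    (cumulantWeight d (finiteFreeCumulant d q))
  have h2 := isCum_rootMoment hd1 (monic_finiteFreeMul hp hpd hq hqd)
    (natDegree_finiteFreeMul hp hpd hq hqd)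
  simp only [permSum_powerWeight hd1 hp hpd, permSum_cumulantWeight hd1 hq hqd] at h1
  simp only [normCoeff_finiteFreeMul, ← mul_assoc] at h1 h2
  exact h1.unique_cumulant (by simp [normCoeff_zero hp hpd, normCoeff_zero hq hqd]) h2 n

theorem transSum_cumulant_cumulant (hd1 : 1 ≤ d) (hp : p.Monic) (hpd : p.natDegree = d)
    (hq : q.Monic) (hqd : q.natDegree = d) (n : ℕ) :
    transSum (Fin (n + 1)) (cumulantWeight d (finiteFreeCumulant d p))
      (cumulantWeight d (finiteFreeCumulant d q)) =
    (n.factorial : ℝ) * cumulantWeight d (finiteFreeCumulant d (finiteFreeMul d p q)) (n + 1) := by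
  have h1 := isCum_transSum (cumulantWeight d (finiteFreeCumulant d p))
    (cumulantWeight d (finiteFreeCumulant d q))
  have h2 := isCum_cumulantWeight hd1 (monic_finiteFreeMul hp hpd hq hqd)
    (natDegree_finiteFreeMul hp hpd hq hqd)
  simp only [permSum_cumulantWeight hd1 hp hpd, permSum_cumulantWeight hd1 hq hqd] at h1
  rw [funext (normCoeff_finiteFreeMul (d := d) (p := p) (q := q))] at h2
  exact h1.unique_cumulant (by simp [normCoeff_zero hp hpd, normCoeff_zero hq hqd]) h2 n

theorem rootMoment_X_sub_one_pow (hd1 : 1 ≤ d) (n : ℕ) : rootMoment d ((X - C 1) ^ d) n = 1 := by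
  have hd' : (d : ℝ) ≠ 0 := by exact_mod_cast (by omega : d ≠ 0)
  rw [rootMoment_of_splits d (Splits.pow (Splits.X_sub_C 1) d), roots_pow, roots_X_sub_C]
  simp [Multiset.map_nsmul, Multiset.sum_nsmul, hd']

theorem monic_X_sub_one_pow : ((X - C 1 : ℝ[X]) ^ d).Monic := (monic_X_sub_C 1).pow d

theorem natDegree_X_sub_one_pow : ((X - C 1 : ℝ[X]) ^ d).natDegree = d := by
  rw [(monic_X_sub_C (1 : ℝ)).natDegree_pow, natDegree_X_sub_C, mul_one]

theorem normCoeff_X_sub_one_pow {n : ℕ} (hn : n ≤ d) : normCoeff d ((X - C 1) ^ d) n = 1 := by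
  have hc : (d.choose n : ℝ) ≠ 0 := by exact_mod_cast (Nat.choose_pos hn).ne'
  rw [normCoeff, sub_eq_add_neg, ← C_neg, coeff_X_add_C_pow, Nat.sub_sub_self hn, Nat.choose_symm hn,
    ← mul_assoc, ← mul_pow]
  simp [hc]

/-- All normalized coefficients of `(x-1)^d` up to index `d` are 1, so it is the unit. This turns
formulas for products into relations between the moments and the cumulants of one polynomial. -/
theorem finiteFreeMul_X_sub_one_pow (hqd : q.natDegree = d) :
    finiteFreeMul d ((X - C 1) ^ d) q = q := by
  ext k
  rcases le_or_gt k d with hk | hk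
  · obtain ⟨j, hj, rfl⟩ : ∃ j ≤ d, k = d - j := ⟨d - k, Nat.sub_le _ _, by omega⟩
    have hc : (d.choose j : ℝ) ≠ 0 := by exact_mod_cast (Nat.choose_pos hj).ne'
    rw [coeff_finiteFreeMul hj, normCoeff_X_sub_one_pow hj, one_mul, normCoeff, mul_assoc,
      mul_div_cancel₀ _ hc, ← mul_assoc, ← mul_pow]
    simp
  · rw [coeff_eq_zero_of_natDegree_lt (natDegree_finiteFreeMul_le.trans_lt hk),
      coeff_eq_zero_of_natDegree_lt (hqd.trans_lt hk)]

end Poly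

/-! ### The genus expansion -/

/-- The polynomial `1/(n-1)! ∑ (-ε)^{n+1-#α-#β} u_α v_β` over the pairs `(α, β)` that generate a
transitive group. -/
noncomputable def genusSum (n : ℕ) (ε : ℝ) (u v : ℕ → ℝ) : ℝ :=
  1 / ((n - 1).factorial : ℝ) * ∑ a ∈ transPairs (Fin n),
    (-ε) ^ (n + 1 - numClasses (orb a.1) - numClasses (orb a.2)) *
      (classProd u (orb a.1) * classProd v (orb a.2))

theorem numClasses_add_le_of_trans {X : Type*} [Fintype X] [DecidableEq X] [Nonempty X]
    {a : Equiv.Perm X × Equiv.Perm X} (h : a ∈ transPairs X) :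
    numClasses (orb a.1) + numClasses (orb a.2) + numClasses (orb (a.1 * a.2)) ≤
      Fintype.card X + 2 := by
  have h1 := euler_inequality a.1 a.2
  rwa [mem_transPairs.mp h, numClasses_top, Nat.card_eq_fintype_card] at h1

theorem transSum_eq_genusSum (d n : ℕ) (u v : ℕ → ℝ) :
    transSum (Fin (n + 1)) (cumulantWeight d u) (cumulantWeight d v) =
      (-(1 / (d : ℝ))) ^ n * (n.factorial : ℝ) * genusSum (n + 1) (1 / d) u v := by
  have hf : (n.factorial : ℝ) ≠ 0 := by exact_mod_cast n.factorial_ne_zero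
  rw [genusSum, Nat.add_sub_cancel, mul_assoc, ← mul_assoc (n.factorial : ℝ), mul_one_div_cancel hf,
    one_mul, mul_sum, transSum]
  refine sum_congr rfl fun a ha => ?_
  -- Together with `h2`, `h3`, `h4` this shows that none of the truncated subtractions in the
  -- exponents truncates.
  have h1 := numClasses_add_le_of_trans ha
  have h2 := numClasses_pos (orb (a.1 * a.2))
  have h3 := numClasses_le_card (orb a.1)
  have h4 := numClasses_le_card (orb a.2)
  rw [Fintype.card_fin] at h1 h3 h4
  have h5 : ∀ w : ℕ → ℝ, cumulantWeight d w = fun k => (-(1 / (d : ℝ))) ^ (k - 1) * w k :=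
    fun _ => rfl
  rw [h5, h5, classProd_pow_pred_mul, classProd_pow_pred_mul, Fintype.card_fin]
  have key : (-(1 / (d : ℝ))) ^ n *
      (-(1 / (d : ℝ))) ^ (n + 1 + 1 - numClasses (orb a.1) - numClasses (orb a.2)) =
      (-(1 / (d : ℝ))) ^ (n + 1 - numClasses (orb a.1)) *
      (-(1 / (d : ℝ))) ^ (n + 1 - numClasses (orb a.2)) := by
    rw [← pow_add, ← pow_add]
    congr 1
    omega
  linear_combination -(classProd u (orb a.1) * classProd v (orb a.2)) * key

/-- Distribute `d^n` as `d^k` over the cycles of length `k`, and use `d^k (-1/d)^{k-1} = (-1)^{k-1}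
d`. -/
theorem transSum_powerWeight {d : ℕ} (hd : 1 ≤ d) (n : ℕ) (u ψ : ℕ → ℝ) :
    transSum (Fin n) (powerWeight d u) ψ = (d : ℝ) ^ n * transSum (Fin n) (cumulantWeight d u) ψ := by
  rw [transSum, transSum, mul_sum]
  refine sum_congr rfl fun a _ => ?_
  have hd' : (d : ℝ) ≠ 0 := by exact_mod_cast (by omega : d ≠ 0)
  have h := classProd_pow (d : ℝ) (orb a.1)
  rw [Fintype.card_fin] at h
  rw [← mul_assoc, ← h, ← classProd_mul]
  congr 1
  refine classProd_congr (fun k hk => ?_) _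
  obtain ⟨k, rfl⟩ : ∃ j, k = j + 1 := ⟨k - 1, by omega⟩
  have key : (d : ℝ) ^ k * (-(1 / (d : ℝ))) ^ k = (-1) ^ k := by
    rw [← mul_pow]; congr 1; field_simp
  rw [powerWeight, cumulantWeight, Nat.add_sub_cancel, ← key]
  ring

/-! ### Exact genus expansions for fixed `d` -/

section Expansion

variable {d : ℕ} {p q : ℝ[X]}

theorem finiteFreeCumulant_finiteFreeMul (hd1 : 1 ≤ d) (hp : p.Monic) (hpd : p.natDegree = d)
    (hq : q.Monic) (hqd : q.natDegree = d) (n : ℕ) :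
    finiteFreeCumulant d (finiteFreeMul d p q) (n + 1) =
      genusSum (n + 1) (1 / d) (finiteFreeCumulant d p) (finiteFreeCumulant d q) := by
  have hd' : (d : ℝ) ≠ 0 := by exact_mod_cast (by omega : d ≠ 0)
  have hf : (n.factorial : ℝ) ≠ 0 := by exact_mod_cast n.factorial_ne_zero
  have h := transSum_cumulant_cumulant hd1 hp hpd hq hqd n
  rw [transSum_eq_genusSum, cumulantWeight, Nat.add_sub_cancel, mul_comm _ (n.factorial : ℝ),
    mul_assoc] at h
  have h0 : (-(1 / (d : ℝ))) ^ n ≠ 0 := pow_ne_zero _ (by simp [hd'])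
  exact (mul_left_cancel₀ h0 (mul_left_cancel₀ hf h)).symm

theorem rootMoment_finiteFreeMul (hd1 : 1 ≤ d) (hp : p.Monic) (hpd : p.natDegree = d)
    (hq : q.Monic) (hqd : q.natDegree = d) (n : ℕ) :
    rootMoment d (finiteFreeMul d p q) (n + 1) =
      genusSum (n + 1) (1 / d) (rootMoment d p) (finiteFreeCumulant d q) := by
  have hd' : (d : ℝ) ≠ 0 := by exact_mod_cast (by omega : d ≠ 0)
  have hf : (n.factorial : ℝ) ≠ 0 := by exact_mod_cast n.factorial_ne_zero
  have h := transSum_power_cumulant hd1 hp hpd hq hqd n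
  rw [transSum_powerWeight hd1, transSum_eq_genusSum, powerWeight, Nat.add_sub_cancel] at h
  have h1 : (d : ℝ) ^ (n + 1) * (-(1 / (d : ℝ))) ^ n = (-1) ^ n * d := by
    rw [← neg_one_mul, mul_pow, pow_succ, div_pow]; field_simp; simp
  have h0 : (-1 : ℝ) ^ n * d ≠ 0 := mul_ne_zero (pow_ne_zero _ (by norm_num)) hd'
  refine (mul_left_cancel₀ (mul_ne_zero hf h0) ?_).symm
  rw [← mul_assoc, ← mul_assoc, h1] at h
  linear_combination h

theorem rootMoment_eq_genusSum (hd1 : 1 ≤ d) (hq : q.Monic) (hqd : q.natDegree = d) (n : ℕ) :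
    rootMoment d q (n + 1) = genusSum (n + 1) (1 / d) (fun _ => 1) (finiteFreeCumulant d q) := by
  have h := rootMoment_finiteFreeMul hd1 monic_X_sub_one_pow natDegree_X_sub_one_pow hq hqd n
  rwa [finiteFreeMul_X_sub_one_pow hqd, funext (rootMoment_X_sub_one_pow hd1)] at h

end Expansion
end FiniteFree

namespace FiniteFree

/-! ### Factorizations of a permutation -/

section Factor

variable {X Y : Type*} [Fintype X] [DecidableEq X] [Fintype Y] [DecidableEq Y]

open Classical in
/-- The permutations `α` such that `α` and `g` generate a transitive group, and `α` and `α⁻¹ g`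
together have `N` cycles. -/
noncomputable def factors (N : ℕ) (g : Equiv.Perm X) : Finset (Equiv.Perm X) :=
  univ.filter fun α => orb α ⊔ orb g = ⊤ ∧ numClasses (orb α) + numClasses (orb (α⁻¹ * g)) = N

theorem mem_factors {N : ℕ} {g α : Equiv.Perm X} : α ∈ factors N g ↔
    orb α ⊔ orb g = ⊤ ∧ numClasses (orb α) + numClasses (orb (α⁻¹ * g)) = N := by simp [factors]

/-- `∑ u_α v_{α⁻¹ g}` over `factors N g`. -/
noncomputable def factorSum (N : ℕ) (u v : ℕ → ℝ) (g : Equiv.Perm X) : ℝ :=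
  ∑ α ∈ factors N g, classProd u (orb α) * classProd v (orb (α⁻¹ * g))

theorem permCongr_inv_mul (e : X ≃ Y) (α g : Equiv.Perm X) :
    (e.permCongr α)⁻¹ * e.permCongr g = e.permCongr (α⁻¹ * g) := by
  ext y
  simp [Equiv.Perm.mul_apply, Equiv.Perm.inv_def, Equiv.permCongr_def]

theorem factorSum_permCongr (e : X ≃ Y) (N : ℕ) (u v : ℕ → ℝ) (g : Equiv.Perm X) :
    factorSum N u v (e.permCongr g) = factorSum N u v g := by
  symm
  refine sum_equiv e.permCongr (fun α => ?_) (fun α _ => ?_)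
  · rw [mem_factors, mem_factors, permCongr_inv_mul, orb_sup_permCongr_eq_top_iff,
      numClasses_permCongr, numClasses_permCongr]
  · rw [permCongr_inv_mul, classProd_permCongr, classProd_permCongr]

-- Substitute `g = αβ`, that is `β = α⁻¹g`; the generated group does not change.
open Classical in
theorem sum_transPairs_eq_sum_factorSum (N : ℕ) (u v : ℕ → ℝ) :
    ∑ a ∈ (transPairs X).filter (fun a => numClasses (orb a.1) + numClasses (orb a.2) = N),
      classProd u (orb a.1) * classProd v (orb a.2) = ∑ g : Equiv.Perm X, factorSum N u v g := by
  simp only [factorSum]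
  rw [sum_sigma']
  refine sum_bij' (fun a _ => ⟨a.1 * a.2, a.1⟩) (fun c _ => (c.2, c.2⁻¹ * c.1)) ?_ ?_ ?_ ?_ ?_
  · rintro ⟨α, β⟩ h
    simp only [mem_filter, mem_transPairs, mem_sigma, mem_univ, true_and, mem_factors,
      inv_mul_cancel_left, orb_mul_sup_left] at h ⊢
    exact h
  · rintro ⟨g, α⟩ h
    simp only [mem_filter, mem_transPairs, mem_sigma, mem_univ, true_and, mem_factors] at h ⊢
    rwa [← orb_mul_sup_left, mul_inv_cancel_left]
  · rintro ⟨α, β⟩ _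
    simp
  · rintro ⟨g, α⟩ _
    simp
  · rintro ⟨α, β⟩ _
    simp

variable [Nonempty X]

theorem factors_bound {N : ℕ} {g α : Equiv.Perm X} (h : α ∈ factors N g) :
    N + numClasses (orb g) ≤ Fintype.card X + 2 := by
  obtain ⟨h1, h2⟩ := mem_factors.mp h
  have h3 := euler_inequality α (α⁻¹ * g)
  rw [← orb_mul_sup_left, mul_inv_cancel_left, h1, numClasses_top, Nat.card_eq_fintype_card] at h3
  omega

theorem factors_parity {N : ℕ} {g α : Equiv.Perm X} (h : α ∈ factors N g) :
    (-1 : ℤˣ) ^ N = (-1) ^ (Fintype.card X + numClasses (orb g)) := by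
  obtain ⟨h1, h2⟩ := mem_factors.mp h
  rw [← h2, pow_add, pow_add, neg_one_pow_numClasses, neg_one_pow_numClasses,
    neg_one_pow_numClasses, Nat.card_eq_fintype_card, Equiv.Perm.sign_mul, Equiv.Perm.sign_inv,
    mul_mul_mul_comm, Int.units_mul_self, one_mul]
  simp only [← mul_assoc, Int.units_mul_self, one_mul]

theorem factors_eq_empty_of_ne_top {g : Equiv.Perm X} (hg : orb g ≠ ⊤) :
    factors (Fintype.card X + 1) g = ∅ := by
  refine eq_empty_of_forall_notMem fun α hα => hg ?_
  have h1 := factors_bound hα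
  have h2 := numClasses_pos (orb g)
  exact numClasses_eq_one_iff.mp (by omega)

/-- The genus inequality leaves one or two cycles for `g`, and the sign excludes one. -/
theorem factors_eq_empty_of_ne_two {g : Equiv.Perm X} (hg : numClasses (orb g) ≠ 2) :
    factors (Fintype.card X) g = ∅ := by
  refine eq_empty_of_forall_notMem fun α hα => hg ?_
  have h1 := factors_bound hα
  have h2 := numClasses_pos (orb g)
  have h3 := factors_parity hα
  by_contra hne
  have h4 : numClasses (orb g) = 1 := by omega
  rw [h4, pow_succ] at h3
  simp at h3

end Factor

/-! ### Cycle types -/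

theorem exists_permCongr_eq_finRotate {X : Type*} [Fintype X] [DecidableEq X] {k : ℕ}
    (hk : Fintype.card X = k) {g : Equiv.Perm X} (hg : orb g = ⊤) :
    ∃ e : X ≃ Fin k, e.permCongr g = finRotate k := by
  let e₀ := Fintype.equivFinOfCardEq hk
  match k, hk, e₀ with
  -- On at most one point the rotation is the identity, which is not a cycle in the sense of
  -- `IsCycle`, so the conjugacy argument starts at two points.
  | 0, _, e₀ => exact ⟨e₀, Subsingleton.elim _ _⟩
  | 1, _, e₀ => exact ⟨e₀, Subsingleton.elim _ _⟩
  | k + 2, _, e₀ =>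
    have h0 : orb (e₀.permCongr g) = ⊤ := by
      have := orb_sup_permCongr_eq_top e₀ (α := g) (β := g) (by rw [sup_idem, hg])
      rwa [sup_idem] at this
    have hmove : ∀ x, e₀.permCongr g x ≠ x := by
      intro x hx
      obtain ⟨y, hy⟩ := exists_ne x
      have h1 : orb (e₀.permCongr g) x y := by rw [h0]; trivial
      exact hy (Equiv.Perm.SameCycle.eq_of_left h1 hx).symm
    have hcyc : (e₀.permCongr g).IsCycle := ⟨0, hmove 0, fun y _ => by
      have h1 : orb (e₀.permCongr g) 0 y := by rw [h0]; trivial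
      exact h1⟩
    have hsupp : (e₀.permCongr g).support = univ := by
      ext x
      simpa only [Equiv.Perm.mem_support, mem_univ, iff_true] using hmove x
    have hconj := hcyc.isConj (isCycle_finRotate (n := k)) (by rw [hsupp, support_finRotate])
    obtain ⟨c, hc⟩ := isConj_iff.mp hconj
    refine ⟨e₀.trans c, ?_⟩
    rw [← hc]
    ext x
    simp [Equiv.permCongr_def, Equiv.Perm.mul_apply, Equiv.Perm.inv_def]

/-- Only long cycles contribute; there are `n!` of them on `n + 1` points, and conjugation makes
their contributions equal. -/
theorem sum_longCycles_factorSum (n : ℕ) (u v : ℕ → ℝ) :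
    ∑ g : Equiv.Perm (Fin (n + 1)), factorSum (n + 2) u v g =
      n.factorial * factorSum (n + 2) u v (finRotate (n + 1)) := by
  have h1 : ∀ g ∈ univ, g ∉ longCycles (Fin (n + 1)) → factorSum (n + 2) u v g = 0 := by
    intro g _ hg
    have := factors_eq_empty_of_ne_top (g := g) fun h => hg (mem_longCycles.mpr h)
    rw [Fintype.card_fin] at this
    rw [factorSum, this, sum_empty]
  rw [← sum_subset (subset_univ (longCycles (Fin (n + 1)))) h1, ← card_longCycles n]
  rw [sum_congr rfl (g := fun _ => factorSum (n + 2) u v (finRotate (n + 1))), sum_const,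
    nsmul_eq_mul]
  intro g hg
  obtain ⟨e, he⟩ := exists_permCongr_eq_finRotate (Fintype.card_fin (n + 1)) (mem_longCycles.mp hg)
  rw [← he, factorSum_permCongr]

theorem permCongr_subtypeCongr_eq_annularRotate {X : Type*} [Fintype X] [DecidableEq X]
    {S : Finset X} {a : Equiv.Perm {x // x ∈ S}} {b : Equiv.Perm {x // ¬ x ∈ S}} {t s : ℕ}
    {e₁ : {x // x ∈ S} ≃ Fin t} {e₂ : {x // ¬ x ∈ S} ≃ Fin s} (h₁ : e₁.permCongr a = finRotate t)
    (h₂ : e₂.permCongr b = finRotate s) :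
    ((Equiv.sumCompl (· ∈ S)).symm.trans ((e₁.sumCongr e₂).trans finSumFinEquiv)).permCongr
      (a.subtypeCongr b) = annularRotate t s := by
  rw [annularRotate, ← h₁, ← h₂]
  ext x
  obtain ⟨y, rfl⟩ := finSumFinEquiv.surjective x
  rcases y with y | y
  · simp [Equiv.permCongr_def]
  · have h := (e₂.symm y).2
    have h' := (b (e₂.symm y)).2
    simp [Equiv.permCongr_def, h]

theorem factorSum_annularRotate_comm (t s : ℕ) (u v : ℕ → ℝ) :
    factorSum (t + s) u v (annularRotate t s) = factorSum (s + t) u v (annularRotate s t) := by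
  let e : Fin (t + s) ≃ Fin (s + t) :=
    finSumFinEquiv.symm.trans ((Equiv.sumComm (Fin t) (Fin s)).trans finSumFinEquiv)
  have h : e.permCongr (annularRotate t s) = annularRotate s t := by
    ext x
    obtain ⟨y, rfl⟩ := finSumFinEquiv.surjective x
    rcases y with y | y <;> simp [e, Equiv.permCongr_def, annularRotate]
  rw [← h, factorSum_permCongr, add_comm s t]

/-- With one cycle fixed on `S`, exactly two cycles in all means that `b` is a long cycle of the `n
+ 1 - #S` remaining points, which leaves `(n - #S)!` choices, each conjugate to the annular
rotation. -/
theorem factorSum_subtypeCongr {n : ℕ} {S : Finset (Fin (n + 1))} (hS : #S < n + 1) (h0 : S.Nonempty)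
    {a : Equiv.Perm {x // x ∈ S}} (ha : a ∈ longCycles {x // x ∈ S}) (u v : ℕ → ℝ) :
    ∑ b : Equiv.Perm {x // ¬ x ∈ S}, factorSum (n + 1) u v (a.subtypeCongr b) =
      (n - #S).factorial * factorSum (n + 1) u v (annularRotate #S (n + 1 - #S)) := by
  have hcard := card_notMem S
  have hcardS : Fintype.card {x // x ∈ S} = #S := Fintype.card_coe S
  have hne : Nonempty {x // ¬ x ∈ S} := Fintype.card_pos_iff.mp (by omega)
  have hneS : Nonempty {x // x ∈ S} := h0.to_subtype
  have h1 : ∀ b ∈ univ, b ∉ longCycles {x // ¬ x ∈ S} →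
      factorSum (n + 1) u v (a.subtypeCongr b) = 0 := by
    intro b _ hb
    have := factors_eq_empty_of_ne_two (g := a.subtypeCongr b) fun h => hb (mem_longCycles.mpr ?_)
    · rw [Fintype.card_fin] at this
      rw [factorSum, this, sum_empty]
    · rw [numClasses_subtypeCongr, mem_longCycles.mp ha, numClasses_top] at h
      exact numClasses_eq_one_iff.mp (by omega)
  rw [← sum_subset (subset_univ (longCycles {x // ¬ x ∈ S})) h1]
  have h2 : #(longCycles {x // ¬ x ∈ S}) = (n - #S).factorial := by
    rw [← card_longCycles]
    exact card_longCycles_congr (Fintype.equivFinOfCardEq (by omega))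
  rw [← h2, sum_congr rfl (g := fun _ => factorSum (n + 1) u v (annularRotate #S (n + 1 - #S))),
    sum_const, nsmul_eq_mul]
  intro b hb
  obtain ⟨e₁, h₁⟩ := exists_permCongr_eq_finRotate hcardS (mem_longCycles.mp ha)
  obtain ⟨e₂, h₂⟩ := exists_permCongr_eq_finRotate hcard (mem_longCycles.mp hb)
  rw [← permCongr_subtypeCongr_eq_annularRotate h₁ h₂, factorSum_permCongr]

theorem factorSum_subtypeCongr_univ {n : ℕ} {S : Finset (Fin (n + 1))} (hS : #S = n + 1)
    {a : Equiv.Perm {x // x ∈ S}} (ha : a ∈ longCycles {x // x ∈ S}) (u v : ℕ → ℝ)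
    (b : Equiv.Perm {x // ¬ x ∈ S}) : factorSum (n + 1) u v (a.subtypeCongr b) = 0 := by
  have hcard := card_notMem S
  have hemp : IsEmpty {x // ¬ x ∈ S} := Fintype.card_eq_zero_iff.mp (by omega)
  have hneS : Nonempty {x // x ∈ S} := (card_pos.mp (by omega : 0 < #S)).to_subtype
  have h1 := numClasses_le_card (orb b)
  have := factors_eq_empty_of_ne_two (g := a.subtypeCongr b) (by
    rw [numClasses_subtypeCongr, mem_longCycles.mp ha, numClasses_top]
    omega)
  rw [Fintype.card_fin] at this
  rw [factorSum, this, sum_empty]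

/-- The pairs `(t, s)` with `t + s = n` and `t, s ≥ 1`. -/
abbrev posAntidiagonal (n : ℕ) : Finset (ℕ × ℕ) :=
  (antidiagonal n).filter (fun ts => 1 ≤ ts.1 ∧ 1 ≤ ts.2)

theorem sum_posAntidiagonal (n : ℕ) (f : ℕ → ℕ → ℝ) :
    ∑ ts ∈ posAntidiagonal (n + 1), f ts.1 ts.2 = ∑ k ∈ range n, f (k + 1) (n - k) := by
  rw [posAntidiagonal, sum_filter, Nat.sum_antidiagonal_eq_sum_range_succ_mk, sum_range_succ',
    sum_range_succ]
  simp only [Nat.sub_self, Nat.add_sub_add_right]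
  rw [if_neg (by omega), if_neg (by omega), add_zero, add_zero]
  exact sum_congr rfl fun k hk => by
    have := mem_range.mp hk
    rw [if_pos (by omega)]

theorem sum_posAntidiagonal_swap (n : ℕ) (f : ℕ → ℕ → ℝ) :
    ∑ ts ∈ posAntidiagonal n, f ts.1 ts.2 = ∑ ts ∈ posAntidiagonal n, f ts.2 ts.1 := by
  refine sum_nbij' Prod.swap Prod.swap ?_ ?_ ?_ ?_ ?_
  · simp only [mem_filter, HasAntidiagonal.mem_antidiagonal]
    rintro ⟨t, s⟩ h
    simp only [Prod.swap] at h ⊢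
    omega
  · simp only [mem_filter, HasAntidiagonal.mem_antidiagonal]
    rintro ⟨t, s⟩ h
    simp only [Prod.swap] at h ⊢
    omega
  all_goals simp

/-- If the cycle of `0` has length `t = k + 1` and the other one length `s = n - k`, there are `(n
choose k) k! (s-1)! = n!/s` such permutations. The formula is asymmetric because `0` lies in the
first cycle. -/
theorem sum_factorSum_two_cycles (n : ℕ) (u v : ℕ → ℝ) :
    ∑ g : Equiv.Perm (Fin (n + 1)), factorSum (n + 1) u v g =
      n.factorial * ∑ ts ∈ posAntidiagonal (n + 1),
        factorSum (ts.1 + ts.2) u v (annularRotate ts.1 ts.2) / ts.2 := by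
  rw [sum_perm_eq_sum_orbit 0]
  let G : ℕ → ℝ := fun k => if k < n + 1 then ((k - 1).factorial : ℝ) *
    ((n - k).factorial * factorSum (n + 1) u v (annularRotate k (n + 1 - k))) else 0
  have h1 : ∀ S ∈ univ.filter (fun S : Finset (Fin (n + 1)) => 0 ∈ S),
      ∑ a ∈ longCycles {x // x ∈ S}, ∑ b : Equiv.Perm {x // ¬ x ∈ S},
        factorSum (n + 1) u v (a.subtypeCongr b) = G #S := by
    intro S hS
    simp only [mem_filter, mem_univ, true_and] at hS
    have hle : #S ≤ n + 1 := by simpa using card_le_univ S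
    have hpos : 0 < #S := card_pos.mpr ⟨0, hS⟩
    rcases hle.lt_or_eq with hlt | heq
    · rw [sum_congr rfl fun a ha => factorSum_subtypeCongr hlt ⟨0, hS⟩ ha u v, sum_const,
        nsmul_eq_mul]
      simp only [G, if_pos hlt]
      congr 2
      rw [← card_longCycles]
      exact card_longCycles_congr (Fintype.equivFinOfCardEq (by rw [Fintype.card_coe]; omega))
    · rw [sum_eq_zero fun a ha => sum_eq_zero fun b _ =>
        factorSum_subtypeCongr_univ heq ha u v b]
      simp only [G, heq, lt_irrefl, if_false]
  rw [sum_congr rfl h1, sum_filter_zero_mem, sum_range_succ,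
    sum_posAntidiagonal n fun t s => factorSum (t + s) u v (annularRotate t s) / s, mul_sum]
  simp only [G, lt_irrefl, if_false, mul_zero, add_zero]
  refine sum_congr rfl fun k hk => ?_
  have hk := mem_range.mp hk
  rw [if_pos (by omega), Nat.add_sub_cancel, Nat.add_sub_add_right,
    ← Nat.choose_mul_factorial_mul_factorial hk.le]
  obtain ⟨j, rfl⟩ : ∃ j, n = k + j + 1 := ⟨n - k - 1, by omega⟩
  have e1 : k + j + 1 - (k + 1) = j := by omega
  have e2 : k + j + 1 - k = j + 1 := by omega
  have e3 : k + 1 + (j + 1) = k + j + 1 + 1 := by omega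
  rw [e1, e2, ← e3, Nat.factorial_succ]
  have : ((j + 1 : ℕ) : ℝ) ≠ 0 := by positivity
  push_cast at this ⊢
  field_simp

/-- Average with the roles of `t` and `s` exchanged: `1/s + 1/t = (t+s)/(ts)`, which is the origin
of the factor `n/2`. -/
theorem sum_factorSum_annular (n : ℕ) (u v : ℕ → ℝ) :
    1 / (n.factorial : ℝ) * ∑ g : Equiv.Perm (Fin (n + 1)), factorSum (n + 1) u v g =
      ((n + 1 : ℕ) : ℝ) / 2 * ∑ ts ∈ posAntidiagonal (n + 1),
        factorSum (ts.1 + ts.2) u v (annularRotate ts.1 ts.2) / ((ts.1 : ℝ) * ts.2) := by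
  have hf : (n.factorial : ℝ) ≠ 0 := by exact_mod_cast n.factorial_ne_zero
  rw [sum_factorSum_two_cycles, ← mul_assoc, one_div_mul_cancel hf, one_mul]
  have h1 := sum_posAntidiagonal_swap (n + 1)
    fun t s => factorSum (t + s) u v (annularRotate t s) / (s : ℝ)
  have h2 : ∑ ts ∈ posAntidiagonal (n + 1),
        factorSum (ts.1 + ts.2) u v (annularRotate ts.1 ts.2) / (ts.2 : ℝ) +
      ∑ ts ∈ posAntidiagonal (n + 1),
        factorSum (ts.2 + ts.1) u v (annularRotate ts.2 ts.1) / (ts.1 : ℝ) =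
      ((n + 1 : ℕ) : ℝ) * ∑ ts ∈ posAntidiagonal (n + 1),
        factorSum (ts.1 + ts.2) u v (annularRotate ts.1 ts.2) / ((ts.1 : ℝ) * ts.2) := by
    rw [← sum_add_distrib, mul_sum]
    refine sum_congr rfl fun ts hts => ?_
    obtain ⟨ha, hb, hc⟩ := mem_filter.mp hts
    rw [HasAntidiagonal.mem_antidiagonal] at ha
    rw [← factorSum_annularRotate_comm, ← ha]
    have h3 : (ts.1 : ℝ) ≠ 0 := by exact_mod_cast (by omega : ts.1 ≠ 0)
    have h4 : (ts.2 : ℝ) ≠ 0 := by exact_mod_cast (by omega : ts.2 ≠ 0)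
    push_cast
    field_simp
  rw [← h1] at h2
  linear_combination h2 / 2

end FiniteFree

namespace FiniteFree

/-! ### Non-crossing partitions as minimal factorizations of a long cycle -/

theorem numClasses_swap_mul_of_sameCycle {X : Type*} [Finite X] [DecidableEq X]
    {σ : Equiv.Perm X} {i j : X} (hij : i ≠ j) (h : σ.SameCycle i j) :
    numClasses (orb (Equiv.swap i j * σ)) = numClasses (orb σ) + 1 := by
  have := numClasses_mul_swap_of_sameCycle hij (Equiv.Perm.sameCycle_inv.mpr h)
  rwa [orb_inv, ← Equiv.swap_inv, ← mul_inv_rev, orb_inv] at this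

theorem numClasses_swap_mul_le {X : Type*} [Finite X] [DecidableEq X]
    (σ : Equiv.Perm X) (i j : X) :
    numClasses (orb (Equiv.swap i j * σ)) ≤ numClasses (orb σ) + 1 := by
  have := numClasses_mul_swap_le σ⁻¹ i j
  rwa [orb_inv, ← Equiv.swap_inv, ← mul_inv_rev, orb_inv] at this

variable {m : ℕ}

theorem orb_finRotate : orb (finRotate (m + 1)) = ⊤ := by
  refine top_le_iff.mp fun x y _ => ?_
  have h : ∀ (k : ℕ) (hk : k < m + 1), orb (finRotate (m + 1)) 0 ⟨k, hk⟩ := by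
    intro k
    induction k with
    | zero => intro _; exact Setoid.refl' _ _
    | succ k ih =>
      intro hk
      refine Setoid.trans' _ (ih (by omega)) ?_
      have := orb_apply (finRotate (m + 1)) ⟨k, by omega⟩
      rwa [finRotate_of_lt (by omega)] at this
  exact Setoid.trans' _ (Setoid.symm' _ (h x x.2)) (h y y.2)

/-- Every cyclic interval from `i` to `σ i` is stable under `σ`. -/
def ArcStable (σ : Equiv.Perm (Fin (m + 1))) : Prop :=
  ∀ i x, (i < x → x < σ i → i < σ x ∧ σ x < σ i) ∧ (σ i ≤ x → x ≤ i → σ i ≤ σ x ∧ σ x ≤ i)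

/-- Every cycle of `σ` runs through its elements in increasing order. -/
def IncreasingCycles (σ : Equiv.Perm (Fin (m + 1))) : Prop :=
  ∀ i x, σ.SameCycle i x → ¬ (i < x ∧ x < σ i) ∧ (σ i ≤ i → σ i ≤ x ∧ x ≤ i)

/-- The cycles of `σ` do not cross. -/
def NonCrossingCycles (σ : Equiv.Perm (Fin (m + 1))) : Prop :=
  ∀ a b c d, a < b → b < c → c < d → σ.SameCycle a c → σ.SameCycle b d → σ.SameCycle a b

theorem val_finRotate (x : Fin (m + 1)) :
    (x.val = m ∧ (finRotate (m + 1) x).val = 0) ∨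
      (x.val < m ∧ (finRotate (m + 1) x).val = x.val + 1) := by
  rw [coe_finRotate]
  split_ifs with h
  · left; simp [h]
  · right
    refine ⟨?_, rfl⟩
    have : x.val ≠ m := fun e => h (Fin.ext e)
    omega

/-- Multiplying by `τ = (i, σ i)` adds a cycle to `σ` and splits the rotation `γ` in two. The genus
inequality for `τσ` and `σ⁻¹γ` then gives their join at least two classes. As the join contains `orb
(τγ)`, which has two, they are equal. -/
theorem orb_le_of_factor {σ : Equiv.Perm (Fin (m + 1))}
    (h : σ ∈ factors (m + 2) (finRotate (m + 1))) {i : Fin (m + 1)} (hi : i ≠ σ i) :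
    orb (Equiv.swap i (σ i) * σ) ≤ orb (Equiv.swap i (σ i) * finRotate (m + 1)) := by
  obtain ⟨-, h1⟩ := mem_factors.mp h
  set τ := Equiv.swap i (σ i)
  have h2 : numClasses (orb (τ * σ)) = numClasses (orb σ) + 1 :=
    numClasses_swap_mul_of_sameCycle hi (orb_apply σ i)
  have h3 : numClasses (orb (τ * finRotate (m + 1))) = 2 := by
    have h4 : (finRotate (m + 1)).SameCycle i (σ i) := by
      rw [← orb_rel, orb_finRotate]; trivial
    have := numClasses_swap_mul_of_sameCycle hi h4
    rwa [orb_finRotate, numClasses_top] at this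
  have h4 : (τ * σ) * (σ⁻¹ * finRotate (m + 1)) = τ * finRotate (m + 1) := by
    rw [mul_assoc, mul_inv_cancel_left]
  have h5 := euler_inequality (τ * σ) (σ⁻¹ * finRotate (m + 1))
  have h6 : orb (τ * finRotate (m + 1)) ≤ orb (τ * σ) ⊔ orb (σ⁻¹ * finRotate (m + 1)) :=
    h4 ▸ orb_mul_le le_sup_left le_sup_right
  rw [h4, h2, h3, Nat.card_eq_fintype_card, Fintype.card_fin] at h5
  rw [eq_of_numClasses_le h6 (by omega)]
  exact le_sup_left

/-- The two cycles of `τγ` are the cyclic intervals cut out by `i` and `σ i`. They are preserved by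
`τσ`, hence by `σ` up to the exchange of the endpoints. -/
theorem arcStable_of_factor {σ : Equiv.Perm (Fin (m + 1))}
    (h : σ ∈ factors (m + 2) (finRotate (m + 1))) : ArcStable σ := by
  intro i x
  by_cases hi : i = σ i
  · refine ⟨fun h1 h2 => absurd (h1.trans h2) (by rw [← hi]; exact lt_irrefl _), fun h1 h2 => ?_⟩
    have : x = i := le_antisymm h2 (hi ▸ h1)
    rw [this]
    exact ⟨le_rfl, hi.symm.le⟩
  have hle := orb_le_of_factor h hi
  have hσ : ∀ y, Equiv.swap i (σ i) ((Equiv.swap i (σ i) * σ) y) = σ y := fun y => by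
    rw [Equiv.Perm.mul_apply, Equiv.swap_apply_self]
  have hfix : ∀ y, (Equiv.swap i (σ i) * σ) y = i → y = i := by
    intro y hy
    have := hσ y
    rw [hy, Equiv.swap_apply_left] at this
    exact (σ.injective this).symm
  have hval := fun y => val_finRotate (m := m) y
  have hsw : ∀ y, (y = i ∧ Equiv.swap i (σ i) y = σ i) ∨ (y = σ i ∧ Equiv.swap i (σ i) y = i) ∨
      (y ≠ i ∧ y ≠ σ i ∧ Equiv.swap i (σ i) y = y) := by
    intro y
    by_cases h1 : y = i
    · left; rw [h1]; exact ⟨rfl, Equiv.swap_apply_left _ _⟩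
    by_cases h2 : y = σ i
    · right; left; refine ⟨h2, ?_⟩; rw [h2]; exact Equiv.swap_apply_right _ _
    · exact Or.inr (Or.inr ⟨h1, h2, Equiv.swap_apply_of_ne_of_ne h1 h2⟩)
  have hstep : ∀ A : Set (Fin (m + 1)),
      (∀ y ∈ A, (Equiv.swap i (σ i) * finRotate (m + 1)) y ∈ A) →
      x ∈ A → (Equiv.swap i (σ i) * σ) x ∈ A := fun A hA hx =>
    (mem_iff_of_sameCycle hA (hle (orb_apply _ x))).mp hx
  constructor
  · intro h1 h2
    -- The interval is half-open because `τγ` sends the predecessor of `σ i` back to `i`.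
    have := hstep {y | i ≤ y ∧ y < σ i} (by
      rintro y ⟨hy1, hy2⟩
      rw [Equiv.Perm.mul_apply]
      have e1 := hval y
      have e2 := hsw (finRotate (m + 1) y)
      simp only [Set.mem_ofPred_eq, Fin.le_def, Fin.lt_def, Fin.ext_iff, ne_eq] at *
      omega) ⟨h1.le, h2⟩
    -- Undo `τ`: since `x ≠ i`, `hfix` shows that `τσ x` is not `i`, so `σ x` is still strictly
    -- inside.
    have e3 := hsw ((Equiv.swap i (σ i) * σ) x)
    rw [hσ] at e3
    have e4 := hfix x
    simp only [Set.mem_ofPred_eq, Fin.le_def, Fin.lt_def, Fin.ext_iff, ne_eq] at *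
    omega
  · intro h1 h2
    rcases eq_or_ne x i with rfl | hx
    · exact ⟨le_rfl, h1⟩
    have := hstep {y | σ i ≤ y ∧ y < i} (by
      rintro y ⟨hy1, hy2⟩
      rw [Equiv.Perm.mul_apply]
      have e1 := hval y
      have e2 := hsw (finRotate (m + 1) y)
      simp only [Set.mem_ofPred_eq, Fin.le_def, Fin.lt_def, Fin.ext_iff, ne_eq] at *
      omega) ⟨h1, lt_of_le_of_ne h2 hx⟩
    have e3 := hsw ((Equiv.swap i (σ i) * σ) x)
    rw [hσ] at e3
    simp only [Set.mem_ofPred_eq, Fin.le_def, Fin.lt_def, Fin.ext_iff, ne_eq] at *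
    omega

theorem ArcStable.iff_apply {σ : Equiv.Perm (Fin (m + 1))} (h : ArcStable σ)
    {x y : Fin (m + 1)} (hxy : σ.SameCycle x y) (i : Fin (m + 1)) :
    ((i < x ∧ x < σ i) ↔ (i < y ∧ y < σ i)) ∧ ((σ i ≤ x ∧ x ≤ i) ↔ (σ i ≤ y ∧ y ≤ i)) :=
  ⟨mem_iff_of_sameCycle (A := {x | i < x ∧ x < σ i}) (fun z hz => (h i z).1 hz.1 hz.2) hxy,
    mem_iff_of_sameCycle (A := {x | σ i ≤ x ∧ x ≤ i}) (fun z hz => (h i z).2 hz.1 hz.2) hxy⟩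

/-- Membership in an arc is constant along cycles, and `i` lies outside its open arc `(i, σ i)` but
inside its closed arc `[σ i, i]`. -/
theorem ArcStable.increasingCycles {σ : Equiv.Perm (Fin (m + 1))} (h : ArcStable σ) :
    IncreasingCycles σ := by
  intro i x hix
  have := h.iff_apply hix i
  refine ⟨fun hx => lt_irrefl _ (this.1.mpr hx).1, fun hi => this.2.mp ⟨hi, le_rfl⟩⟩

theorem ArcStable.nonCrossingCycles {σ : Equiv.Perm (Fin (m + 1))} (h : ArcStable σ) :
    NonCrossingCycles σ := by
  classical
  intro a b c d hab hbc hcd hac hbd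
  -- Take the last point `i` of the cycle of `a` before `b`. If the cycles of `a` and `b` differ,
  -- then `σ i` lies beyond `b` and not beyond `c`, so the arc from `i` to `σ i` contains `b` but
  -- not `d`, although they share a cycle.
  obtain ⟨i, hi, hmax⟩ := exists_max_image
    (univ.filter fun y => σ.SameCycle a y ∧ y < b) id
    ⟨a, mem_filter.mpr ⟨mem_univ _, Equiv.Perm.SameCycle.rfl, hab⟩⟩
  simp only [mem_filter, mem_univ, true_and, id] at hi hmax
  by_contra hn
  have h1 : σ.SameCycle a (σ i) := Equiv.Perm.sameCycle_apply_right.mpr hi.1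
  have h2 : σ i ≠ b := fun e => hn (e ▸ h1)
  have h3 := h.increasingCycles i c (hi.1.symm.trans hac)
  have h4 := hmax (σ i)
  have h5 := (h.iff_apply hbd i).1
  have h6 : σ i < b → σ i ≤ i := fun hlt => hmax _ ⟨h1, hlt⟩
  obtain ⟨-, hi2⟩ := hi
  clear hmax h4
  simp only [Fin.le_def, Fin.lt_def, Fin.ext_iff, ne_eq] at *
  omega

/-- If `x` is on the cycle of `i`, the increasing order confines `σ x`. Otherwise leaving the arc
would make the pairs `x, σ x` and `i, σ i` cross; `c1` to `c4` exclude the four ways of doing so. -/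
theorem arcStable_of_increasing_of_nonCrossing {σ : Equiv.Perm (Fin (m + 1))}
    (h1 : IncreasingCycles σ) (h2 : NonCrossingCycles σ) : ArcStable σ := by
  intro i x
  have hx : σ.SameCycle x (σ x) := orb_apply σ x
  have hi : σ.SameCycle i (σ i) := orb_apply σ i
  by_cases hs : σ.SameCycle i x
  · have e1 := h1 i x hs
    have e2 := h1 i (σ x) (hs.trans hx)
    simp only [Fin.le_def, Fin.lt_def] at *
    omega
  have hs' : ¬ σ.SameCycle x i := fun h => hs h.symm
  have hne1 : σ x ≠ i := fun e => hs' (e ▸ hx)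
  have hne2 : σ x ≠ σ i := fun e => hs (hi.trans (e ▸ hx.symm))
  have hne3 : x ≠ i := fun e => hs (e ▸ Equiv.Perm.SameCycle.rfl)
  have hne4 : x ≠ σ i := fun e => hs (e ▸ hi)
  have c1 : ¬ (σ x < i ∧ i < x ∧ x < σ i) := fun h =>
    hs' (hx.trans (h2 _ _ _ _ h.1 h.2.1 h.2.2 hx.symm hi))
  have c2 : ¬ (i < x ∧ x < σ i ∧ σ i < σ x) := fun h =>
    hs (h2 _ _ _ _ h.1 h.2.1 h.2.2 hi hx)
  have c3 : ¬ (σ x < σ i ∧ σ i < x ∧ x < i) := fun h =>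
    hs' (hx.trans ((h2 _ _ _ _ h.1 h.2.1 h.2.2 hx.symm hi.symm).trans hi.symm))
  have c4 : ¬ (σ i < x ∧ x < i ∧ i < σ x) := fun h =>
    hs (hi.trans (h2 _ _ _ _ h.1 h.2.1 h.2.2 hi.symm hx))
  simp only [Fin.le_def, Fin.lt_def, Fin.ext_iff, ne_eq] at *
  omega

/-- Afterwards `j` goes to its cyclic successor and `k` to the old `σ j`. Two cycles are joined
between neighbouring points, and no arc becomes unstable. -/
theorem ArcStable.mul_swap {σ : Equiv.Perm (Fin (m + 1))} (h : ArcStable σ) {j k : Fin (m + 1)}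
    (hjk : j ≠ k) (hk : σ k = finRotate (m + 1) j) : ArcStable (σ * Equiv.swap j k) := by
  have hσj : (σ * Equiv.swap j k) j = σ k := by simp
  have hσk : (σ * Equiv.swap j k) k = σ j := by simp
  have hσ : ∀ x, x ≠ j → x ≠ k → (σ * Equiv.swap j k) x = σ x := fun x h1 h2 => by
    rw [Equiv.Perm.mul_apply, Equiv.swap_apply_of_ne_of_ne h1 h2]
  have hval := val_finRotate j
  rw [← hk] at hval
  have hinj : ∀ a b, a ≠ b → σ a ≠ σ b := fun a b => σ.injective.ne
  have hiff := fun i x => h.iff_apply (orb_apply σ x) i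
  have hjk' := hinj j k hjk
  intro i x
  have hxm := x.2
  have him := i.2
  by_cases hij : i = j
  · subst hij
    rw [hσj]
    generalize (σ * Equiv.swap i k) x = y
    have := y.2
    simp only [Fin.le_def, Fin.lt_def] at *
    omega
  by_cases hik : i = k
  · subst hik
    rw [hσk]
    by_cases hxj : x = j
    · subst hxj
      rw [hσj]
      simp only [Fin.le_def, Fin.lt_def, Fin.ext_iff, ne_eq] at *
      omega
    by_cases hxi : x = i
    · subst hxi
      rw [hσk]
      simp only [Fin.le_def, Fin.lt_def, Fin.ext_iff, ne_eq] at *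
      omega
    rw [hσ x hxj hxi]
    have e1 := hiff i x
    have e2 := hiff j x
    have e3 := hinj x j hxj
    have e4 := hinj x i hxi
    clear hiff hσ hinj h
    simp only [Fin.le_def, Fin.lt_def, Fin.ext_iff, ne_eq] at *
    omega
  rw [hσ i hij hik]
  have e1 := hiff i j
  have e2 := hiff i k
  have e3 := hiff i x
  have e4 := hinj i k hik
  have e5 := hinj i j hij
  by_cases hxj : x = j
  · subst hxj
    rw [hσj]
    clear hiff hσ hinj h
    simp only [Fin.le_def, Fin.lt_def, Fin.ext_iff, ne_eq] at *
    omega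
  by_cases hxk : x = k
  · subst hxk
    rw [hσk]
    clear hiff hσ hinj h
    simp only [Fin.le_def, Fin.lt_def, Fin.ext_iff, ne_eq] at *
    omega
  rw [hσ x hxj hxk]
  exact h i x

theorem ArcStable.not_sameCycle {σ : Equiv.Perm (Fin (m + 1))} (h : ArcStable σ)
    {j k : Fin (m + 1)} (hjk : j ≠ k) (hk : σ k = finRotate (m + 1) j) : ¬ σ.SameCycle j k := by
  intro hs
  have h1 := h.increasingCycles k j hs.symm
  have hval := val_finRotate j
  rw [← hk] at hval
  have := k.2
  simp only [Fin.le_def, Fin.lt_def, Fin.ext_iff, ne_eq] at *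
  omega

/-- Induct on the support of `κ = σ⁻¹γ`. Passing from `σ` to `σ(j, κ j)` costs `σ` one cycle, gains
`κ` at most one and makes `j` a fixed point of the new complement. When `κ = 1`, `σ` is the rotation
itself. -/
theorem ArcStable.le_numClasses {σ : Equiv.Perm (Fin (m + 1))} (h : ArcStable σ) :
    m + 2 ≤ numClasses (orb σ) + numClasses (orb (σ⁻¹ * finRotate (m + 1))) := by
  induction hc : #(σ⁻¹ * finRotate (m + 1)).support using Nat.strong_induction_on
    generalizing σ with | _ c ih
  by_cases h1 : σ⁻¹ * finRotate (m + 1) = 1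
  · have h2 : finRotate (m + 1) = σ := by rw [← mul_one σ, ← h1, mul_inv_cancel_left]
    rw [h1, orb_one, numClasses_bot, ← h2, orb_finRotate, numClasses_top, Nat.card_eq_fintype_card,
      Fintype.card_fin]
    omega
  obtain ⟨j, hj⟩ : ∃ j, (σ⁻¹ * finRotate (m + 1)) j ≠ j := by
    by_contra! hall
    exact h1 (Equiv.ext hall)
  set κ := σ⁻¹ * finRotate (m + 1)
  set k := κ j
  have hk : σ k = finRotate (m + 1) j := by simp [k, κ, Equiv.Perm.mul_apply]
  have hjk : j ≠ k := Ne.symm hj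
  have hκ : (σ * Equiv.swap j k)⁻¹ * finRotate (m + 1) = Equiv.swap j k * κ := by
    rw [mul_inv_rev, Equiv.swap_inv, mul_assoc]
  have hsupp : (Equiv.swap j k * κ).support ⊂ κ.support := by
    rw [ssubset_iff_of_subset]
    · refine ⟨j, Equiv.Perm.mem_support.mpr hj, ?_⟩
      rw [Equiv.Perm.mem_support, not_not, Equiv.Perm.mul_apply]
      exact Equiv.swap_apply_right j k
    · intro x hx
      rw [Equiv.Perm.mem_support] at hx ⊢
      intro hfix
      apply hx
      have h3 : x ≠ j := fun e => hj (by rw [e] at hfix; exact hfix)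
      have h4 : x ≠ k := fun e => h3 (κ.injective (hfix.trans e))
      rw [Equiv.Perm.mul_apply, hfix, Equiv.swap_apply_of_ne_of_ne h3 h4]
  have hind := ih _ (by rw [hκ, ← hc]; exact card_lt_card hsupp) (h.mul_swap hjk hk) rfl
  have h3 := numClasses_mul_swap_of_not (h.not_sameCycle hjk hk)
  have h4 := numClasses_swap_mul_le κ j k
  rw [hκ] at hind
  omega

theorem mem_factors_finRotate_iff {σ : Equiv.Perm (Fin (m + 1))} :
    σ ∈ factors (m + 2) (finRotate (m + 1)) ↔ ArcStable σ := by
  refine ⟨arcStable_of_factor, fun h => ?_⟩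
  have h1 : orb σ ⊔ orb (finRotate (m + 1)) = ⊤ := by rw [orb_finRotate, sup_top_eq]
  refine mem_factors.mpr ⟨h1, le_antisymm ?_ h.le_numClasses⟩
  have h2 := euler_inequality σ (σ⁻¹ * finRotate (m + 1))
  rw [← orb_mul_sup_left, mul_inv_cancel_left, orb_finRotate, sup_top_eq, numClasses_top,
    Nat.card_eq_fintype_card, Fintype.card_fin] at h2
  omega

end FiniteFree

namespace FiniteFree

/-! ### Partitions and permutations -/

theorem cyclePartition_parts {n : ℕ} (σ : Equiv.Perm (Fin n)) :
    (cyclePartition σ).parts = classes (orb σ) := by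
  classical
  ext V
  simp only [cyclePartition, Finpartition.ofSetoid, classes, Finpartition.ofSetSetoid, mem_image,
    mem_univ, true_and]
  refine exists_congr fun x => ?_
  refine Eq.congr_left ?_
  ext y
  simp [mem_cls]

theorem blockProd_cyclePartition {n : ℕ} (u : ℕ → ℝ) (σ : Equiv.Perm (Fin n)) :
    blockProd u (cyclePartition σ) = classProd u (orb σ) := by
  rw [blockProd, cyclePartition_parts, classProd]

theorem card_cyclePartition {n : ℕ} (σ : Equiv.Perm (Fin n)) :
    #(cyclePartition σ).parts = numClasses (orb σ) := by
  rw [cyclePartition_parts, card_classes]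

/-- All that is needed about the sorted list: the image stays in the block, no element is skipped,
and a non-increase happens only when wrapping from the maximum to the minimum. -/
theorem blockCycle_apply {n : ℕ} {V : Finset (Fin n)} {x : Fin n} (hx : x ∈ V) :
    (blockCycle V x ∈ V) ∧ (∀ y ∈ V, ¬ (x < y ∧ y < blockCycle V x)) ∧
      (blockCycle V x ≤ x → ∀ y ∈ V, blockCycle V x ≤ y ∧ y ≤ x) := by
  set l := V.sort (· ≤ ·) with hl
  have hnd : l.Nodup := V.sort_nodup _
  have hmem : ∀ y, y ∈ V ↔ y ∈ l := fun y => (V.mem_sort _).symm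
  have hmono : StrictMono l.get := V.sortedLT_sort.strictMono_get
  obtain ⟨i, hi, rfl⟩ := List.getElem_of_mem ((hmem x).mp hx)
  have happ : blockCycle V l[i] = l[(i + 1) % l.length]'(Nat.mod_lt _ (by omega)) :=
    List.formPerm_apply_getElem l hnd i hi
  have hmono' : ∀ a b (ha : a < l.length) (hb : b < l.length), l[a] < l[b] ↔ a < b := by
    intro a b ha hb
    exact hmono.lt_iff_lt (a := ⟨a, ha⟩) (b := ⟨b, hb⟩)
  have hmono'' : ∀ a b (ha : a < l.length) (hb : b < l.length), l[a] ≤ l[b] ↔ a ≤ b := by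
    intro a b ha hb
    exact hmono.le_iff_le (a := ⟨a, ha⟩) (b := ⟨b, hb⟩)
  rw [happ]
  refine ⟨(hmem _).mpr (List.getElem_mem _), fun y hy => ?_, fun h y hy => ?_⟩
  · obtain ⟨k, hk, rfl⟩ := List.getElem_of_mem ((hmem y).mp hy)
    rw [hmono', hmono']
    rcases Nat.lt_or_ge (i + 1) l.length with h1 | h1
    · rw [Nat.mod_eq_of_lt h1]; omega
    · have : i + 1 = l.length := by omega
      rw [this, Nat.mod_self]; omega
  · obtain ⟨k, hk, rfl⟩ := List.getElem_of_mem ((hmem y).mp hy)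
    rw [hmono''] at h ⊢
    rw [hmono'']
    rcases Nat.lt_or_ge (i + 1) l.length with h1 | h1
    · rw [Nat.mod_eq_of_lt h1] at h; omega
    · have : i + 1 = l.length := by omega
      rw [this, Nat.mod_self]; omega

theorem partitionPerm_apply {n : ℕ} (π : SetPartition n) {V : Finset (Fin n)} (hV : V ∈ π.parts)
    {x : Fin n} (hx : x ∈ V) : partitionPerm π x = blockCycle V x := by
  rw [partitionPerm, ← Finset.mul_noncommProd_erase _ hV, Equiv.Perm.mul_apply]
  congr 1
  refine Finset.noncommProd_induction _ _ _ (fun f : Equiv.Perm (Fin n) => f x = x)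
    (fun f g hf hg => by rw [Equiv.Perm.mul_apply, hg, hf]) rfl fun W hW => ?_
  obtain ⟨hne, hW⟩ := mem_erase.mp hW
  exact blockCycle_apply_of_notMem (Finset.disjoint_left.mp (π.disjoint hV hW hne.symm) hx)

theorem sameCycle_partitionPerm_iff {n : ℕ} (π : SetPartition n) {V : Finset (Fin n)}
    (hV : V ∈ π.parts) {x y : Fin n} (hx : x ∈ V) : (partitionPerm π).SameCycle x y ↔ y ∈ V := by
  have hstab : ∀ z ∈ (V : Set (Fin n)), partitionPerm π z ∈ (V : Set (Fin n)) := fun z hz => by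
    rw [partitionPerm_apply π hV hz]; exact (blockCycle_apply hz).1
  refine ⟨fun h => (mem_iff_of_sameCycle hstab h).mp hx, fun hy => ?_⟩
  -- The largest element `z` of `V` on the cycle of `x` is sent to something not larger, so the
  -- order wraps there and `z` is the maximum of `V`. Hence all points of `V` share a cycle.
  have key : ∀ x ∈ V, ∃ z, (∀ w ∈ V, w ≤ z) ∧ (partitionPerm π).SameCycle x z := by
    intro x hx
    classical
    obtain ⟨z, hz, hmax⟩ := exists_max_image
      (V.filter fun z => (partitionPerm π).SameCycle x z) id
      ⟨x, mem_filter.mpr ⟨hx, Equiv.Perm.SameCycle.rfl⟩⟩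
    simp only [mem_filter, id] at hz hmax
    refine ⟨z, ?_, hz.2⟩
    have h1 := blockCycle_apply hz.1
    have h2 := partitionPerm_apply π hV hz.1
    have h3 := hmax (blockCycle V z) ⟨h1.1, by
      rw [← h2]; exact Equiv.Perm.sameCycle_apply_right.mpr hz.2⟩
    exact fun w hw => (h1.2.2 h3 w hw).2
  obtain ⟨z, hz, hxz⟩ := key x hx
  obtain ⟨w, hw, hyw⟩ := key y hy
  have hzV := (mem_iff_of_sameCycle hstab hxz).mp hx
  have hwV := (mem_iff_of_sameCycle hstab hyw).mp hy
  have : z = w := le_antisymm (hw z hzV) (hz w hwV)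
  exact hxz.trans (this ▸ hyw.symm)

theorem mem_cyclePartition_iff {n : ℕ} {σ : Equiv.Perm (Fin n)} {V : Finset (Fin n)}
    (hV : V ∈ (cyclePartition σ).parts) {x y : Fin n} (hx : x ∈ V) : σ.SameCycle x y ↔ y ∈ V := by
  rw [cyclePartition_parts] at hV
  obtain ⟨z, rfl⟩ := mem_classes.mp hV
  rw [mem_cls] at hx ⊢
  exact ⟨fun h => Setoid.trans' _ hx h, fun h => Setoid.trans' _ (Setoid.symm' _ hx) h⟩

theorem setPartition_ext {n : ℕ} {π ρ : SetPartition n}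
    (h : ∀ V ∈ π.parts, ∀ W ∈ ρ.parts, ∀ x ∈ V, x ∈ W → V = W) : π = ρ := by
  refine Finpartition.ext (Finset.ext fun V => ⟨fun hV => ?_, fun hV => ?_⟩)
  · obtain ⟨x, hx⟩ := π.nonempty_of_mem_parts hV
    obtain ⟨W, hW, hxW⟩ := ρ.exists_mem (mem_univ x)
    rwa [h V hV W hW x hx hxW]
  · obtain ⟨x, hx⟩ := ρ.nonempty_of_mem_parts hV
    obtain ⟨W, hW, hxW⟩ := π.exists_mem (mem_univ x)
    rwa [← h W hW V hV x hxW hx]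

theorem cyclePartition_partitionPerm {n : ℕ} (π : SetPartition n) :
    cyclePartition (partitionPerm π) = π := by
  refine setPartition_ext fun V hV W hW x hxV hxW => ?_
  ext y
  rw [← mem_cyclePartition_iff hV hxV, sameCycle_partitionPerm_iff π hW hxW]

variable {m : ℕ}

theorem increasingCycles_partitionPerm (π : SetPartition (m + 1)) :
    IncreasingCycles (partitionPerm π) := by
  intro i x hix
  obtain ⟨V, hV, hi⟩ := π.exists_mem (mem_univ i)
  have hx := (sameCycle_partitionPerm_iff π hV hi).mp hix
  have h := blockCycle_apply hi
  rw [partitionPerm_apply π hV hi]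
  exact ⟨h.2.1 x hx, fun hle => h.2.2 hle x hx⟩

/-- In an increasing cycle the image of `i` is the cyclic successor of `i` within its cycle, so the
cycles determine the permutation. -/
theorem eq_of_increasingCycles {σ τ : Equiv.Perm (Fin (m + 1))} (hσ : IncreasingCycles σ)
    (hτ : IncreasingCycles τ) (h : ∀ x y, σ.SameCycle x y ↔ τ.SameCycle x y) : σ = τ := by
  ext i
  have e1 := hσ i (τ i) ((h _ _).mpr (orb_apply τ i))
  have e2 := hτ i (σ i) ((h _ _).mp (orb_apply σ i))
  simp only [Fin.le_def, Fin.lt_def] at e1 e2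
  omega

theorem partitionPerm_cyclePartition {σ : Equiv.Perm (Fin (m + 1))} (hσ : IncreasingCycles σ) :
    partitionPerm (cyclePartition σ) = σ := by
  refine eq_of_increasingCycles (increasingCycles_partitionPerm _) hσ fun x y => ?_
  obtain ⟨V, hV, hx⟩ := (cyclePartition σ).exists_mem (mem_univ x)
  rw [sameCycle_partitionPerm_iff _ hV hx, mem_cyclePartition_iff hV hx]

theorem nonCrossingCycles_partitionPerm_iff (π : SetPartition (m + 1)) :
    NonCrossingCycles (partitionPerm π) ↔ IsNonCrossing π := by
  constructor
  · intro h V hV W hW a ha b hb c hc d hd hab hbc hcd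
    have := h a b c d hab hbc hcd ((sameCycle_partitionPerm_iff π hV ha).mpr hc)
      ((sameCycle_partitionPerm_iff π hW hb).mpr hd)
    exact π.eq_of_mem_parts hV hW ((sameCycle_partitionPerm_iff π hV ha).mp this) hb
  · intro h a b c d hab hbc hcd hac hbd
    obtain ⟨V, hV, ha⟩ := π.exists_mem (mem_univ a)
    obtain ⟨W, hW, hb⟩ := π.exists_mem (mem_univ b)
    have := h V hV W hW a ha b hb c ((sameCycle_partitionPerm_iff π hV ha).mp hac) d
      ((sameCycle_partitionPerm_iff π hW hb).mp hbd) hab hbc hcd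
    exact (sameCycle_partitionPerm_iff π hV ha).mpr (this ▸ hb)

theorem mem_NC_iff (π : SetPartition (m + 1)) :
    π ∈ NC (m + 1) ↔ partitionPerm π ∈ factors (m + 2) (finRotate (m + 1)) := by
  rw [NC, mem_filter, mem_factors_finRotate_iff, ← nonCrossingCycles_partitionPerm_iff]
  exact ⟨fun h => arcStable_of_increasing_of_nonCrossing (increasingCycles_partitionPerm π) h.2,
    fun h => ⟨mem_univ _, h.nonCrossingCycles⟩⟩

theorem sum_NC_eq (F : Equiv.Perm (Fin (m + 1)) → ℝ) :
    ∑ π ∈ NC (m + 1), F (partitionPerm π) =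
      ∑ σ ∈ factors (m + 2) (finRotate (m + 1)), F σ := by
  refine sum_bij' (fun π _ => partitionPerm π) (fun σ _ => cyclePartition σ)
    (fun π hπ => (mem_NC_iff π).mp hπ) (fun σ hσ => ?_)
    (fun π _ => cyclePartition_partitionPerm π) (fun σ hσ => ?_) fun _ _ => rfl
  · rwa [mem_NC_iff, partitionPerm_cyclePartition
      (mem_factors_finRotate_iff.mp hσ).increasingCycles]
  · exact partitionPerm_cyclePartition (mem_factors_finRotate_iff.mp hσ).increasingCycles

theorem blockProd_eq_classProd {n : ℕ} (u : ℕ → ℝ) (π : SetPartition n) :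
    blockProd u π = classProd u (orb (partitionPerm π)) := by
  rw [← blockProd_cyclePartition, cyclePartition_partitionPerm]

theorem blockProd_kreweras {n : ℕ} (u : ℕ → ℝ) (π : SetPartition n) :
    blockProd u (kreweras π) = classProd u (orb ((partitionPerm π)⁻¹ * finRotate n)) :=
  blockProd_cyclePartition u _

theorem factorSum_finRotate (u v : ℕ → ℝ) :
    factorSum (m + 2) u v (finRotate (m + 1)) =
      ∑ π ∈ NC (m + 1), blockProd u π * blockProd v (kreweras π) := by
  simp only [blockProd_eq_classProd u, blockProd_kreweras]
  exact (sum_NC_eq fun σ => classProd u (orb σ) * classProd v (orb (σ⁻¹ * finRotate (m + 1)))).symm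

theorem numClasses_conj {X : Type*} [Fintype X] (g σ : Equiv.Perm X) :
    numClasses (orb (g * σ * g⁻¹)) = numClasses (orb σ) :=
  numClasses_permCongr g σ

/-- The Kreweras complement permutes the non-crossing partitions. -/
theorem sum_NC_kreweras (v : ℕ → ℝ) :
    ∑ π ∈ NC (m + 1), blockProd v (kreweras π) = ∑ π ∈ NC (m + 1), blockProd v π := by
  have h1 := sum_NC_eq (m := m) fun σ => classProd v (orb (σ⁻¹ * finRotate (m + 1)))
  have h2 := sum_NC_eq (m := m) fun σ => classProd v (orb σ)
  simp only [← blockProd_kreweras, ← blockProd_eq_classProd] at h1 h2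
  rw [h1, h2]
  set γ := finRotate (m + 1)
  refine sum_bij' (fun σ _ => σ⁻¹ * γ) (fun τ _ => γ * τ⁻¹) (fun σ hσ => ?_) (fun τ hτ => ?_)
    (fun σ _ => by group) (fun τ _ => by group) fun _ _ => rfl
  · obtain ⟨-, h⟩ := mem_factors.mp hσ
    refine mem_factors.mpr ⟨by rw [orb_finRotate, sup_top_eq], ?_⟩
    -- The complement of the complement is a conjugate of `σ`, so the two cycle counts are merely
    -- exchanged.
    have e : (σ⁻¹ * γ)⁻¹ * γ = γ⁻¹ * σ * γ⁻¹⁻¹ := by group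
    rw [e, numClasses_conj, add_comm, h]
  · obtain ⟨-, h⟩ := mem_factors.mp hτ
    refine mem_factors.mpr ⟨by rw [orb_finRotate, sup_top_eq], ?_⟩
    have e1 : γ * τ⁻¹ = γ * (τ⁻¹ * γ) * γ⁻¹ := by group
    have e2 : (γ * τ⁻¹)⁻¹ * γ = τ := by group
    rw [e2, e1, numClasses_conj, add_comm, h]

/-! ### Annular non-crossing permutations -/

theorem isPretransitive_closure_iff {X : Type*} (σ τ : Equiv.Perm X) :
    MulAction.IsPretransitive (Subgroup.closure {σ, τ}) X ↔ orb σ ⊔ orb τ = ⊤ := by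
  constructor
  · intro h
    have key : ∀ g ∈ Subgroup.closure {σ, τ}, orb g ≤ orb σ ⊔ orb τ := by
      intro g hg
      induction hg using Subgroup.closure_induction with
      | mem g hg =>
        rcases hg with rfl | rfl
        exacts [le_sup_left, le_sup_right]
      | one => rw [orb_one]; exact bot_le
      | mul a b _ _ ha hb => exact orb_mul_le ha hb
      | inv a _ ha => rwa [orb_inv]
    refine top_le_iff.mp fun x y _ => ?_
    obtain ⟨⟨g, hg⟩, rfl⟩ := h.exists_smul_eq x y
    exact key g hg (orb_apply g x)
  · intro h
    have key : orb σ ⊔ orb τ ≤ MulAction.orbitRel (Subgroup.closure {σ, τ}) X := by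
      refine sup_le (orb_le_iff.mpr fun x => ?_) (orb_le_iff.mpr fun x => ?_)
      · exact Setoid.symm' _ ⟨⟨σ, Subgroup.subset_closure (by simp)⟩, rfl⟩
      · exact Setoid.symm' _ ⟨⟨τ, Subgroup.subset_closure (by simp)⟩, rfl⟩
    rw [h] at key
    exact ⟨fun x y => by
      obtain ⟨g, hg⟩ := key (x := y) (y := x) trivial
      exact ⟨g, hg⟩⟩

theorem annularNC_eq_factors (t s : ℕ) : annularNC t s = factors (t + s) (annularRotate t s) := by
  classical
  ext σ
  rw [annularNC, mem_filter, mem_factors, isPretransitive_closure_iff, card_cyclePartition,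
    card_cyclePartition, annularKreweras]
  exact and_iff_right (mem_univ σ)

theorem factorSum_annularRotate (t s : ℕ) (u v : ℕ → ℝ) :
    factorSum (t + s) u v (annularRotate t s) = ∑ σ ∈ annularNC t s,
      blockProd u (cyclePartition σ) * blockProd v (cyclePartition (annularKreweras σ)) := by
  simp only [factorSum, annularNC_eq_factors, blockProd_cyclePartition, annularKreweras]

end FiniteFree

namespace FiniteFree

/-! ### First-order expansions in `1/d` -/

/-- `f d = a + b/d + o(1/d)`. -/
def HasExpansion (f : ℕ → ℝ) (a b : ℝ) : Prop :=
  Tendsto (fun d : ℕ => (d : ℝ) * (f d - a)) atTop (𝓝 b)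

section HasExpansion

variable {f g : ℕ → ℝ} {a b a' b' : ℝ}

theorem eventually_cast_ne_zero : ∀ᶠ d : ℕ in atTop, (d : ℝ) ≠ 0 :=
  (eventually_ge_atTop 1).mono fun d hd => by
    exact_mod_cast (by omega : d ≠ 0)

theorem tendsto_one_div_nat : Tendsto (fun d : ℕ => 1 / (d : ℝ)) atTop (𝓝 0) :=
  tendsto_one_div_atTop_nhds_zero_nat

theorem HasExpansion.tendsto (h : HasExpansion f a b) : Tendsto f atTop (𝓝 a) := by
  have h1 := ((Tendsto.mul h tendsto_one_div_nat).add_const a)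
  rw [mul_zero, zero_add] at h1
  refine h1.congr' (eventually_cast_ne_zero.mono fun d hd => ?_)
  field_simp
  ring

theorem HasExpansion.congr' (h : HasExpansion f a b) (hfg : f =ᶠ[atTop] g) :
    HasExpansion g a b :=
  Tendsto.congr' (hfg.mono fun d hd => by simp only [hd]) h

theorem hasExpansion_const (c : ℝ) : HasExpansion (fun _ => c) c 0 := by
  simp [HasExpansion]

theorem HasExpansion.sub (hf : HasExpansion f a b) (hg : HasExpansion g a' b') :
    HasExpansion (fun d => f d - g d) (a - a') (b - b') :=
  (Tendsto.sub hf hg).congr fun d => by ring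

theorem HasExpansion.mul (hf : HasExpansion f a b) (hg : HasExpansion g a' b') :
    HasExpansion (fun d => f d * g d) (a * a') (b * a' + a * b') :=
  ((Tendsto.mul hf hg.tendsto).add (Tendsto.const_mul a hg)).congr fun d => by ring

/-- The first-order coefficient stays existential: the cumulant fluctuations are only claimed to
exist. -/
theorem HasExpansion.div (hf : HasExpansion f a b) (hg : HasExpansion g a' b') (h : a' ≠ 0) :
    ∃ c, HasExpansion (fun d => f d / g d) (a / a') c := by
  refine ⟨_, ((Tendsto.mul hf (tendsto_const_nhds (x := a'))).sub
    (Tendsto.const_mul a hg)).div (hg.tendsto.mul_const a') (mul_ne_zero h h) |>.congr' ?_⟩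
  filter_upwards [hg.tendsto.eventually_ne h] with d hd
  simp only [Pi.div_apply]
  field_simp
  ring

theorem HasExpansion.sum {ι : Type*} {s : Finset ι} {F : ι → ℕ → ℝ} {A B : ι → ℝ}
    (h : ∀ i ∈ s, HasExpansion (F i) (A i) (B i)) :
    HasExpansion (fun d => ∑ i ∈ s, F i d) (∑ i ∈ s, A i) (∑ i ∈ s, B i) :=
  (tendsto_finsetSum s h).congr fun d => by rw [← mul_sum, ← sum_sub_distrib]

theorem HasExpansion.prod {ι : Type*} [DecidableEq ι] {s : Finset ι} {F : ι → ℕ → ℝ} {A B : ι → ℝ}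
    (h : ∀ i ∈ s, HasExpansion (F i) (A i) (B i)) :
    HasExpansion (fun d => ∏ i ∈ s, F i d) (∏ i ∈ s, A i)
      (∑ i ∈ s, B i * ∏ j ∈ s.erase i, A j) := by
  induction s using Finset.induction_on with
  | empty => simpa using hasExpansion_const 1
  | insert x s hx ih =>
    have h1 := (h x (mem_insert_self x s)).mul (ih fun i hi => h i (mem_insert_of_mem hi))
    simp only [prod_insert hx]
    convert h1 using 1
    rw [sum_insert hx, erase_insert hx, mul_sum]
    congr 1
    refine sum_congr rfl fun i hi => ?_
    have hxi : x ≠ i := fun e => hx (e ▸ hi)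
    rw [erase_insert_of_ne hxi, prod_insert fun h => hx (mem_of_mem_erase h)]
    ring

theorem hasExpansion_iff_isLittleO : HasExpansion f a b ↔
    (fun d : ℕ => f d - (a + b / d)) =o[atTop] (fun d : ℕ => 1 / (d : ℝ)) := by
  rw [isLittleO_iff_tendsto' (eventually_cast_ne_zero.mono fun d hd h0 =>
    absurd h0 (one_div_ne_zero hd)), HasExpansion, ← tendsto_sub_nhds_zero_iff]
  refine tendsto_congr' (eventually_cast_ne_zero.mono fun d hd => ?_)
  field_simp
  ring

end HasExpansion

/-! ### Expansion of the genus sum -/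

/-- The coefficient of `-ε` in `genusSum`. -/
noncomputable def annularSum (n : ℕ) (u v : ℕ → ℝ) : ℝ :=
  (n : ℝ) / 2 * ∑ ts ∈ posAntidiagonal n, ∑ σ ∈ annularNC ts.1 ts.2,
    blockProd u (cyclePartition σ) * blockProd v (cyclePartition (annularKreweras σ)) /
      ((ts.1 : ℝ) * (ts.2 : ℝ))

/-- The leading coefficient of `genusSum`. -/
noncomputable def planarSum (n : ℕ) (u v : ℕ → ℝ) : ℝ :=
  ∑ π ∈ NC n, blockProd u π * blockProd v (kreweras π)

open Classical in
/-- The remainder of `genusSum` after the terms of order `0` and `1`. -/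
noncomputable def genusTail (n : ℕ) (ε : ℝ) (u v : ℕ → ℝ) : ℝ :=
  1 / ((n - 1).factorial : ℝ) * ∑ a ∈ (transPairs (Fin n)).filter fun a =>
      numClasses (orb a.1) + numClasses (orb a.2) + 1 ≤ n,
    (-ε) ^ (n - 1 - numClasses (orb a.1) - numClasses (orb a.2)) *
      (classProd u (orb a.1) * classProd v (orb a.2))

/-- Sort the transitive pairs by the exponent of `-ε`. Exponent 0 gives the factorizations of long
cycles, exponent 1 those of permutations with two cycles, and a factor `ε²` comes out of all others.
-/
theorem genusSum_eq (n : ℕ) (ε : ℝ) (u v : ℕ → ℝ) :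
    genusSum (n + 1) ε u v = planarSum (n + 1) u v - ε * annularSum (n + 1) u v +
      ε ^ 2 * genusTail (n + 1) ε u v := by
  classical
  have hf : (n.factorial : ℝ) ≠ 0 := by exact_mod_cast n.factorial_ne_zero
  have h0 : planarSum (n + 1) u v = 1 / (n.factorial : ℝ) *
      ∑ a ∈ (transPairs (Fin (n + 1))).filter
        (fun a => numClasses (orb a.1) + numClasses (orb a.2) = n + 2),
        classProd u (orb a.1) * classProd v (orb a.2) := by
    rw [sum_transPairs_eq_sum_factorSum, sum_longCycles_factorSum, ← mul_assoc,
      one_div_mul_cancel hf, one_mul, factorSum_finRotate, planarSum]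
  have h1 : annularSum (n + 1) u v = 1 / (n.factorial : ℝ) *
      ∑ a ∈ (transPairs (Fin (n + 1))).filter
        (fun a => numClasses (orb a.1) + numClasses (orb a.2) = n + 1),
        classProd u (orb a.1) * classProd v (orb a.2) := by
    rw [sum_transPairs_eq_sum_factorSum, sum_factorSum_annular, annularSum]
    congr 1
    exact sum_congr rfl fun ts _ => by rw [factorSum_annularRotate, sum_div]
  rw [h0, h1, genusTail, genusSum, Nat.add_sub_cancel]
  have key : ∑ a ∈ transPairs (Fin (n + 1)),
      (-ε) ^ (n + 1 + 1 - numClasses (orb a.1) - numClasses (orb a.2)) *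
        (classProd u (orb a.1) * classProd v (orb a.2)) =
      ∑ a ∈ (transPairs (Fin (n + 1))).filter
        (fun a => numClasses (orb a.1) + numClasses (orb a.2) = n + 2),
        classProd u (orb a.1) * classProd v (orb a.2) -
      ε * ∑ a ∈ (transPairs (Fin (n + 1))).filter
        (fun a => numClasses (orb a.1) + numClasses (orb a.2) = n + 1),
        classProd u (orb a.1) * classProd v (orb a.2) +
      ε ^ 2 * ∑ a ∈ (transPairs (Fin (n + 1))).filter fun a =>
          numClasses (orb a.1) + numClasses (orb a.2) + 1 ≤ n + 1,
        (-ε) ^ (n - numClasses (orb a.1) - numClasses (orb a.2)) *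
          (classProd u (orb a.1) * classProd v (orb a.2)) := by
    rw [mul_sum, mul_sum, sum_filter, sum_filter, sum_filter, ← sum_sub_distrib, ← sum_add_distrib]
    refine sum_congr rfl fun a ha => ?_
    have hb := numClasses_add_le_of_trans ha
    have hp := numClasses_pos (orb (a.1 * a.2))
    rw [Fintype.card_fin] at hb
    generalize classProd u (orb a.1) * classProd v (orb a.2) = w
    generalize numClasses (orb a.1) = i at *
    generalize numClasses (orb a.2) = j at *
    rcases (by omega : i + j = n + 2 ∨ i + j = n + 1 ∨ i + j ≤ n) with h | h | h
    · rw [if_pos h, if_neg (by omega), if_neg (by omega), show n + 1 + 1 - i - j = 0 by omega]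
      simp
    · rw [if_neg (by omega), if_pos h, if_neg (by omega), show n + 1 + 1 - i - j = 1 by omega]
      simp
    · rw [if_neg (by omega), if_neg (by omega), if_pos (by omega),
        show n + 1 + 1 - i - j = (n - i - j) + 2 by omega, pow_add, neg_sq]
      ring
  rw [key]
  ring

/-! ### Limits and first-order expansions of the genus sum -/

section Limits

variable {U V : ℕ → ℕ → ℝ} {u v u' v' : ℕ → ℝ}

theorem tendsto_classProd {X : Type*} [Fintype X]
    (hU : ∀ k, 1 ≤ k → Tendsto (fun d => U d k) atTop (𝓝 (u k))) (r : Setoid X) :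
    Tendsto (fun d => classProd (U d) r) atTop (𝓝 (classProd u r)) := by
  refine tendsto_finsetProd _ fun W hW => hU _ ?_
  obtain ⟨x, rfl⟩ := mem_classes.mp hW
  exact card_pos.mpr ⟨x, mem_cls.mpr (r.refl x)⟩

theorem tendsto_blockProd {n : ℕ} (hU : ∀ k, 1 ≤ k → Tendsto (fun d => U d k) atTop (𝓝 (u k)))
    (π : SetPartition n) : Tendsto (fun d => blockProd (U d) π) atTop (𝓝 (blockProd u π)) :=
  tendsto_finsetProd _ fun _ hW => hU _ (card_pos.mpr (π.nonempty_of_mem_parts hW))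

theorem hasExpansion_blockProd {n : ℕ}
    (hU : ∀ k, 1 ≤ k → HasExpansion (fun d => U d k) (u k) (u' k)) (π : SetPartition n) :
    HasExpansion (fun d => blockProd (U d) π) (blockProd u π) (blockDerivSum u' u π) :=
  HasExpansion.prod fun _ hW => hU _ (card_pos.mpr (π.nonempty_of_mem_parts hW))

theorem tendsto_annularSum (n : ℕ)
    (hU : ∀ k, 1 ≤ k → Tendsto (fun d => U d k) atTop (𝓝 (u k)))
    (hV : ∀ k, 1 ≤ k → Tendsto (fun d => V d k) atTop (𝓝 (v k))) :
    Tendsto (fun d => annularSum n (U d) (V d)) atTop (𝓝 (annularSum n u v)) :=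
  Tendsto.const_mul _ (tendsto_finsetSum _ fun _ _ => tendsto_finsetSum _ fun _ _ =>
    ((tendsto_blockProd hU _).mul (tendsto_blockProd hV _)).div_const _)

theorem tendsto_genusTail (n : ℕ)
    (hU : ∀ k, 1 ≤ k → Tendsto (fun d => U d k) atTop (𝓝 (u k)))
    (hV : ∀ k, 1 ≤ k → Tendsto (fun d => V d k) atTop (𝓝 (v k))) :
    Tendsto (fun d : ℕ => genusTail n (1 / d) (U d) (V d)) atTop (𝓝 (genusTail n 0 u v)) :=
  Tendsto.const_mul _ (tendsto_finsetSum _ fun _ _ => (tendsto_one_div_nat.neg.pow _).mul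
    ((tendsto_classProd hU _).mul (tendsto_classProd hV _)))

theorem tendsto_genusSum (n : ℕ)
    (hU : ∀ k, 1 ≤ k → Tendsto (fun d => U d k) atTop (𝓝 (u k)))
    (hV : ∀ k, 1 ≤ k → Tendsto (fun d => V d k) atTop (𝓝 (v k))) :
    Tendsto (fun d : ℕ => genusSum (n + 1) (1 / d) (U d) (V d)) atTop
      (𝓝 (planarSum (n + 1) u v)) := by
  have h1 : Tendsto (fun d => planarSum (n + 1) (U d) (V d)) atTop (𝓝 (planarSum (n + 1) u v)) :=
    tendsto_finsetSum _ fun π _ => (tendsto_blockProd hU π).mul (tendsto_blockProd hV _)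
  have h2 := (h1.sub (tendsto_one_div_nat.mul (tendsto_annularSum (n + 1) hU hV))).add
    ((tendsto_one_div_nat.pow 2).mul (tendsto_genusTail (n + 1) hU hV))
  have h3 : planarSum (n + 1) u v - 0 * annularSum (n + 1) u v +
      0 ^ 2 * genusTail (n + 1) 0 u v = planarSum (n + 1) u v := by ring
  rw [h3] at h2
  exact h2.congr fun d => (genusSum_eq n _ _ _).symm

/-- The planar part is expanded by the Leibniz rule over blocks. The annular part already carries
`1/d`, so only its limit enters, and the tail is negligible after multiplication by `d`. -/
theorem hasExpansion_genusSum (n : ℕ)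
    (hU : ∀ k, 1 ≤ k → HasExpansion (fun d => U d k) (u k) (u' k))
    (hV : ∀ k, 1 ≤ k → HasExpansion (fun d => V d k) (v k) (v' k)) :
    HasExpansion (fun d : ℕ => genusSum (n + 1) (1 / d) (U d) (V d)) (planarSum (n + 1) u v)
      (mulInfinitesimalMoment u u' v v' (n + 1)) := by
  have h1 : HasExpansion (fun d => planarSum (n + 1) (U d) (V d)) (planarSum (n + 1) u v)
      (∑ π ∈ NC (n + 1), (blockDerivSum u' u π * blockProd v (kreweras π) +
        blockProd u π * blockDerivSum v' v (kreweras π))) :=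
    HasExpansion.sum fun π _ => (hasExpansion_blockProd hU π).mul (hasExpansion_blockProd hV _)
  have hU' := fun k hk => (hU k hk).tendsto
  have hV' := fun k hk => (hV k hk).tendsto
  have h2 := (Tendsto.sub h1 (tendsto_annularSum (n + 1) hU' hV')).add
    (tendsto_one_div_nat.mul (tendsto_genusTail (n + 1) hU' hV'))
  rw [zero_mul, add_zero] at h2
  refine h2.congr' (eventually_cast_ne_zero.mono fun d hd => ?_)
  simp only [genusSum_eq]
  field_simp
  ring

end Limits

/-! ### Expansion of the finite free cumulants -/

/-- The sequence that is `1` at `n` and `0` elsewhere. -/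
noncomputable def unitSeq (n k : ℕ) : ℝ := if k = n then 1 else 0

/-- A class of size `n + 1` is the whole set, so `v (n + 1)` occurs only for `r = ⊤`, and linearly.
Thus the genus sum is affine in the top cumulant. -/
theorem classProd_split (n : ℕ) (v : ℕ → ℝ) (r : Setoid (Fin (n + 1))) :
    classProd v r = classProd (fun k => if n + 1 ≤ k then 0 else v k) r +
      v (n + 1) * classProd (unitSeq (n + 1)) r := by
  by_cases hr : r = ⊤
  · rw [hr, classProd_top, classProd_top, classProd_top, Fintype.card_fin, unitSeq]
    simp
  have hcard : ∀ x, #(cls r x) ≠ n + 1 := by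
    intro x hx
    apply hr
    have huniv : cls r x = univ := eq_univ_of_card _ (by rw [hx, Fintype.card_fin])
    refine top_le_iff.mp fun y z _ => ?_
    exact Setoid.trans' _ (Setoid.symm' _ (mem_cls.mp (huniv ▸ mem_univ y)))
      (mem_cls.mp (huniv ▸ mem_univ z))
  have h1 : classProd (unitSeq (n + 1)) r = 0 :=
    prod_eq_zero (mem_classes.mpr ⟨0, rfl⟩) (if_neg (hcard 0))
  rw [h1, mul_zero, add_zero]
  refine prod_congr rfl fun W hW => ?_
  obtain ⟨x, rfl⟩ := mem_classes.mp hW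
  have h2 : #(cls r x) ≤ n + 1 := by simpa using card_le_univ (cls r x)
  have h3 := hcard x
  exact (if_neg (by omega)).symm

theorem genusSum_split (n : ℕ) (ε : ℝ) (u v : ℕ → ℝ) :
    genusSum (n + 1) ε u v = genusSum (n + 1) ε u (fun k => if n + 1 ≤ k then 0 else v k) +
      v (n + 1) * genusSum (n + 1) ε u (unitSeq (n + 1)) := by
  simp only [genusSum]
  rw [mul_left_comm, ← mul_add]
  congr 1
  rw [mul_sum, ← sum_add_distrib]
  refine sum_congr rfl fun a _ => ?_
  rw [classProd_split n v]
  ring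

theorem planarSum_one (n : ℕ) (v : ℕ → ℝ) :
    planarSum (n + 1) (fun _ => 1) v = momentOfCumulant v (n + 1) := by
  rw [planarSum, momentOfCumulant, ← sum_NC_kreweras]
  simp [blockProd]

theorem momentOfCumulant_split (n : ℕ) (v : ℕ → ℝ) : momentOfCumulant v (n + 1) =
    v (n + 1) + ∑ π ∈ (NC (n + 1)).erase ⊤, blockProd v π := by
  rw [momentOfCumulant, ← add_sum_erase _ _ (top_mem_NC (by omega))]
  congr 1
  simp [blockProd, top_parts]

/-- This is the limit of the coefficient of the top cumulant; being nonzero, it allows solving for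
that cumulant once `d` is large. -/
theorem planarSum_one_unitSeq (n : ℕ) :
    planarSum (n + 1) (fun _ => 1) (unitSeq (n + 1)) = 1 := by
  rw [planarSum_one, momentOfCumulant_split, sum_eq_zero, add_zero, unitSeq, if_pos rfl]
  intro π hπ
  obtain ⟨V, hV, -⟩ := π.exists_mem (mem_univ (0 : Fin (n + 1)))
  exact prod_eq_zero hV (if_neg (card_block_lt (ne_of_mem_erase hπ) hV).ne)

theorem eq_of_momentOfCumulant_eq {r r' : ℕ → ℝ}
    (h : ∀ n, momentOfCumulant r (n + 1) = momentOfCumulant r' (n + 1)) (n : ℕ) :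
    r (n + 1) = r' (n + 1) := by
  induction n using Nat.strong_induction_on with | _ n ih
  have h1 := h n
  rw [momentOfCumulant_split, momentOfCumulant_split] at h1
  have h2 : ∑ π ∈ (NC (n + 1)).erase ⊤, blockProd r π =
      ∑ π ∈ (NC (n + 1)).erase ⊤, blockProd r' π := by
    refine sum_congr rfl fun π hπ => prod_congr rfl fun V hV => ?_
    have h2 := card_block_lt (ne_of_mem_erase hπ) hV
    have h3 := card_pos.mpr (π.nonempty_of_mem_parts hV)
    have := ih (#V - 1) (by omega)
    rwa [Nat.sub_add_cancel h3] at this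
  rw [h2] at h1
  exact add_right_cancel h1

theorem momentOfCumulant_congr {r r' : ℕ → ℝ} (h : ∀ n, r (n + 1) = r' (n + 1)) (n : ℕ) :
    momentOfCumulant r n = momentOfCumulant r' n := by
  refine sum_congr rfl fun π _ => prod_congr rfl fun V hV => ?_
  have h3 := card_pos.mpr (π.nonempty_of_mem_parts hV)
  have := h (#V - 1)
  rwa [Nat.sub_add_cancel h3] at this

theorem moment_eq_momentOfCumulant (μ : Measure ℝ) (n : ℕ) :
    moment μ (n + 1) = momentOfCumulant (freeCumulant μ) (n + 1) :=
  moment_cumulant_formula (moment μ) (by omega)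

/-! ### Finite free cumulants and free convolution in the limit -/

section Main

variable {q : ℕ → ℝ[X]}

/-- By induction, the moment of order `n + 1` is an expression in lower cumulants, which has an
expansion, plus the top cumulant times a coefficient tending to 1. Solve for the top cumulant. -/
theorem exists_hasExpansion_finiteFreeCumulant
    (hq : ∀ d, 1 ≤ d → (q d).Monic ∧ (q d).natDegree = d) {m m' : ℕ → ℝ}
    (hm : ∀ n, 1 ≤ n → HasExpansion (fun d => rootMoment d (q d) n) (m n) (m' n)) (n : ℕ) :
    ∃ a b, HasExpansion (fun d => finiteFreeCumulant d (q d) (n + 1)) a b := by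
  induction n using Nat.strong_induction_on with | _ n ih
  choose! A B hAB using ih
  let V : ℕ → ℕ → ℝ := fun d k => if n + 1 ≤ k then 0 else finiteFreeCumulant d (q d) k
  have hV : ∀ k, 1 ≤ k → HasExpansion (fun d => V d k) (if n + 1 ≤ k then 0 else A (k - 1))
      (if n + 1 ≤ k then 0 else B (k - 1)) := by
    intro k hk
    by_cases h : n + 1 ≤ k
    · simpa only [V, if_pos h] using hasExpansion_const 0
    · have := hAB (k - 1) (by omega)
      simpa only [V, if_neg h, Nat.sub_add_cancel hk] using this
  have h1 := hasExpansion_genusSum n (U := fun _ _ => 1) (fun k _ => hasExpansion_const 1) hV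
  have h2 := hasExpansion_genusSum n (U := fun _ _ => 1) (V := fun _ => unitSeq (n + 1))
    (fun k _ => hasExpansion_const 1) (fun k _ => hasExpansion_const (unitSeq (n + 1) k))
  rw [planarSum_one_unitSeq] at h2
  obtain ⟨c, hc⟩ := ((hm (n + 1) (by omega)).sub h1).div h2 one_ne_zero
  refine ⟨_, c, hc.congr' ?_⟩
  filter_upwards [eventually_ge_atTop 1, h2.tendsto.eventually_ne one_ne_zero] with d hd hne
  rw [div_eq_iff hne, rootMoment_eq_genusSum hd (hq d hd).1 (hq d hd).2, genusSum_split]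
  exact add_sub_cancel_left _ _

theorem exists_isCumulantFluctuation
    (hq : ∀ d, 1 ≤ d → (q d).Monic ∧ (q d).natDegree = d) {ν : Measure ℝ} {m' : ℕ → ℝ}
    (hm : ∀ n, 1 ≤ n → HasExpansion (fun d => rootMoment d (q d) n) (moment ν n) (m' n)) :
    ∃ rhat : ℕ → ℝ, ∀ n, 1 ≤ n →
      HasExpansion (fun d => finiteFreeCumulant d (q d) n) (freeCumulant ν n) (rhat n) := by
  choose A B hAB using exists_hasExpansion_finiteFreeCumulant hq hm
  have hAB' : ∀ k, 1 ≤ k →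
      HasExpansion (fun d => finiteFreeCumulant d (q d) k) (A (k - 1)) (B (k - 1)) := by
    intro k hk
    have := hAB (k - 1)
    rwa [Nat.sub_add_cancel hk] at this
  -- The limits satisfy the free moment-cumulant formula for the moments of `ν`, which determines
  -- them.
  have hA : ∀ n, A n = freeCumulant ν (n + 1) := by
    refine eq_of_momentOfCumulant_eq (r := fun k => A (k - 1)) fun n => ?_
    have h1 := tendsto_genusSum n (U := fun _ _ => 1) (fun k _ => tendsto_const_nhds)
      fun k hk => (hAB' k hk).tendsto
    rw [planarSum_one] at h1
    rw [← moment_eq_momentOfCumulant]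
    refine tendsto_nhds_unique h1 ((hm (n + 1) (by omega)).tendsto.congr' ?_)
    filter_upwards [eventually_ge_atTop 1] with d hd
    exact rootMoment_eq_genusSum hd (hq d hd).1 (hq d hd).2 n
  refine ⟨fun k => B (k - 1), fun n hn => ?_⟩
  have := hAB' n hn
  rwa [hA, Nat.sub_add_cancel hn] at this

/-- Both sides are limits of the same moment of `p_d ⊠_d q_d`. One comes from expanding it directly
in moments of `p_d` and cumulants of `q_d`, the other from first computing the cumulants of the
product and then recovering the moment from them. -/
theorem freeMulMoment_eq_planarSum {p : ℕ → ℝ[X]}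
    (hp : ∀ d, 1 ≤ d → (p d).Monic ∧ (p d).natDegree = d)
    (hq : ∀ d, 1 ≤ d → (q d).Monic ∧ (q d).natDegree = d) {μ ν : Measure ℝ}
    (hmp : ∀ n, 1 ≤ n → Tendsto (fun d => rootMoment d (p d) n) atTop (𝓝 (moment μ n)))
    (hκp : ∀ n, 1 ≤ n →
      Tendsto (fun d => finiteFreeCumulant d (p d) n) atTop (𝓝 (freeCumulant μ n)))
    (hκq : ∀ n, 1 ≤ n →
      Tendsto (fun d => finiteFreeCumulant d (q d) n) atTop (𝓝 (freeCumulant ν n))) (n : ℕ) :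
    freeMulMoment μ ν (n + 1) = planarSum (n + 1) (moment μ) (freeCumulant ν) := by
  have hκ : ∀ k, 1 ≤ k → Tendsto (fun d => finiteFreeCumulant d (finiteFreeMul d (p d) (q d)) k)
      atTop (𝓝 (freeMulCumulant μ ν k)) := by
    intro k hk
    obtain ⟨k, rfl⟩ : ∃ j, k = j + 1 := ⟨k - 1, by omega⟩
    refine (tendsto_genusSum k hκp hκq).congr' ?_
    filter_upwards [eventually_ge_atTop 1] with d hd
    exact (finiteFreeCumulant_finiteFreeMul hd (hp d hd).1 (hp d hd).2 (hq d hd).1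
      (hq d hd).2 k).symm
  have h1 := tendsto_genusSum n (U := fun _ _ => 1) (fun k _ => tendsto_const_nhds) hκ
  rw [planarSum_one] at h1
  refine tendsto_nhds_unique h1 ((tendsto_genusSum n hmp hκq).congr' ?_)
  filter_upwards [eventually_ge_atTop 1] with d hd
  obtain ⟨hpm, hpd⟩ := hp d hd
  obtain ⟨hqm, hqd⟩ := hq d hd
  rw [← rootMoment_finiteFreeMul hd hpm hpd hqm hqd, rootMoment_eq_genusSum hd
    (monic_finiteFreeMul hpm hpd hqm hqd) (natDegree_finiteFreeMul hpm hpd hqm hqd)]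

theorem IsFreeMulConv.moment_eq {μ ν ρ : Measure ℝ} (h : IsFreeMulConv μ ν ρ) (n : ℕ) :
    moment ρ (n + 1) = freeMulMoment μ ν (n + 1) := by
  rw [moment_eq_momentOfCumulant, freeMulMoment]
  exact momentOfCumulant_congr (fun k => h.freeCumulant_eq (k + 1) (by omega)) (n + 1)

end Main

end FiniteFree

/-! ### The main theorem -/

open FiniteFree in
theorem mainTheorem3
    (p q : ℕ → ℝ[X])
    (hp : ∀ d : ℕ, 1 ≤ d → p d ∈ MonicRealRooted d)
    (hq : ∀ d : ℕ, 1 ≤ d → q d ∈ MonicRealRooted d)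
    (μ ν : Measure ℝ) (μ' ν' : ℝ[X] →ₗ[ℝ] ℝ)
    (hμ : HasInfinitesimalDistribution p μ μ')
    (hν : HasInfinitesimalDistribution q ν ν') :
    ∃ rhat : ℕ → ℝ, IsCumulantFluctuation q ν rhat ∧
      ∀ n : ℕ, 1 ≤ n →
        ((fun d : ℕ => rootMoment d (finiteFreeMul d (p d) (q d)) n -
            (freeMulMoment μ ν n +
              mulInfinitesimalMoment (moment μ) (fun k => μ' (X ^ k)) (freeCumulant ν) rhat n / d))
          =o[atTop] (fun d : ℕ => 1 / (d : ℝ))) ∧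
        ∀ ρ : Measure ℝ, IsFreeMulConv μ ν ρ → moment ρ n = freeMulMoment μ ν n := by
  have hp' : ∀ d, 1 ≤ d → (p d).Monic ∧ (p d).natDegree = d := fun d hd =>
    ⟨(hp d hd).1, (hp d hd).2.1⟩
  have hq' : ∀ d, 1 ≤ d → (q d).Monic ∧ (q d).natDegree = d := fun d hd =>
    ⟨(hq d hd).1, (hq d hd).2.1⟩
  have hmp : ∀ n, 1 ≤ n → HasExpansion (fun d => rootMoment d (p d) n) (moment μ n) (μ' (X ^ n)) :=
    fun n _ => hμ.tendsto_infinitesimal n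
  -- The cumulants of `p_d` serve only to identify the leading term; the values of `shat` do not
  -- enter the result.
  obtain ⟨shat, hs⟩ := exists_isCumulantFluctuation hp' hmp
  obtain ⟨rhat, hr⟩ := exists_isCumulantFluctuation hq' fun n _ => hν.tendsto_infinitesimal n
  refine ⟨rhat, fun n hn => hasExpansion_iff_isLittleO.mp (hr n hn), fun n hn => ?_⟩
  obtain ⟨n, rfl⟩ : ∃ j, n = j + 1 := ⟨n - 1, by omega⟩
  refine ⟨hasExpansion_iff_isLittleO.mp ?_, fun ρ hρ => hρ.moment_eq n⟩
  rw [freeMulMoment_eq_planarSum hp' hq' (fun k hk => (hmp k hk).tendsto)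
    (fun k hk => (hs k hk).tendsto) (fun k hk => (hr k hk).tendsto)]
  refine (hasExpansion_genusSum n hmp hr).congr' ?_
  filter_upwards [eventually_ge_atTop 1] with d hd
  exact (rootMoment_finiteFreeMul hd (hp' d hd).1 (hp' d hd).2 (hq' d hd).1 (hq' d hd).2 n).symm
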